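/- Let $n\ge 5$ and let $(M^n,g)$ be a smooth Riemannian manifold without boundary (not necessarily complete, compact or connected). Write $\mathrm{Ric}_g$ for the Ricci tensor and $R=R_g$ for the scalar curvature (positive on round spheres), $\nabla^2_g$ for the Hessian and $dV_g$ for the Riemannian volume measure. Suppose that $g$ is a critical metric of the functional $\mathfrak S^2=\int R_g^2\,dV_g$ under compactly supported variations, that is, $$\frac{d}{dt}\Big|_{t=0}\int_K R_{g+th}^2\,dV_{g+th}=0$$ for every compact set $K\subset M$ and every smooth symmetric $2$-tensor field $h$ on $M$ that vanishes outside $K$. Suppose also that $R<0$ everywhere on $M$. Let $k\in\mathbb R$ with $k\ne 0$ and $k\neq \frac1{n-2}$. Then $$\tilde g=|R|^{2k}g \qquad\text{and}\qquad f=\big((n-2)k-1\big)\log|R|$$ are a smooth Riemannian metric and a smooth function on $M$, and they satisfy on all of $M$ $$\mathrm{Ric}_{\tilde g}+\nabla^2_{\tilde g}f-\frac{1+2k-(n-2)k^2}{\big((n-2)k-1\big)^2}\,df\otimes df=\frac{(n-4)k-3}{4(n-1)}\,e^{\frac{1-2k}{(n-2)k-1}f}\,\tilde g .$$ -/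

import Mathlib

open scoped Manifold ContDiff Bundle

noncomputable section

namespace QuadCurv

/-- The model space `ℝⁿ`. -/
abbrev Model (n : ℕ) : Type := EuclideanSpace ℝ (Fin n)

/-- The tangent space `T_pM` of a manifold modelled on `ℝⁿ`. -/
abbrev Tan (n : ℕ) {M : Type*} [TopologicalSpace M] [ChartedSpace (Model n) M] (p : M) : Type :=
  TangentSpace 𝓘(ℝ, Model n) p

/-- (Not necessarily smooth) fields of bilinear forms on the tangent spaces of `M`,
that is, covariant 2-tensor fields. -/
abbrev BilinField (n : ℕ) (M : Type*) [TopologicalSpace M] [ChartedSpace (Model n) M] : Type _ :=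
  ∀ p : M, Tan n p →L[ℝ] Tan n p →L[ℝ] ℝ

/-- Smooth (`C^∞`) Riemannian metrics on `M`. -/
abbrev SmoothMetric (n : ℕ) (M : Type*) [TopologicalSpace M] [ChartedSpace (Model n) M]
    [IsManifold 𝓘(ℝ, Model n) ∞ M] : Type _ :=
  Bundle.ContMDiffRiemannianMetric 𝓘(ℝ, Model n) ∞ (Model n)
    (fun p : M => TangentSpace 𝓘(ℝ, Model n) p)

/-- Smoothness of a covariant 2-tensor field, as a section of the bundle of bilinear forms. -/
def SmoothField {n : ℕ} {M : Type*} [TopologicalSpace M] [ChartedSpace (Model n) M]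
    [IsManifold 𝓘(ℝ, Model n) ∞ M] (h : BilinField n M) : Prop :=
  ContMDiff 𝓘(ℝ, Model n)
    (𝓘(ℝ, Model n).prod 𝓘(ℝ, Model n →L[ℝ] Model n →L[ℝ] ℝ)) ∞
    (fun p : M => Bundle.TotalSpace.mk' (Model n →L[ℝ] Model n →L[ℝ] ℝ)
      (E := fun p : M => Tan n p →L[ℝ] Tan n p →L[ℝ] ℝ) p (h p))

/-! ### Riemannian geometry of an open subset of `ℝⁿ`, from the matrix `G = (G_ij)` of the metric -/

section Coordinates

variable {n : ℕ}

/-- The partial derivative `∂_i F` at `y`. -/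
def pd (i : Fin n) (F : Model n → ℝ) (y : Model n) : ℝ :=
  fderiv ℝ F y (EuclideanSpace.single i 1)

/-- `Γ^k_ij = ½ ∑_l G^{kl} (∂_i G_jl + ∂_j G_il - ∂_l G_ij)`. -/
def christoffel (G : Model n → Matrix (Fin n) (Fin n) ℝ) (k i j : Fin n) (y : Model n) : ℝ :=
  (1 / 2) * ∑ l, (G y)⁻¹ k l *
    (pd i (fun z => G z j l) y + pd j (fun z => G z i l) y - pd l (fun z => G z i j) y)

/-- `Ric_ij = ∑_k (∂_k Γ^k_ij - ∂_i Γ^k_kj) + ∑_{k,l} (Γ^k_kl Γ^l_ij - Γ^k_il Γ^l_kj)`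
(positive on round spheres). -/
def ricciCoord (G : Model n → Matrix (Fin n) (Fin n) ℝ) (i j : Fin n) (y : Model n) : ℝ :=
  ∑ k, (pd k (christoffel G k i j) y - pd i (christoffel G k k j) y) +
    ∑ k, ∑ l, (christoffel G k k l y * christoffel G l i j y -
      christoffel G k i l y * christoffel G l k j y)

/-- `R = ∑_{i,j} G^{ij} Ric_ij`. -/
def scalarCoord (G : Model n → Matrix (Fin n) (Fin n) ℝ) (y : Model n) : ℝ :=
  ∑ i, ∑ j, (G y)⁻¹ i j * ricciCoord G i j y

/-- `(∇²F)_ij = ∂_i ∂_j F - ∑_k Γ^k_ij ∂_k F`. -/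
def hessianCoord (G : Model n → Matrix (Fin n) (Fin n) ℝ) (F : Model n → ℝ) (i j : Fin n)
    (y : Model n) : ℝ :=
  pd i (pd j F) y - ∑ k, christoffel G k i j y * pd k F y

end Coordinates

/-! ### Riemannian geometry of a manifold, through its charts -/

section Manifold

variable {n : ℕ} {M : Type*} [TopologicalSpace M] [ChartedSpace (Model n) M]

/-- The coordinate vector field `∂/∂x_i` of the chart at `p`, at the point with coordinates `y`. -/
def coordVec (p : M) (i : Fin n) (y : Model n) :
    Tan n ((extChartAt 𝓘(ℝ, Model n) p).symm y) :=
  mfderiv 𝓘(ℝ, Model n) 𝓘(ℝ, Model n) (extChartAt 𝓘(ℝ, Model n) p).symm y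
    (EuclideanSpace.single i (1 : ℝ) : Model n)

/-- The matrix `g_ij = g(∂/∂x_i, ∂/∂x_j)` of `g` in the chart at `p`. -/
def gram (g : BilinField n M) (p : M) (y : Model n) : Matrix (Fin n) (Fin n) ℝ :=
  Matrix.of fun i j =>
    g ((extChartAt 𝓘(ℝ, Model n) p).symm y) (coordVec p i y) (coordVec p j y)

/-- The `i`-th component `dx_i(v)` of a tangent vector `v ∈ T_pM` in the chart at `p`. -/
def comp (p : M) (v : Tan n p) (i : Fin n) : ℝ :=
  (show Model n from
    mfderiv 𝓘(ℝ, Model n) 𝓘(ℝ, Model n) (extChartAt 𝓘(ℝ, Model n) p) p v) i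

/-- The Ricci tensor `Ric_g(v, w)` at `p`. -/
def ricci (g : BilinField n M) (p : M) (v w : Tan n p) : ℝ :=
  ∑ i, ∑ j, ricciCoord (gram g p) i j (extChartAt 𝓘(ℝ, Model n) p p) * comp p v i * comp p w j

/-- The scalar curvature `R_g` at `p`. -/
def scalarCurv (g : BilinField n M) (p : M) : ℝ :=
  scalarCoord (gram g p) (extChartAt 𝓘(ℝ, Model n) p p)

/-- The Hessian `∇²_g f (v, w)` at `p`. -/
def hessian (g : BilinField n M) (f : M → ℝ) (p : M) (v w : Tan n p) : ℝ :=
  ∑ i, ∑ j, hessianCoord (gram g p) (f ∘ (extChartAt 𝓘(ℝ, Model n) p).symm) i j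
    (extChartAt 𝓘(ℝ, Model n) p p) * comp p v i * comp p w j

/-- The differential `df(v)` at `p`. -/
def diff (f : M → ℝ) (p : M) (v : Tan n p) : ℝ :=
  mfderiv 𝓘(ℝ, Model n) 𝓘(ℝ, ℝ) f p v

variable [MeasurableSpace M]

/-- The measure `√(det g_ij) dx` of the chart at `p`, carried by the domain of that chart. -/
def chartVolume (g : BilinField n M) (p : M) : MeasureTheory.Measure M :=
  MeasureTheory.Measure.map (extChartAt 𝓘(ℝ, Model n) p).symm
    ((MeasureTheory.volume.restrict (extChartAt 𝓘(ℝ, Model n) p).target).withDensity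
      fun y => ENNReal.ofReal (Real.sqrt (gram g p y).det))

/-- The Riemannian volume measure `dV_g`: it restricts to `√(det g_ij) dx` on every chart domain,
and as such it is the supremum, in the lattice of measures, of these restrictions. -/
def riemVolume (g : BilinField n M) : MeasureTheory.Measure M :=
  ⨆ p : M, chartVolume g p

/-- The part `∫_K R_g² dV_g` over a set `K` of the functional `∫ R_g² dV_g`. -/
def energyOn (K : Set M) (g : BilinField n M) : ℝ :=
  ∫ p in K, scalarCurv g p ^ 2 ∂(riemVolume g)

/-- `g` is a critical metric of `∫ R_g² dV_g` (under variations with compact support): for every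
smooth symmetric 2-tensor field `h` that vanishes outside a compact set `K`,
`d/dt ∫_K R² dV` at `g + t h` is zero for `t = 0`. As `g + t h = g` outside `K`, and as the total
integral over `M` may be infinite, the integral is taken over `K`. -/
def IsCritical [IsManifold 𝓘(ℝ, Model n) ∞ M] (g : SmoothMetric n M) : Prop :=
  ∀ h : BilinField n M, SmoothField h → (∀ p v w, h p v w = h p w v) →
    ∀ K : Set M, IsCompact K → (∀ p, p ∉ K → h p = 0) →
      HasDerivAt (fun t : ℝ => energyOn K (fun p => g.inner p + t • h p)) 0 0

end Manifold

end QuadCurv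

end

/-! Criticality gives the Euler-Lagrange equation R Ric = ∇²R + (R²/4 − ΔR) g. A conformal change
then turns this equation into the claim by algebra.

The algebra (`quasiEinstein_coord`). Tracing gives 4(n−1) ΔR = (n−4) R². As R has no zeros, one may
divide by R: Ric is ∇²R/R plus a multiple of g. Put φ = k log|R|, so that the new metric is e^{2φ}
g, and f = c log|R| with c = (n−2)k − 1. In the sum of the new Ricci tensor and the new Hessian of
f, the coefficient of ∇²R/R is 1 − (n−2)k + c = 0, which is what dictates c. With this c the
coefficient of (|∇R|²/R²) g, namely k − (n−2)k² + kc, vanishes as well. There remain (1 + 2k −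
(n−2)k²) dR⊗dR/R², a constant multiple of df⊗df, and a multiple of R g whose constant comes from the
traced equation. The sign of R enters through |R| = −R and e^{(1−2k)f/c} |R|^{2k} = |R|.

The Euler-Lagrange equation is local, so it is tested in one chart with h = u ℓ⊗ℓ, where u is a
compactly supported function and ℓ a constant covector with dual vector X. Such rank-one directions
suffice, because a symmetric tensor is determined by its quadratic form. Along them δR = −u Ric(X,X)
+ div V, where V is the Palatini field of the variation of the Christoffel symbols. The integration
by parts of 2R div V is carried out pointwise: an explicit field, `variationField`, collects
everything that is a divergence, and the derivative of R² √det becomes u √det E(X,X) plus a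
divergence with compact support (`hasDerivAt_scalarCoord_sq_mul_density`). Integration kills the
divergence, and the fundamental lemma of the calculus of variations gives E = 0
(`eulerLagrange_eq_zero`).

The passage between manifold and charts needs invariance: curvature at a point is defined through
the chart at that very point, and the volume is a supremum of chart measures, while the variation
lives in one fixed chart. Hence `scalarCoord_comp`, `chartVolume_apply_eq` and `energyOn_eq`.
Invariance and the conformal formulas are proved without indices, for Levi-Civita connections on
open subsets of a normed space, with the Ricci tensor as the trace of `riemEnd`. The variational
computation is done with indices, where the density √det lives. -/

noncomputable section

namespace QuadCurv

set_option maxSynthPendingDepth 3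

/-! ### Partial derivatives, and families of functions depending smoothly on a parameter -/

section Calculus

variable {n : ℕ}

theorem pd_congr {i : Fin n} {F K : Model n → ℝ} {y : Model n} (h : F =ᶠ[nhds y] K) :
    pd i F y = pd i K y := by
  unfold pd; rw [h.fderiv_eq]

theorem pd_const (i : Fin n) (c : ℝ) (y : Model n) : pd i (fun _ => c) y = 0 := by
  simp [pd]

theorem pd_sub {i : Fin n} {F K : Model n → ℝ} {y : Model n}
    (hF : DifferentiableAt ℝ F y) (hK : DifferentiableAt ℝ K y) :
    pd i (fun z => F z - K z) y = pd i F y - pd i K y := by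
  unfold pd; rw [fderiv_fun_sub hF hK]; rfl

theorem pd_mul {i : Fin n} {F K : Model n → ℝ} {y : Model n}
    (hF : DifferentiableAt ℝ F y) (hK : DifferentiableAt ℝ K y) :
    pd i (fun z => F z * K z) y = F y * pd i K y + pd i F y * K y := by
  unfold pd; rw [fderiv_fun_mul hF hK]; simp [mul_comm]

theorem pd_const_mul {i : Fin n} {F : Model n → ℝ} {y : Model n} (c : ℝ)
    (hF : DifferentiableAt ℝ F y) :
    pd i (fun z => c * F z) y = c * pd i F y := by
  rw [pd_mul (differentiableAt_const c) hF, pd_const]; ring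

theorem pd_sum {ι : Type*} {i : Fin n} {s : Finset ι} {F : ι → Model n → ℝ} {y : Model n}
    (hF : ∀ a ∈ s, DifferentiableAt ℝ (F a) y) :
    pd i (fun z => ∑ a ∈ s, F a z) y = ∑ a ∈ s, pd i (F a) y := by
  unfold pd; rw [fderiv_fun_sum hF]; simp

theorem pd_comp {i : Fin n} {F : Model n → ℝ} {y : Model n} {q : ℝ → ℝ} {q' : ℝ}
    (hq : HasDerivAt q q' (F y)) (hF : DifferentiableAt ℝ F y) :
    pd i (fun z => q (F z)) y = q' * pd i F y := by
  unfold pd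
  have := hq.comp_hasFDerivAt y hF.hasFDerivAt
  rw [HasFDerivAt.fderiv (f := fun z => q (F z)) this]; simp

theorem contDiffOn_pd {U : Set (Model n)} (hU : IsOpen U) {F : Model n → ℝ}
    (hF : ContDiffOn ℝ ∞ F U) (i : Fin n) : ContDiffOn ℝ ∞ (pd i F) U := by
  unfold pd
  exact (hF.fderiv_of_isOpen hU (by simp)).clm_apply contDiffOn_const

theorem differentiableAt_of_contDiffOn {V : Type*} [NormedAddCommGroup V] [NormedSpace ℝ V]
    {W : Type*} [NormedAddCommGroup W] [NormedSpace ℝ W] {U : Set V} (hU : IsOpen U) {F : V → W}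
    (hF : ContDiffOn ℝ ∞ F U) {y : V} (hy : y ∈ U) : DifferentiableAt ℝ F y :=
  (hF.contDiffAt (hU.mem_nhds hy)).differentiableAt (by simp)

theorem pd_comm {U : Set (Model n)} (hU : IsOpen U) {F : Model n → ℝ}
    (hF : ContDiffOn ℝ ∞ F U) (i j : Fin n) {y : Model n} (hy : y ∈ U) :
    pd i (pd j F) y = pd j (pd i F) y := by
  have hd : DifferentiableAt ℝ (fderiv ℝ F) y :=
    differentiableAt_of_contDiffOn hU (hF.fderiv_of_isOpen hU (by simp)) hy
  have hs : IsSymmSndFDerivAt ℝ F y :=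
    (hF.contDiffAt (hU.mem_nhds hy)).isSymmSndFDerivAt (by simpa using ENat.LEInfty.out)
  unfold pd
  rw [fderiv_clm_apply hd (differentiableAt_const _),
    fderiv_clm_apply hd (differentiableAt_const _)]
  simpa using hs.eq _ _

/-- A family `F t` of functions that is smooth in `(t, y)` on `W`. -/
def SmoothFamily (W : Set (ℝ × Model n)) (F : ℝ → Model n → ℝ) : Prop :=
  ContDiffOn ℝ ∞ (fun q : ℝ × Model n => F q.1 q.2) W

namespace SmoothFamily

variable {W : Set (ℝ × Model n)} {F K : ℝ → Model n → ℝ}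

theorem const (c : ℝ) : SmoothFamily W (fun _ (_ : Model n) => c) := contDiffOn_const

theorem add (hF : SmoothFamily W F) (hK : SmoothFamily W K) :
    SmoothFamily W (fun t y => F t y + K t y) := ContDiffOn.add hF hK

theorem sub (hF : SmoothFamily W F) (hK : SmoothFamily W K) :
    SmoothFamily W (fun t y => F t y - K t y) := ContDiffOn.sub hF hK

theorem mul (hF : SmoothFamily W F) (hK : SmoothFamily W K) :
    SmoothFamily W (fun t y => F t y * K t y) := ContDiffOn.mul hF hK

theorem sum {ι : Type*} {s : Finset ι} {F : ι → ℝ → Model n → ℝ}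
    (hF : ∀ a, SmoothFamily W (F a)) : SmoothFamily W (fun t y => ∑ a ∈ s, F a t y) :=
  ContDiffOn.sum fun a _ => hF a

theorem hasFDerivAt_slice (hW : IsOpen W) (hF : SmoothFamily W F) {t : ℝ} {y : Model n}
    (h : (t, y) ∈ W) :
    HasFDerivAt (F t) ((fderiv ℝ (fun q : ℝ × Model n => F q.1 q.2) (t, y)).comp
      (ContinuousLinearMap.inr ℝ ℝ (Model n))) y :=
  (differentiableAt_of_contDiffOn hW hF h).hasFDerivAt.comp y (hasFDerivAt_prodMk_right t y)

theorem pd_eq (hW : IsOpen W) (hF : SmoothFamily W F) {t : ℝ} {y : Model n}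
    (h : (t, y) ∈ W) (i : Fin n) :
    QuadCurv.pd i (F t) y = fderiv ℝ (fun q : ℝ × Model n => F q.1 q.2) (t, y)
      (0, EuclideanSpace.single i 1) := by
  unfold QuadCurv.pd
  rw [(hF.hasFDerivAt_slice hW h).fderiv]; rfl

theorem hasDerivAt_time (hW : IsOpen W) (hF : SmoothFamily W F) {t : ℝ} {y : Model n}
    (h : (t, y) ∈ W) :
    HasDerivAt (fun s => F s y)
      (fderiv ℝ (fun q : ℝ × Model n => F q.1 q.2) (t, y) (1, 0)) t := by
  have h1 : HasDerivAt (fun s : ℝ => (s, y)) ((1 : ℝ), (0 : Model n)) t :=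
    (hasDerivAt_id t).prodMk (hasDerivAt_const t y)
  exact (differentiableAt_of_contDiffOn hW hF h).hasFDerivAt.comp_hasDerivAt t h1

theorem pd (hW : IsOpen W) (hF : SmoothFamily W F) (i : Fin n) :
    SmoothFamily W (fun t => QuadCurv.pd i (F t)) := by
  have : ContDiffOn ℝ ∞ (fun q : ℝ × Model n => fderiv ℝ (fun q : ℝ × Model n => F q.1 q.2) q
      (0, EuclideanSpace.single i 1)) W :=
    (ContDiffOn.fderiv_of_isOpen hF hW (by simp)).clm_apply contDiffOn_const
  exact this.congr fun q hq => hF.pd_eq hW hq i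

theorem time (hW : IsOpen W) (hF : SmoothFamily W F) :
    SmoothFamily W (fun t y => deriv (fun s => F s y) t) := by
  have : ContDiffOn ℝ ∞ (fun q : ℝ × Model n => fderiv ℝ (fun q : ℝ × Model n => F q.1 q.2) q
      (1, 0)) W :=
    (ContDiffOn.fderiv_of_isOpen hF hW (by simp)).clm_apply contDiffOn_const
  exact this.congr fun q hq => (hF.hasDerivAt_time hW hq).deriv

theorem slice (hF : SmoothFamily W F) {t : ℝ} {U : Set (Model n)}
    (h : ∀ y ∈ U, (t, y) ∈ W) : ContDiffOn ℝ ∞ (F t) U :=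
  ContDiffOn.comp (g := fun q : ℝ × Model n => F q.1 q.2) hF
    (contDiff_prodMk_right t).contDiffOn h

theorem of_contDiffOn {U : Set (Model n)} {F : Model n → ℝ} (hF : ContDiffOn ℝ ∞ F U)
    (h : ∀ q ∈ W, q.2 ∈ U) : SmoothFamily W (fun _ => F) :=
  hF.comp contDiff_snd.contDiffOn h

/-- The time derivative commutes with the partial derivatives in space. -/
theorem hasDerivAt_pd (hW : IsOpen W) (hF : SmoothFamily W F) {t : ℝ} {y : Model n}
    (h : (t, y) ∈ W) (i : Fin n) :
    HasDerivAt (fun s => QuadCurv.pd i (F s) y)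
      (QuadCurv.pd i (fun z => deriv (fun s => F s z) t) y) t := by
  have h1 := (hF.pd hW i).hasDerivAt_time hW h
  convert h1 using 1
  rw [(hF.time hW).pd_eq hW h i]
  have hd : DifferentiableAt ℝ (fderiv ℝ fun q : ℝ × Model n => F q.1 q.2) (t, y) :=
    differentiableAt_of_contDiffOn hW (ContDiffOn.fderiv_of_isOpen hF hW (by simp)) h
  -- Both mixed derivatives are values of the second derivative of the joint function of (t, y), at
  -- (1, 0) and (0, e_i), so its symmetry exchanges them.
  have hs : IsSymmSndFDerivAt ℝ (fun q : ℝ × Model n => F q.1 q.2) (t, y) :=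
    (hF.contDiffAt (hW.mem_nhds h)).isSymmSndFDerivAt (by simpa using ENat.LEInfty.out)
  have e1 : (fun q : ℝ × Model n => deriv (fun s => F s q.2) q.1) =ᶠ[nhds (t, y)]
      fun q => fderiv ℝ (fun q : ℝ × Model n => F q.1 q.2) q (1, 0) :=
    Filter.eventually_of_mem (hW.mem_nhds h) fun q hq => (hF.hasDerivAt_time hW hq).deriv
  have e2 : (fun q : ℝ × Model n => QuadCurv.pd i (F q.1) q.2) =ᶠ[nhds (t, y)]
      fun q => fderiv ℝ (fun q : ℝ × Model n => F q.1 q.2) q (0, EuclideanSpace.single i 1) :=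
    Filter.eventually_of_mem (hW.mem_nhds h) fun q hq => hF.pd_eq hW hq i
  rw [e1.fderiv_eq, e2.fderiv_eq, fderiv_clm_apply hd (differentiableAt_const _),
    fderiv_clm_apply hd (differentiableAt_const _)]
  simpa using (hs.eq _ _)

end SmoothFamily

theorem contDiffOn_det {V : Type*} [NormedAddCommGroup V] [NormedSpace ℝ V] {ι : Type*}
    [Fintype ι] [DecidableEq ι] {U : Set V} {A : V → Matrix ι ι ℝ}
    (hA : ∀ i j, ContDiffOn ℝ ∞ (fun x => A x i j) U) :
    ContDiffOn ℝ ∞ (fun x => (A x).det) U := by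
  simp only [Matrix.det_apply]
  exact ContDiffOn.sum fun σ _ => (contDiffOn_prod fun i _ => hA _ _).const_smul _

theorem contDiffOn_inv {V : Type*} [NormedAddCommGroup V] [NormedSpace ℝ V] {ι : Type*}
    [Fintype ι] [DecidableEq ι] {U : Set V} {A : V → Matrix ι ι ℝ}
    (hA : ∀ i j, ContDiffOn ℝ ∞ (fun x => A x i j) U) (hd : ∀ x ∈ U, (A x).det ≠ 0) (i j : ι) :
    ContDiffOn ℝ ∞ (fun x => (A x)⁻¹ i j) U := by
  simp only [Matrix.inv_def, Ring.inverse_eq_inv', Matrix.smul_apply, smul_eq_mul,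
    Matrix.adjugate_apply]
  refine ((contDiffOn_det hA).inv hd).mul (contDiffOn_det fun a b => ?_)
  simp only [Matrix.updateRow_apply]
  split_ifs
  · exact contDiffOn_const
  · exact hA _ _

end Calculus

/-! ### Smooth dependence of the curvature on a family of metrics -/

section Families

variable {n : ℕ} {W : Set (ℝ × Model n)} {G : ℝ → Model n → Matrix (Fin n) (Fin n) ℝ}

theorem SmoothFamily.inv (hG : ∀ i j, SmoothFamily W fun t y => G t y i j)
    (hd : ∀ q ∈ W, (G q.1 q.2).det ≠ 0) (i j : Fin n) :
    SmoothFamily W fun t y => (G t y)⁻¹ i j := contDiffOn_inv hG hd i j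

theorem SmoothFamily.christoffel (hW : IsOpen W) (hG : ∀ i j, SmoothFamily W fun t y => G t y i j)
    (hd : ∀ q ∈ W, (G q.1 q.2).det ≠ 0) (k i j : Fin n) :
    SmoothFamily W fun t => QuadCurv.christoffel (G t) k i j := by
  unfold QuadCurv.christoffel
  exact (const _).mul <| sum fun l => (inv hG hd k l).mul <|
    (((hG j l).pd hW i).add ((hG i l).pd hW j)).sub ((hG i j).pd hW l)

theorem SmoothFamily.ricciCoord (hW : IsOpen W) (hG : ∀ i j, SmoothFamily W fun t y => G t y i j)
    (hd : ∀ q ∈ W, (G q.1 q.2).det ≠ 0) (i j : Fin n) :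
    SmoothFamily W fun t => QuadCurv.ricciCoord (G t) i j := by
  unfold QuadCurv.ricciCoord
  have hΓ := SmoothFamily.christoffel hW hG hd
  exact (sum fun k => ((hΓ k i j).pd hW k).sub ((hΓ k k j).pd hW i)).add <|
    sum fun k => sum fun l => ((hΓ k k l).mul (hΓ l i j)).sub ((hΓ k i l).mul (hΓ l k j))

theorem SmoothFamily.scalarCoord (hW : IsOpen W) (hG : ∀ i j, SmoothFamily W fun t y => G t y i j)
    (hd : ∀ q ∈ W, (G q.1 q.2).det ≠ 0) :
    SmoothFamily W fun t => QuadCurv.scalarCoord (G t) := by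
  unfold QuadCurv.scalarCoord
  exact sum fun i => sum fun j => (inv hG hd i j).mul (SmoothFamily.ricciCoord hW hG hd i j)

end Families

/-- The matrix of a (pseudo-)Riemannian metric with smooth coefficients on `U`. -/
structure MetricOn {n : ℕ} (U : Set (Model n)) (G : Model n → Matrix (Fin n) (Fin n) ℝ) :
    Prop where
  smooth : ∀ i j, ContDiffOn ℝ ∞ (fun y => G y i j) U
  symm : ∀ y ∈ U, (G y).IsSymm
  det_ne : ∀ y ∈ U, (G y).det ≠ 0

/-! ### Elementary properties of a metric on a coordinate domain -/

namespace MetricOn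

variable {n : ℕ} {U : Set (Model n)} {G : Model n → Matrix (Fin n) (Fin n) ℝ}

theorem mono (h : MetricOn U G) {V : Set (Model n)} (hV : V ⊆ U) : MetricOn V G :=
  ⟨fun i j => (h.smooth i j).mono hV, fun y hy => h.symm y (hV hy),
    fun y hy => h.det_ne y (hV hy)⟩

theorem apply_comm (h : MetricOn U G) {y : Model n} (hy : y ∈ U) (i j : Fin n) :
    G y i j = G y j i := (h.symm y hy).apply j i

theorem inv_comm (h : MetricOn U G) {y : Model n} (hy : y ∈ U) (i j : Fin n) :
    (G y)⁻¹ i j = (G y)⁻¹ j i := by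
  have : ((G y)⁻¹).IsSymm := by
    rw [Matrix.IsSymm, Matrix.transpose_nonsing_inv, (h.symm y hy).eq]
  exact this.apply j i

theorem inv_smooth (h : MetricOn U G) (i j : Fin n) :
    ContDiffOn ℝ ∞ (fun y => (G y)⁻¹ i j) U := contDiffOn_inv h.smooth h.det_ne i j

/-- A fixed metric is a constant family, so the smoothness results for families also serve for
single metrics. -/
theorem family (h : MetricOn U G) (i j : Fin n) :
    SmoothFamily (Set.univ ×ˢ U) fun _ y => G y i j :=
  SmoothFamily.of_contDiffOn (h.smooth i j) fun _ hq => hq.2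

theorem christoffel_smooth (h : MetricOn U G) (hU : IsOpen U) (k i j : Fin n) :
    ContDiffOn ℝ ∞ (christoffel G k i j) U :=
  (SmoothFamily.christoffel (G := fun _ => G) (isOpen_univ.prod hU) h.family
    (fun _ hq => h.det_ne _ hq.2) k i j).slice (t := 0) fun _ hy => ⟨trivial, hy⟩

theorem ricciCoord_smooth (h : MetricOn U G) (hU : IsOpen U) (i j : Fin n) :
    ContDiffOn ℝ ∞ (ricciCoord G i j) U :=
  (SmoothFamily.ricciCoord (G := fun _ => G) (isOpen_univ.prod hU) h.family
    (fun _ hq => h.det_ne _ hq.2) i j).slice (t := 0) fun _ hy => ⟨trivial, hy⟩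

theorem scalarCoord_smooth (h : MetricOn U G) (hU : IsOpen U) :
    ContDiffOn ℝ ∞ (scalarCoord G) U :=
  (SmoothFamily.scalarCoord (G := fun _ => G) (isOpen_univ.prod hU) h.family
    (fun _ hq => h.det_ne _ hq.2)).slice (t := 0) fun _ hy => ⟨trivial, hy⟩

theorem inv_mul_cancel (h : MetricOn U G) {y : Model n} (hy : y ∈ U) : (G y)⁻¹ * G y = 1 :=
  Matrix.nonsing_inv_mul _ (isUnit_iff_ne_zero.2 (h.det_ne y hy))

theorem mul_inv_cancel (h : MetricOn U G) {y : Model n} (hy : y ∈ U) : G y * (G y)⁻¹ = 1 :=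
  Matrix.mul_nonsing_inv _ (isUnit_iff_ne_zero.2 (h.det_ne y hy))

theorem christoffel_comm (h : MetricOn U G) (hU : IsOpen U) {y : Model n} (hy : y ∈ U)
    (k i j : Fin n) : christoffel G k i j y = christoffel G k j i y := by
  unfold christoffel
  congr 1
  refine Finset.sum_congr rfl fun l _ => ?_
  rw [pd_congr (i := l) (F := fun z => G z i j) (K := fun z => G z j i)
    (Filter.eventually_of_mem (hU.mem_nhds hy) fun z hz => h.apply_comm hz i j)]
  ring

/-- The Christoffel symbols of the first kind. -/
theorem sum_mul_christoffel (h : MetricOn U G) {y : Model n} (hy : y ∈ U)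
    (l i j : Fin n) : ∑ k, G y l k * christoffel G k i j y =
      (1 / 2) * (pd i (fun z => G z j l) y + pd j (fun z => G z i l) y
        - pd l (fun z => G z i j) y) := by
  set c : Fin n → ℝ := fun l => pd i (fun z => G z j l) y + pd j (fun z => G z i l) y
        - pd l (fun z => G z i j) y with hc
  have h1 : (fun k => christoffel G k i j y) = (1 / 2 : ℝ) • Matrix.mulVec (G y)⁻¹ c := by
    ext k; simp [christoffel, Matrix.mulVec, dotProduct, hc]
  have h2 : ∑ k, G y l k * christoffel G k i j y
      = Matrix.mulVec (G y) (fun k => christoffel G k i j y) l := rfl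
  rw [h2, h1, Matrix.mulVec_smul, Matrix.mulVec_mulVec, h.mul_inv_cancel hy]
  simp [hc]

end MetricOn

/-! ### Metrics, connections and curvature on open subsets of a vector space -/

section LeviCivita

variable {E : Type*} [NormedAddCommGroup E] [NormedSpace ℝ E]

theorem fderiv_apply_apply {V₁ V₂ V₃ X : Type*} [NormedAddCommGroup V₁] [NormedSpace ℝ V₁]
    [NormedAddCommGroup V₂] [NormedSpace ℝ V₂] [NormedAddCommGroup V₃] [NormedSpace ℝ V₃]
    [NormedAddCommGroup X] [NormedSpace ℝ X]
    {F : X → V₁ →L[ℝ] V₂ →L[ℝ] V₃} {y : X} (hF : DifferentiableAt ℝ F y) (z : X) (v : V₁)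
    (w : V₂) : fderiv ℝ F y z v w = fderiv ℝ (fun x => F x v w) y z := by
  rw [fderiv_clm_apply (hF.clm_apply (differentiableAt_const v)) (differentiableAt_const w),
    fderiv_clm_apply hF (differentiableAt_const v)]
  simp

/-- `Γ` is the Levi-Civita connection of the metric `B` on the open set `U`. -/
structure IsLeviCivita (U : Set E) (B : E → E →L[ℝ] E →L[ℝ] ℝ) (Γ : E → E →L[ℝ] E →L[ℝ] E) :
    Prop where
  isOpen : IsOpen U
  smooth : ContDiffOn ℝ ∞ B U
  smooth_conn : ContDiffOn ℝ ∞ Γ U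
  symm : ∀ y ∈ U, ∀ v w, B y v w = B y w v
  nondeg : ∀ y ∈ U, ∀ v, (∀ w, B y v w = 0) → v = 0
  conn_symm : ∀ y ∈ U, ∀ v w, Γ y v w = Γ y w v
  koszul : ∀ y ∈ U, ∀ v w z, B y (Γ y v w) z =
    (1 / 2) * (fderiv ℝ B y v w z + fderiv ℝ B y w v z - fderiv ℝ B y z v w)

/-- The endomorphism `z ↦ R(z, v) w`. -/
def riemEnd (Γ : E → E →L[ℝ] E →L[ℝ] E) (y v w : E) : E →L[ℝ] E :=
  ((fderiv ℝ Γ y).flip v).flip w - (fderiv ℝ Γ y v).flip w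
    + (Γ y).flip (Γ y v w) - (Γ y v).comp ((Γ y).flip w)

theorem riemEnd_apply (Γ : E → E →L[ℝ] E →L[ℝ] E) (y v w z : E) :
    riemEnd Γ y v w z = fderiv ℝ Γ y z v w - fderiv ℝ Γ y v z w
      + Γ y z (Γ y v w) - Γ y v (Γ y z w) := rfl

namespace IsLeviCivita

variable {U : Set E} {B : E → E →L[ℝ] E →L[ℝ] ℝ} {Γ : E → E →L[ℝ] E →L[ℝ] E}

theorem ext_metric (h : IsLeviCivita U B Γ) {y : E} (hy : y ∈ U) {v v' : E}
    (e : ∀ w, B y v w = B y v' w) : v = v' := by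
  rw [← sub_eq_zero]
  exact h.nondeg y hy _ fun w => by simp [e w]

theorem hasFDerivAt (h : IsLeviCivita U B Γ) {y : E} (hy : y ∈ U) :
    HasFDerivAt B (fderiv ℝ B y) y :=
  (differentiableAt_of_contDiffOn h.isOpen h.smooth hy).hasFDerivAt

theorem hasFDerivAt_conn (h : IsLeviCivita U B Γ) {y : E} (hy : y ∈ U) :
    HasFDerivAt Γ (fderiv ℝ Γ y) y :=
  (differentiableAt_of_contDiffOn h.isOpen h.smooth_conn hy).hasFDerivAt

theorem fderiv_comm (h : IsLeviCivita U B Γ) {y : E} (hy : y ∈ U) (z v w : E) :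
    fderiv ℝ B y z v w = fderiv ℝ B y z w v := by
  have hd := (h.hasFDerivAt hy).differentiableAt
  rw [fderiv_apply_apply hd, fderiv_apply_apply hd]
  rw [Filter.EventuallyEq.fderiv_eq (Filter.eventually_of_mem (h.isOpen.mem_nhds hy)
    fun x hx => h.symm x hx v w)]

/-- The Levi-Civita connection is metric. -/
theorem fderiv_eq (h : IsLeviCivita U B Γ) {y : E} (hy : y ∈ U) (z v w : E) :
    fderiv ℝ B y z v w = B y (Γ y z v) w + B y v (Γ y z w) := by
  rw [h.symm y hy v, h.koszul y hy, h.koszul y hy,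
    h.fderiv_comm hy z w v, h.fderiv_comm hy v z w, h.fderiv_comm hy w z v]
  ring

end IsLeviCivita

end LeviCivita

/-! ### Invariance of the curvature under changes of coordinates -/

section CoordChange

variable {E : Type*} [NormedAddCommGroup E] [NormedSpace ℝ E]

/-- `B'` is the pullback of the metric `B` under the smooth map `τ : V → U`, and `Γ`, `Γ'` are
the Levi-Civita connections. -/
structure IsPullback (U V : Set E) (τ : E → E) (B : E → E →L[ℝ] E →L[ℝ] ℝ)
    (Γ : E → E →L[ℝ] E →L[ℝ] E) (B' : E → E →L[ℝ] E →L[ℝ] ℝ) (Γ' : E → E →L[ℝ] E →L[ℝ] E) :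
    Prop where
  source : IsLeviCivita V B' Γ'
  target : IsLeviCivita U B Γ
  smooth : ContDiffOn ℝ ∞ τ V
  mapsTo : Set.MapsTo τ V U
  metric_eq : ∀ x ∈ V, ∀ v w, B' x v w = B (τ x) (fderiv ℝ τ x v) (fderiv ℝ τ x w)

namespace IsPullback

variable {U V : Set E} {B B' : E → E →L[ℝ] E →L[ℝ] ℝ} {Γ Γ' : E → E →L[ℝ] E →L[ℝ] E}
  {τ : E → E}

theorem hasFDerivAt (h : IsPullback U V τ B Γ B' Γ') {x : E} (hx : x ∈ V) :
    HasFDerivAt τ (fderiv ℝ τ x) x :=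
  (differentiableAt_of_contDiffOn h.source.isOpen h.smooth hx).hasFDerivAt

theorem fderiv_smooth (h : IsPullback U V τ B Γ B' Γ') : ContDiffOn ℝ ∞ (fderiv ℝ τ) V :=
  h.smooth.fderiv_of_isOpen h.source.isOpen (by simp)

theorem hasFDerivAt_fderiv (h : IsPullback U V τ B Γ B' Γ') {x : E} (hx : x ∈ V) :
    HasFDerivAt (fderiv ℝ τ) (fderiv ℝ (fderiv ℝ τ) x) x :=
  (differentiableAt_of_contDiffOn h.source.isOpen h.fderiv_smooth hx).hasFDerivAt

/-- The kernel of dτ lies in the radical of the pulled-back metric, which is trivial. -/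
theorem injective (h : IsPullback U V τ B Γ B' Γ') {x : E} (hx : x ∈ V) :
    Function.Injective (fderiv ℝ τ x) := by
  rw [injective_iff_map_eq_zero]
  intro v hv
  exact h.source.nondeg x hx _ fun w => by rw [h.metric_eq x hx, hv]; simp

theorem second_symm (h : IsPullback U V τ B Γ B' Γ') {x : E} (hx : x ∈ V) (v w : E) :
    fderiv ℝ (fderiv ℝ τ) x v w = fderiv ℝ (fderiv ℝ τ) x w v :=
  ((h.smooth.contDiffAt (h.source.isOpen.mem_nhds hx)).isSymmSndFDerivAt
    (by simpa using ENat.LEInfty.out)).eq v w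

theorem fderiv_metric_eq (h : IsPullback U V τ B Γ B' Γ') {x : E} (hx : x ∈ V) (z v w : E) :
    fderiv ℝ B' x z v w =
      fderiv ℝ B (τ x) (fderiv ℝ τ x z) (fderiv ℝ τ x v) (fderiv ℝ τ x w)
      + B (τ x) (fderiv ℝ (fderiv ℝ τ) x z v) (fderiv ℝ τ x w)
      + B (τ x) (fderiv ℝ τ x v) (fderiv ℝ (fderiv ℝ τ) x z w) := by
  rw [fderiv_apply_apply (h.source.hasFDerivAt hx).differentiableAt]
  rw [Filter.EventuallyEq.fderiv_eq (Filter.eventually_of_mem (h.source.isOpen.mem_nhds hx)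
    fun x hx => h.metric_eq x hx v w)]
  have hB := h.target.hasFDerivAt (h.mapsTo hx)
  have hJ := fun u : E => (h.hasFDerivAt_fderiv hx).clm_apply (hasFDerivAt_const u x)
  have h1 : HasFDerivAt (fun y => B (τ y)) ((fderiv ℝ B (τ x)).comp (fderiv ℝ τ x)) x :=
    hB.comp x (h.hasFDerivAt hx)
  have h2 := h1.clm_apply (hJ v)
  have h3 := h2.clm_apply (hJ w)
  rw [h3.fderiv]
  simp
  ring

variable [FiniteDimensional ℝ E]

/-- The transformation law of a connection. In finite dimension the injective dτ is onto, so it is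
enough to pair with vectors dτ z. There both sides are given by Koszul formulas, and differentiating
the pulled-back metric produces the second derivatives of τ. -/
theorem conn_eq (h : IsPullback U V τ B Γ B' Γ') {x : E} (hx : x ∈ V) (v w : E) :
    fderiv ℝ τ x (Γ' x v w) = fderiv ℝ (fderiv ℝ τ) x v w
      + Γ (τ x) (fderiv ℝ τ x v) (fderiv ℝ τ x w) := by
  have hs : Function.Surjective (fderiv ℝ τ x) :=
    LinearMap.injective_iff_surjective (f := (fderiv ℝ τ x : E →ₗ[ℝ] E)).1
      (h.injective hx)
  refine h.target.ext_metric (h.mapsTo hx) fun u => ?_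
  obtain ⟨z, rfl⟩ := hs u
  have e := h.target.symm _ (h.mapsTo hx)
  rw [← h.metric_eq x hx, h.source.koszul x hx, map_add, add_apply,
    h.target.koszul _ (h.mapsTo hx), h.fderiv_metric_eq hx, h.fderiv_metric_eq hx,
    h.fderiv_metric_eq hx, h.second_symm hx w v, h.second_symm hx z v, h.second_symm hx z w,
    e (fderiv ℝ τ x w), e (fderiv ℝ τ x v) (fderiv ℝ (fderiv ℝ τ) x w z)]
  ring

/-- The derivative of `conn_eq` in the direction z. -/
theorem fderiv_conn_eq (h : IsPullback U V τ B Γ B' Γ') {x : E} (hx : x ∈ V) (z v w : E) :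
    fderiv ℝ τ x (fderiv ℝ Γ' x z v w) =
      fderiv ℝ (fderiv ℝ (fderiv ℝ τ)) x z v w
      + fderiv ℝ Γ (τ x) (fderiv ℝ τ x z) (fderiv ℝ τ x v) (fderiv ℝ τ x w)
      + Γ (τ x) (fderiv ℝ (fderiv ℝ τ) x z v) (fderiv ℝ τ x w)
      + Γ (τ x) (fderiv ℝ τ x v) (fderiv ℝ (fderiv ℝ τ) x z w)
      - fderiv ℝ (fderiv ℝ τ) x z (Γ' x v w) := by
  have hG' := h.source.hasFDerivAt_conn hx
  have hG := h.target.hasFDerivAt_conn (h.mapsTo hx)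
  have hH : HasFDerivAt (fderiv ℝ (fderiv ℝ τ)) (fderiv ℝ (fderiv ℝ (fderiv ℝ τ)) x) x :=
    (differentiableAt_of_contDiffOn h.source.isOpen
      (h.fderiv_smooth.fderiv_of_isOpen h.source.isOpen (by simp)) hx).hasFDerivAt
  have c := fun u : E => hasFDerivAt_const (𝕜 := ℝ) u x
  have hJ := fun u : E => (h.hasFDerivAt_fderiv hx).clm_apply (c u)
  have h1 := (h.hasFDerivAt_fderiv hx).clm_apply ((hG'.clm_apply (c v)).clm_apply (c w))
  have h2 := ((hH.clm_apply (c v)).clm_apply (c w)).add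
    (((hG.comp x (h.hasFDerivAt hx)).clm_apply (hJ v)).clm_apply (hJ w))
  have h3 := (h1.congr_of_eventuallyEq (Filter.eventually_of_mem (h.source.isOpen.mem_nhds hx)
    fun x hx => (h.conn_eq hx v w).symm)).unique h2
  have h4 := congrArg (fun L => L z) h3
  simp at h4
  rw [eq_sub_iff_add_eq, h4]
  abel

/-- Curvature is antisymmetrized in z and v, so the third derivative of τ drops out; the
second-derivative terms cancel between the derivatives and the products of the connections. -/
theorem riemEnd_eq (h : IsPullback U V τ B Γ B' Γ') {x : E} (hx : x ∈ V) (z v w : E) :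
    fderiv ℝ τ x (riemEnd Γ' x v w z) =
      riemEnd Γ (τ x) (fderiv ℝ τ x v) (fderiv ℝ τ x w) (fderiv ℝ τ x z) := by
  have h3 : fderiv ℝ (fderiv ℝ (fderiv ℝ τ)) x z v w
      = fderiv ℝ (fderiv ℝ (fderiv ℝ τ)) x v z w := by
    rw [((h.fderiv_smooth.contDiffAt (h.source.isOpen.mem_nhds hx)).isSymmSndFDerivAt
      (by simpa using ENat.LEInfty.out)).eq z v]
  rw [riemEnd_apply, riemEnd_apply]
  simp only [map_add, map_sub, h.fderiv_conn_eq hx, h.conn_eq hx, h3, h.second_symm hx z v]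
  abel

/-- By `riemEnd_eq` the two curvature endomorphisms are conjugate under dτ. -/
theorem trace_riemEnd_eq (h : IsPullback U V τ B Γ B' Γ') {x : E} (hx : x ∈ V) (v w : E) :
    LinearMap.trace ℝ E (riemEnd Γ' x v w) = LinearMap.trace ℝ E
      (riemEnd Γ (τ x) (fderiv ℝ τ x v) (fderiv ℝ τ x w)) := by
  let e : E ≃ₗ[ℝ] E :=
    LinearEquiv.ofInjectiveEndo (fderiv ℝ τ x : E →ₗ[ℝ] E) (h.injective hx)
  rw [← LinearMap.trace_conj' (riemEnd Γ' x v w : E →ₗ[ℝ] E) e]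
  congr 1
  ext1 u
  obtain ⟨z, rfl⟩ := e.surjective u
  rw [LinearEquiv.conj_apply_apply, e.symm_apply_apply]
  exact h.riemEnd_eq hx z v w

end IsPullback

end CoordChange

/-! ### Conformal changes of the metric -/

section Conformal

variable {E : Type*} [NormedAddCommGroup E] [NormedSpace ℝ E]
  {U : Set E} {B B' : E → E →L[ℝ] E →L[ℝ] ℝ} {Γ Γ' : E → E →L[ℝ] E →L[ℝ] E}

/-- The connection of `e^{2φ} B`; `N` is the gradient of `φ` with respect to `B`. -/
theorem IsLeviCivita.conformal_conn (h : IsLeviCivita U B Γ) (h' : IsLeviCivita U B' Γ')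
    {φ : E → ℝ} {N : E → E} (hφ : ContDiffOn ℝ ∞ φ U)
    (hB : ∀ y ∈ U, B' y = Real.exp (2 * φ y) • B y)
    (hN : ∀ y ∈ U, ∀ w, B y (N y) w = fderiv ℝ φ y w) {y : E} (hy : y ∈ U) (v w : E) :
    Γ' y v w = Γ y v w + fderiv ℝ φ y v • w + fderiv ℝ φ y w • v - B y v w • N y := by
  have hd : ∀ z v w, fderiv ℝ B' y z v w = Real.exp (2 * φ y) *
      (2 * fderiv ℝ φ y z * B y v w + fderiv ℝ B y z v w) := by
    intro z v w
    have h1 : HasFDerivAt φ (fderiv ℝ φ y) y :=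
      (differentiableAt_of_contDiffOn h.isOpen hφ hy).hasFDerivAt
    have h3 := (h1.const_mul 2).exp
    have h4 := h.hasFDerivAt hy
    have h2 := h3.smul h4
    rw [Filter.EventuallyEq.fderiv_eq (Filter.eventually_of_mem (h.isOpen.mem_nhds hy) hB)]
    erw [h2.fderiv]
    simp
    ring
  refine h'.ext_metric hy fun z => ?_
  rw [h'.koszul y hy, hd, hd, hd, hB y hy]
  simp only [map_add, map_sub, map_smul, smul_apply, add_apply, sub_apply, smul_eq_mul,
    h.koszul y hy, hN y hy]
  rw [h.symm y hy w z, h.symm y hy v z, h.symm y hy v w]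
  ring

/-- The curvature of `e^{2φ} B`. -/
theorem IsLeviCivita.conformal_riemEnd (h : IsLeviCivita U B Γ) (h' : IsLeviCivita U B' Γ')
    {φ : E → ℝ} {N : E → E} (hφ : ContDiffOn ℝ ∞ φ U) (hNs : ContDiffOn ℝ ∞ N U)
    (hB : ∀ y ∈ U, B' y = Real.exp (2 * φ y) • B y)
    (hN : ∀ y ∈ U, ∀ w, B y (N y) w = fderiv ℝ φ y w) {y : E} (hy : y ∈ U) (v w z : E) :
    riemEnd Γ' y v w z = riemEnd Γ y v w z
      + (fderiv ℝ (fderiv ℝ φ) y z w - fderiv ℝ φ y (Γ y z w) - fderiv ℝ φ y z * fderiv ℝ φ y w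
          + B y z w * fderiv ℝ φ y (N y)) • v
      - (fderiv ℝ (fderiv ℝ φ) y v w - fderiv ℝ φ y (Γ y v w) - fderiv ℝ φ y v * fderiv ℝ φ y w
          + B y v w * fderiv ℝ φ y (N y)) • z
      - B y v w • (fderiv ℝ N y z + Γ y z (N y) - fderiv ℝ φ y z • N y)
      + B y z w • (fderiv ℝ N y v + Γ y v (N y) - fderiv ℝ φ y v • N y) := by
  have hdφ : HasFDerivAt (fderiv ℝ φ) (fderiv ℝ (fderiv ℝ φ) y) y :=
    (differentiableAt_of_contDiffOn h.isOpen
      (hφ.fderiv_of_isOpen h.isOpen (by simp)) hy).hasFDerivAt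
  have hdN : HasFDerivAt N (fderiv ℝ N y) y :=
    (differentiableAt_of_contDiffOn h.isOpen hNs hy).hasFDerivAt
  have hsym : ∀ a b, fderiv ℝ (fderiv ℝ φ) y a b = fderiv ℝ (fderiv ℝ φ) y b a :=
    ((hφ.contDiffAt (h.isOpen.mem_nhds hy)).isSymmSndFDerivAt
      (by simpa using ENat.LEInfty.out)).eq
  have hΓ : ∀ z v w, fderiv ℝ Γ' y z v w = fderiv ℝ Γ y z v w
      + fderiv ℝ (fderiv ℝ φ) y z v • w + fderiv ℝ (fderiv ℝ φ) y z w • v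
      - (fderiv ℝ B y z v w • N y + B y v w • fderiv ℝ N y z) := by
    intro z v w
    have c := fun u : E => hasFDerivAt_const (𝕜 := ℝ) u y
    have h1 := (((((h.hasFDerivAt_conn hy).clm_apply (c v)).clm_apply (c w)).add
      ((hdφ.clm_apply (c v)).smul (c w))).add ((hdφ.clm_apply (c w)).smul (c v))).sub
      ((((h.hasFDerivAt hy).clm_apply (c v)).clm_apply (c w)).smul hdN)
    rw [fderiv_apply_apply (h'.hasFDerivAt_conn hy).differentiableAt]
    rw [Filter.EventuallyEq.fderiv_eq (Filter.eventually_of_mem (h.isOpen.mem_nhds hy)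
      fun x hx => h.conformal_conn h' hφ hB hN hx v w)]
    erw [h1.fderiv]
    simp
    abel
  have hNv : ∀ v, B y v (N y) = fderiv ℝ φ y v := fun v => by rw [h.symm y hy, hN y hy]
  rw [riemEnd_apply, riemEnd_apply]
  simp only [hΓ, h.conformal_conn h' hφ hB hN hy, h.fderiv_eq hy, map_add, map_sub, map_smul,
    hNv, h.conn_symm y hy v z,
    hsym v z, h.symm y hy v z]
  module

variable [FiniteDimensional ℝ E]

/-- The Ricci tensor of `e^{2φ} B`. -/
theorem IsLeviCivita.conformal_trace (h : IsLeviCivita U B Γ) (h' : IsLeviCivita U B' Γ')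
    {φ : E → ℝ} {N : E → E} (hφ : ContDiffOn ℝ ∞ φ U) (hNs : ContDiffOn ℝ ∞ N U)
    (hB : ∀ y ∈ U, B' y = Real.exp (2 * φ y) • B y)
    (hN : ∀ y ∈ U, ∀ w, B y (N y) w = fderiv ℝ φ y w) {y : E} (hy : y ∈ U) (v w : E) :
    LinearMap.trace ℝ E (riemEnd Γ' y v w) = LinearMap.trace ℝ E (riemEnd Γ y v w)
      - (Module.finrank ℝ E - 2 : ℝ) * (fderiv ℝ (fderiv ℝ φ) y v w - fderiv ℝ φ y (Γ y v w)
          - fderiv ℝ φ y v * fderiv ℝ φ y w)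
      - (LinearMap.trace ℝ E (fderiv ℝ N y + (Γ y).flip (N y) : E →L[ℝ] E)
          + (Module.finrank ℝ E - 2 : ℝ) * fderiv ℝ φ y (N y)) * B y v w := by
  have hsym : ∀ a b, fderiv ℝ (fderiv ℝ φ) y a b = fderiv ℝ (fderiv ℝ φ) y b a :=
    ((hφ.contDiffAt (h.isOpen.mem_nhds hy)).isSymmSndFDerivAt
      (by simpa using ENat.LEInfty.out)).eq
  have hdφ : HasFDerivAt (fderiv ℝ φ) (fderiv ℝ (fderiv ℝ φ) y) y :=
    (differentiableAt_of_contDiffOn h.isOpen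
      (hφ.fderiv_of_isOpen h.isOpen (by simp)) hy).hasFDerivAt
  have hdN : HasFDerivAt N (fderiv ℝ N y) y :=
    (differentiableAt_of_contDiffOn h.isOpen hNs hy).hasFDerivAt
  -- Differentiating B(N, w) = dφ(w) and using that the connection is metric identifies ∇N with the
  -- Hessian of φ, an index raised.
  have hHess : B y (fderiv ℝ N y v + Γ y v (N y)) w =
      fderiv ℝ (fderiv ℝ φ) y v w - fderiv ℝ φ y (Γ y v w) := by
    have c := hasFDerivAt_const (𝕜 := ℝ) w y
    have h1 := ((h.hasFDerivAt hy).clm_apply hdN).clm_apply c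
    have h2 := (h1.congr_of_eventuallyEq (Filter.eventually_of_mem (h.isOpen.mem_nhds hy)
      fun x hx => (hN x hx w).symm)).unique (hdφ.clm_apply c)
    have h3 := congrArg (fun L => L v) h2
    simp [h.fderiv_eq hy, hN y hy] at h3
    simp only [map_add, add_apply]
    linarith
  -- As a linear map of z the new curvature is the old one plus rank-one maps, a multiple of the
  -- identity and a multiple of ∇N; the trace of each is known.
  have hR : (riemEnd Γ' y v w : E →ₗ[ℝ] E) = (riemEnd Γ y v w : E →ₗ[ℝ] E)
      + ((((fderiv ℝ (fderiv ℝ φ) y w - (fderiv ℝ φ y).comp (Γ y w)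
          - fderiv ℝ φ y w • fderiv ℝ φ y + fderiv ℝ φ y (N y) • B y w).smulRight v :
          E →L[ℝ] E)) : E →ₗ[ℝ] E)
      - (fderiv ℝ (fderiv ℝ φ) y v w - fderiv ℝ φ y (Γ y v w) - fderiv ℝ φ y v * fderiv ℝ φ y w
          + B y v w * fderiv ℝ φ y (N y)) • LinearMap.id
      - B y v w • ((fderiv ℝ N y + (Γ y).flip (N y) : E →L[ℝ] E) : E →ₗ[ℝ] E)
      + B y v w • (((fderiv ℝ φ y).smulRight (N y) : E →L[ℝ] E) : E →ₗ[ℝ] E)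
      + (((B y w).smulRight (fderiv ℝ N y v + Γ y v (N y) - fderiv ℝ φ y v • N y) : E →L[ℝ] E) :
          E →ₗ[ℝ] E) := by
    ext1 z
    have := h.conformal_riemEnd h' hφ hNs hB hN hy v w z
    simp only [ContinuousLinearMap.coe_coe] at this ⊢
    rw [this]
    simp [h.symm y hy w z, hsym w z, h.conn_symm y hy w z]
    module
  have htr : ∀ (L : E →L[ℝ] ℝ) (u : E),
      LinearMap.trace ℝ E ((L.smulRight u : E →L[ℝ] E) : E →ₗ[ℝ] E) = L u := by
    intro L u
    exact LinearMap.trace_smulRight (L : E →ₗ[ℝ] ℝ) u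
  rw [hR]
  simp only [map_add, map_sub, map_smul, htr, LinearMap.trace_id, smul_eq_mul]
  have e1 : B y w (fderiv ℝ N y v) + B y w (Γ y v (N y)) =
      fderiv ℝ (fderiv ℝ φ) y v w - fderiv ℝ φ y (Γ y v w) := by
    rw [← hHess, h.symm y hy _ w, map_add]
  simp only [smul_apply, add_apply, sub_apply, smul_eq_mul,
    ContinuousLinearMap.comp_apply, h.symm y hy w v, hsym w v, h.conn_symm y hy w v,
    h.symm y hy w (N y), hN y hy]
  linear_combination e1

end Conformal

/-! ### The coordinate expressions of the connection and of the curvature -/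

section Bridge

variable {n : ℕ}

/-- The standard basis vectors of `ℝⁿ`. -/
abbrev stdVec (i : Fin n) : Model n := EuclideanSpace.single i (1 : ℝ)

theorem model_eq_sum (v : Model n) : v = ∑ i, v i • stdVec i := by
  ext j
  simp [Finset.sum_apply, Pi.single_apply]

/-- Reduces identities that are linear in v to the standard basis, where the coordinate formulas
apply. -/
theorem model_induction {p : Model n → Prop} (hadd : ∀ v w, p v → p w → p (v + w))
    (hsmul : ∀ (c : ℝ) v, p v → p (c • v)) (h0 : p 0) (hb : ∀ i, p (stdVec i)) (v : Model n) :
    p v := by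
  rw [model_eq_sum v]
  exact Finset.sum_induction _ p hadd h0 fun i _ => hsmul _ _ (hb i)

theorem trace_eq_sum (L : Model n →L[ℝ] Model n) :
    LinearMap.trace ℝ (Model n) L = ∑ k, (L (stdVec k)) k := by
  rw [LinearMap.trace_eq_matrix_trace ℝ (EuclideanSpace.basisFun (Fin n) ℝ).toBasis,
    Matrix.trace]
  refine Finset.sum_congr rfl fun k _ => ?_
  simp [LinearMap.toMatrix_apply]

theorem pd_eq_fderiv (i : Fin n) (F : Model n → ℝ) (y : Model n) :
    pd i F y = fderiv ℝ F y (stdVec i) := rfl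

theorem fderiv_eq_sum_pd (F : Model n → ℝ) (y v : Model n) :
    fderiv ℝ F y v = ∑ i, v i * pd i F y := by
  conv_lhs => rw [model_eq_sum v]
  simp [pd]

/-- The bilinear form with matrix `A`. -/
def bil (A : Matrix (Fin n) (Fin n) ℝ) : Model n →L[ℝ] Model n →L[ℝ] ℝ :=
  ∑ i, ∑ j, A i j • (EuclideanSpace.proj (𝕜 := ℝ) i : Model n →L[ℝ] ℝ).smulRight
    (EuclideanSpace.proj (𝕜 := ℝ) j : Model n →L[ℝ] ℝ)

theorem bil_apply (A : Matrix (Fin n) (Fin n) ℝ) (v w : Model n) :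
    bil A v w = ∑ i, ∑ j, A i j * v i * w j := by
  simp [bil, mul_assoc]

theorem bil_stdVec (A : Matrix (Fin n) (Fin n) ℝ) (i j : Fin n) :
    bil A (stdVec i) (stdVec j) = A i j := by
  simp [bil_apply]

theorem bil_stdVec_right (A : Matrix (Fin n) (Fin n) ℝ) (v : Model n) (j : Fin n) :
    bil A v (stdVec j) = ∑ i, A i j * v i := by
  simp [bil_apply]

theorem bil_comm {A : Matrix (Fin n) (Fin n) ℝ} (hA : A.IsSymm) (v w : Model n) :
    bil A v w = bil A w v := by
  rw [bil_apply, bil_apply, Finset.sum_comm]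
  refine Finset.sum_congr rfl fun i _ => Finset.sum_congr rfl fun j _ => ?_
  rw [hA.apply]; ring

theorem eq_zero_of_bil {A : Matrix (Fin n) (Fin n) ℝ} (hA : A.det ≠ 0) {v : Model n}
    (h : ∀ w, bil A v w = 0) : v = 0 := by
  have h1 : Matrix.vecMul (v : Fin n → ℝ) A = 0 := by
    ext j
    have := h (stdVec j)
    rw [bil_stdVec_right] at this
    simpa [Matrix.vecMul, dotProduct, mul_comm] using this
  have h2 : (v : Fin n → ℝ) = 0 := by
    have := congrArg (fun u => Matrix.vecMul u A⁻¹) h1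
    simpa [Matrix.vecMul_vecMul, Matrix.mul_nonsing_inv _ (isUnit_iff_ne_zero.2 hA)] using this
  ext j; exact congrFun h2 j

/-- The bilinear map with components `c k i j`. -/
def bilVec (c : Fin n → Fin n → Fin n → ℝ) : Model n →L[ℝ] Model n →L[ℝ] Model n :=
  ∑ k, ∑ i, ∑ j, c k i j • (EuclideanSpace.proj (𝕜 := ℝ) i : Model n →L[ℝ] ℝ).smulRight
    ((EuclideanSpace.proj (𝕜 := ℝ) j : Model n →L[ℝ] ℝ).smulRight (stdVec k))

theorem bilVec_apply (c : Fin n → Fin n → Fin n → ℝ) (v w : Model n) (k : Fin n) :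
    bilVec c v w k = ∑ i, ∑ j, c k i j * v i * w j := by
  simp [bilVec, Pi.single_apply, mul_assoc, Finset.sum_apply]

theorem bilVec_stdVec (c : Fin n → Fin n → Fin n → ℝ) (i j k : Fin n) :
    bilVec c (stdVec i) (stdVec j) k = c k i j := by
  simp [bilVec_apply]

/-- The Christoffel symbols, as a bilinear map. -/
def Gam (G : Model n → Matrix (Fin n) (Fin n) ℝ) (y : Model n) :
    Model n →L[ℝ] Model n →L[ℝ] Model n := bilVec fun k i j => christoffel G k i j y

theorem Gam_stdVec (G : Model n → Matrix (Fin n) (Fin n) ℝ) (y : Model n) (i j k : Fin n) :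
    Gam G y (stdVec i) (stdVec j) k = christoffel G k i j y := bilVec_stdVec _ i j k

namespace MetricOn

variable {U : Set (Model n)} {G : Model n → Matrix (Fin n) (Fin n) ℝ}

theorem bil_smooth (h : MetricOn U G) : ContDiffOn ℝ ∞ (fun y => bil (G y)) U :=
  ContDiffOn.sum fun i _ => ContDiffOn.sum fun j _ => (h.smooth i j).smul contDiffOn_const

theorem Gam_smooth (h : MetricOn U G) (hU : IsOpen U) : ContDiffOn ℝ ∞ (Gam G) U := by
  change ContDiffOn ℝ ∞ (fun y => Gam G y) U
  simp only [Gam, bilVec]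
  exact ContDiffOn.sum fun k _ => ContDiffOn.sum fun i _ => ContDiffOn.sum fun j _ =>
    (h.christoffel_smooth hU k i j).smul contDiffOn_const

theorem Gam_comm (h : MetricOn U G) (hU : IsOpen U) {y : Model n} (hy : y ∈ U) (v w : Model n) :
    Gam G y v w = Gam G y w v := by
  ext k
  rw [Gam, bilVec_apply, bilVec_apply, Finset.sum_comm]
  refine Finset.sum_congr rfl fun i _ => Finset.sum_congr rfl fun j _ => ?_
  rw [h.christoffel_comm hU hy]; ring

theorem fderiv_bil_stdVec (h : MetricOn U G) (hU : IsOpen U) {y : Model n} (hy : y ∈ U)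
    (a i j : Fin n) :
    fderiv ℝ (fun y => bil (G y)) y (stdVec a) (stdVec i) (stdVec j)
      = pd a (fun z => G z i j) y := by
  rw [fderiv_apply_apply (differentiableAt_of_contDiffOn hU h.bil_smooth hy), pd_eq_fderiv]
  simp only [bil_stdVec]

/-- Both sides are trilinear, and on basis vectors this is the formula for the Christoffel symbols
of the first kind. -/
theorem bil_Gam (h : MetricOn U G) (hU : IsOpen U) {y : Model n} (hy : y ∈ U) (v w z : Model n) :
    bil (G y) (Gam G y v w) z = (1 / 2) * (fderiv ℝ (fun y => bil (G y)) y v w z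
      + fderiv ℝ (fun y => bil (G y)) y w v z - fderiv ℝ (fun y => bil (G y)) y z v w) := by
  induction v using model_induction with
  | h0 => simp
  | hadd v₁ v₂ h₁ h₂ => simp only [map_add, add_apply, h₁, h₂]; ring
  | hsmul c v h₁ => simp only [map_smul, smul_apply, h₁, smul_eq_mul]; ring
  | hb i =>
  induction w using model_induction with
  | h0 => simp
  | hadd v₁ v₂ h₁ h₂ => simp only [map_add, add_apply, h₁, h₂]; ring
  | hsmul c v h₁ => simp only [map_smul, smul_apply, h₁, smul_eq_mul]; ring
  | hb j =>
  induction z using model_induction with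
  | h0 => simp
  | hadd v₁ v₂ h₁ h₂ => simp only [map_add, add_apply, h₁, h₂]; ring
  | hsmul c v h₁ => simp only [map_smul, smul_apply, h₁, smul_eq_mul]; ring
  | hb l =>
  simp only [h.fderiv_bil_stdVec hU hy]
  rw [← h.sum_mul_christoffel hy l i j, bil_stdVec_right]
  simp only [Gam_stdVec]
  exact Finset.sum_congr rfl fun k _ => by rw [h.apply_comm hy k l]

/-- The bridge by which the index-free invariance and conformal formulas reach the coordinate
definitions. -/
theorem isLeviCivita (h : MetricOn U G) (hU : IsOpen U) :
    IsLeviCivita U (fun y => bil (G y)) (Gam G) where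
  isOpen := hU
  smooth := h.bil_smooth
  smooth_conn := h.Gam_smooth hU
  symm _ hy := bil_comm (h.symm _ hy)
  nondeg _ hy _ hv := eq_zero_of_bil (h.det_ne _ hy) hv
  conn_symm _ hy := h.Gam_comm hU hy
  koszul _ hy := h.bil_Gam hU hy

theorem fderiv_Gam_stdVec (h : MetricOn U G) (hU : IsOpen U) {y : Model n} (hy : y ∈ U)
    (a i j k : Fin n) :
    fderiv ℝ (Gam G) y (stdVec a) (stdVec i) (stdVec j) k = pd a (christoffel G k i j) y := by
  have hd := differentiableAt_of_contDiffOn hU (h.Gam_smooth hU) hy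
  rw [fderiv_apply_apply hd, pd_eq_fderiv]
  have h1 : christoffel G k i j = fun x =>
      (EuclideanSpace.proj (𝕜 := ℝ) k : Model n →L[ℝ] ℝ) (Gam G x (stdVec i) (stdVec j)) := by
    ext x; exact (Gam_stdVec G x i j k).symm
  have h2 : DifferentiableAt ℝ (fun x => Gam G x (stdVec i) (stdVec j)) y :=
    (hd.clm_apply (differentiableAt_const _)).clm_apply (differentiableAt_const _)
  rw [h1, fderiv_clm_apply (differentiableAt_const _) h2]
  simp

/-- The Ricci tensor is the trace of the curvature. -/
theorem ricciCoord_eq_trace (h : MetricOn U G) (hU : IsOpen U) {y : Model n} (hy : y ∈ U)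
    (i j : Fin n) : ricciCoord G i j y =
      LinearMap.trace ℝ (Model n) (riemEnd (Gam G) y (stdVec i) (stdVec j)) := by
  have h1 : ∀ a k (u : Model n), Gam G y (stdVec a) u k = ∑ l, christoffel G k a l y * u l := by
    intro a k u
    simp [Gam, bilVec_apply]
  rw [trace_eq_sum, ricciCoord, ← Finset.sum_add_distrib]
  refine Finset.sum_congr rfl fun k _ => ?_
  rw [riemEnd_apply]
  simp only [PiLp.add_apply, PiLp.sub_apply, h.fderiv_Gam_stdVec hU hy]
  rw [h1 k k, h1 i k]
  simp only [Gam_stdVec, Finset.sum_sub_distrib]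
  ring

theorem bil_ricciCoord (h : MetricOn U G) (hU : IsOpen U) {y : Model n} (hy : y ∈ U)
    (v w : Model n) : bil (Matrix.of fun i j => ricciCoord G i j y) v w =
      LinearMap.trace ℝ (Model n) (riemEnd (Gam G) y v w) := by
  rw [trace_eq_sum]
  simp only [riemEnd_apply]
  induction v using model_induction with
  | h0 => simp
  | hadd v₁ v₂ h₁ h₂ =>
    simp only [map_add, add_apply, h₁, h₂, ← Finset.sum_add_distrib,
      PiLp.add_apply, PiLp.sub_apply]
    exact Finset.sum_congr rfl fun _ _ => by ring
  | hsmul c v h₁ =>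
    simp only [map_smul, smul_apply, h₁, Finset.mul_sum, smul_eq_mul,
      PiLp.add_apply, PiLp.sub_apply, PiLp.smul_apply]
    exact Finset.sum_congr rfl fun _ _ => by ring
  | hb i =>
  induction w using model_induction with
  | h0 => simp
  | hadd v₁ v₂ h₁ h₂ =>
    simp only [map_add, h₁, h₂, ← Finset.sum_add_distrib,
      PiLp.add_apply, PiLp.sub_apply]
    exact Finset.sum_congr rfl fun _ _ => by ring
  | hsmul c v h₁ =>
    simp only [map_smul, h₁, Finset.mul_sum, smul_eq_mul,
      PiLp.add_apply, PiLp.sub_apply, PiLp.smul_apply]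
    exact Finset.sum_congr rfl fun _ _ => by ring
  | hb j =>
  rw [bil_stdVec, Matrix.of_apply, h.ricciCoord_eq_trace hU hy, trace_eq_sum]
  rfl

end MetricOn

/-- The matrix of an endomorphism of `ℝⁿ`. -/
abbrev toMat (L : Model n →L[ℝ] Model n) : Matrix (Fin n) (Fin n) ℝ :=
  LinearMap.toMatrix (EuclideanSpace.basisFun (Fin n) ℝ).toBasis
      (EuclideanSpace.basisFun (Fin n) ℝ).toBasis (L : Model n →ₗ[ℝ] Model n)

theorem eq_of_bil_eq {A A' : Matrix (Fin n) (Fin n) ℝ} {L : Model n →L[ℝ] Model n}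
    (h : ∀ v w, bil A' v w = bil A (L v) (L w)) :
    A' = (toMat L).transpose * A * toMat L := by
  ext i j
  rw [← bil_stdVec A', h, bil_apply]
  simp only [Matrix.mul_apply, Matrix.transpose_apply, Finset.sum_mul, LinearMap.toMatrix_apply]
  rw [Finset.sum_comm]
  refine Finset.sum_congr rfl fun a _ => Finset.sum_congr rfl fun b _ => ?_
  simp only [OrthonormalBasis.coe_toBasis, EuclideanSpace.basisFun_apply,
    ContinuousLinearMap.coe_coe, OrthonormalBasis.coe_toBasis_repr_apply,
    EuclideanSpace.basisFun_repr]
  ring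

theorem det_eq_of_bil_eq {A A' : Matrix (Fin n) (Fin n) ℝ} {L : Model n →L[ℝ] Model n}
    (h : ∀ v w, bil A' v w = bil A (L v) (L w)) : A'.det = L.det ^ 2 * A.det := by
  rw [eq_of_bil_eq h]
  simp only [Matrix.det_mul, Matrix.det_transpose, LinearMap.det_toMatrix]
  rw [ContinuousLinearMap.det]; ring

/-- The scalar curvature does not depend on the coordinates. -/
theorem scalarCoord_comp {U V : Set (Model n)} {G G' : Model n → Matrix (Fin n) (Fin n) ℝ}
    {τ : Model n → Model n} (hU : IsOpen U) (hV : IsOpen V) (hG : MetricOn U G)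
    (hG' : MetricOn V G') (hτ : ContDiffOn ℝ ∞ τ V) (hm : Set.MapsTo τ V U)
    (hB : ∀ x ∈ V, ∀ v w, bil (G' x) v w = bil (G (τ x)) (fderiv ℝ τ x v) (fderiv ℝ τ x w))
    {x : Model n} (hx : x ∈ V) : scalarCoord G' x = scalarCoord G (τ x) := by
  have h : IsPullback U V τ (fun y => bil (G y)) (Gam G) (fun y => bil (G' y)) (Gam G') :=
    ⟨hG'.isLeviCivita hV, hG.isLeviCivita hU, hτ, hm, hB⟩
  have htr : ∀ (A B : Matrix (Fin n) (Fin n) ℝ), ∑ i, ∑ j, A i j * B i j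
      = (A * B.transpose).trace := by
    intro A B; simp [Matrix.trace, Matrix.mul_apply]
  have hGm := eq_of_bil_eq (hB x hx)
  -- The Ricci matrix is a trace of curvature, hence transforms under dτ by the same congruence as
  -- the metric.
  have hR : (Matrix.of fun i j => ricciCoord G' i j x) = _ :=
    eq_of_bil_eq (A := Matrix.of fun i j => ricciCoord G i j (τ x)) (L := fderiv ℝ τ x)
    fun v w => by
      rw [hG'.bil_ricciCoord hV hx, hG.bil_ricciCoord hU (hm hx), h.trace_riemEnd_eq hx]
  have hd := hG'.det_ne x hx
  set J := toMat (fderiv ℝ τ x)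
  have hJ : IsUnit J.det := by
    rw [hGm, Matrix.det_mul] at hd
    exact isUnit_iff_ne_zero.2 (right_ne_zero_of_mul hd)
  have hJt : IsUnit J.transpose.det := by rwa [Matrix.det_transpose]
  have e1 : scalarCoord G' x = ((G' x)⁻¹ *
      (Matrix.of fun i j => ricciCoord G' i j x).transpose).trace := by
    rw [← htr]; rfl
  have e2 : scalarCoord G (τ x) = ((G (τ x))⁻¹ *
      (Matrix.of fun i j => ricciCoord G i j (τ x)).transpose).trace := by
    rw [← htr]; rfl
  rw [e1, e2, hGm, hR]
  simp only [Matrix.mul_inv_rev, Matrix.transpose_mul, Matrix.transpose_transpose]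
  -- As G and Ric change by the same congruence, G⁻¹ Ricᵀ changes by conjugation with J, which
  -- preserves its trace R. Keeping the transpose avoids any appeal to the symmetry of Ric.
  have : ∀ X Y : Matrix (Fin n) (Fin n) ℝ,
      J⁻¹ * (X * J.transpose⁻¹) * (J.transpose * (Y * J)) = J⁻¹ * (X * Y) * J := by
    intro X Y
    calc _ = J⁻¹ * X * (J.transpose⁻¹ * J.transpose) * Y * J := by simp only [Matrix.mul_assoc]
      _ = _ := by rw [Matrix.nonsing_inv_mul _ hJt]; simp only [Matrix.mul_one, Matrix.mul_assoc]
  rw [this, Matrix.trace_mul_comm, ← Matrix.mul_assoc, Matrix.mul_nonsing_inv _ hJ,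
    Matrix.one_mul]

/-! ### Hessian, gradient and Laplacian in coordinates -/

theorem hessianCoord_eq {U : Set (Model n)} {G : Model n → Matrix (Fin n) (Fin n) ℝ}
    (hU : IsOpen U) {F : Model n → ℝ} (hF : ContDiffOn ℝ ∞ F U) {y : Model n} (hy : y ∈ U)
    (i j : Fin n) : hessianCoord G F i j y = fderiv ℝ (fderiv ℝ F) y (stdVec i) (stdVec j)
      - fderiv ℝ F y (Gam G y (stdVec i) (stdVec j)) := by
  have hd : DifferentiableAt ℝ (fderiv ℝ F) y :=
    differentiableAt_of_contDiffOn hU (hF.fderiv_of_isOpen hU (by simp)) hy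
  rw [hessianCoord, fderiv_eq_sum_pd F y (Gam G y _ _)]
  simp only [Gam_stdVec]
  congr 1
  unfold pd
  rw [fderiv_clm_apply hd (differentiableAt_const _)]
  simp

/-- The gradient of `F`. -/
def gradVec (G : Model n → Matrix (Fin n) (Fin n) ℝ) (F : Model n → ℝ) (y : Model n) : Model n :=
  ∑ i, (∑ j, (G y)⁻¹ i j * pd j F y) • stdVec i

theorem gradVec_apply (G : Model n → Matrix (Fin n) (Fin n) ℝ) (F : Model n → ℝ) (y : Model n)
    (i : Fin n) : gradVec G F y i = ∑ j, (G y)⁻¹ i j * pd j F y := by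
  simp [gradVec, Finset.sum_apply, Pi.single_apply]

theorem gradVec_smooth {U : Set (Model n)} {G : Model n → Matrix (Fin n) (Fin n) ℝ}
    (hU : IsOpen U) (hG : MetricOn U G) {F : Model n → ℝ} (hF : ContDiffOn ℝ ∞ F U) :
    ContDiffOn ℝ ∞ (gradVec G F) U :=
  ContDiffOn.sum fun i _ => (ContDiffOn.sum fun j _ =>
    (hG.inv_smooth i j).mul (contDiffOn_pd hU hF j)).smul contDiffOn_const

theorem bil_gradVec {U : Set (Model n)} {G : Model n → Matrix (Fin n) (Fin n) ℝ}
    (hG : MetricOn U G) {F : Model n → ℝ} {y : Model n} (hy : y ∈ U) (w : Model n) :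
    bil (G y) (gradVec G F y) w = fderiv ℝ F y w := by
  induction w using model_induction with
  | h0 => simp
  | hadd v₁ v₂ h₁ h₂ => simp only [map_add, h₁, h₂]
  | hsmul c v h₁ => simp only [map_smul, h₁]
  | hb k =>
  rw [bil_stdVec_right, ← pd_eq_fderiv]
  simp only [gradVec_apply, hG.apply_comm hy _ k]
  have : (∑ i, G y k i * ∑ j, (G y)⁻¹ i j * pd j F y)
      = Matrix.mulVec (G y) (Matrix.mulVec (G y)⁻¹ fun j => pd j F y) k := rfl
  rw [this, Matrix.mulVec_mulVec, hG.mul_inv_cancel hy, Matrix.one_mulVec]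

/-- The Laplacian. -/
def laplaceCoord (G : Model n → Matrix (Fin n) (Fin n) ℝ) (F : Model n → ℝ) (y : Model n) : ℝ :=
  ∑ i, ∑ j, (G y)⁻¹ i j * hessianCoord G F i j y

/-- Differentiating `bil_gradVec` shows that ∇ grad F, with its index lowered, is the Hessian.
Raising the index again with G⁻¹ and tracing gives the Laplacian. This identifies the trace left
over in `IsLeviCivita.conformal_trace`. -/
theorem trace_gradVec {U : Set (Model n)} {G : Model n → Matrix (Fin n) (Fin n) ℝ}
    (hU : IsOpen U) (hG : MetricOn U G) {F : Model n → ℝ} (hF : ContDiffOn ℝ ∞ F U) {y : Model n}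
    (hy : y ∈ U) : LinearMap.trace ℝ (Model n) (fderiv ℝ (gradVec G F) y
      + (Gam G y).flip (gradVec G F y) : Model n →L[ℝ] Model n) = laplaceCoord G F y := by
  have hL := hG.isLeviCivita hU
  have hdF : HasFDerivAt (fderiv ℝ F) (fderiv ℝ (fderiv ℝ F) y) y :=
    (differentiableAt_of_contDiffOn hU (hF.fderiv_of_isOpen hU (by simp)) hy).hasFDerivAt
  have hdN : HasFDerivAt (gradVec G F) (fderiv ℝ (gradVec G F) y) y :=
    (differentiableAt_of_contDiffOn hU (gradVec_smooth hU hG hF) hy).hasFDerivAt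
  have key : ∀ v w, bil (G y) (fderiv ℝ (gradVec G F) y v + Gam G y v (gradVec G F y)) w =
      fderiv ℝ (fderiv ℝ F) y v w - fderiv ℝ F y (Gam G y v w) := by
    intro v w
    have c := hasFDerivAt_const (𝕜 := ℝ) w y
    have h1 := ((hL.hasFDerivAt hy).clm_apply hdN).clm_apply c
    have h2 := (h1.congr_of_eventuallyEq (Filter.eventually_of_mem (hU.mem_nhds hy)
      fun x hx => (bil_gradVec hG hx w).symm)).unique (hdF.clm_apply c)
    have h3 := congrArg (fun L => L v) h2
    simp [hL.fderiv_eq hy, bil_gradVec hG hy] at h3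
    simp only [map_add, add_apply]
    linarith
  set S : Model n →L[ℝ] Model n := fderiv ℝ (gradVec G F) y + (Gam G y).flip (gradVec G F y)
  have hS : ∀ k i, ∑ a, G y i a * (S (stdVec k)) a = hessianCoord G F k i y := by
    intro k i
    rw [hessianCoord_eq hU hF hy, ← key, bil_stdVec_right]
    exact Finset.sum_congr rfl fun a _ => by rw [hG.apply_comm hy i a]; rfl
  have hinv : ∀ (u : Fin n → ℝ) k, u k = ∑ i, (G y)⁻¹ k i * ∑ a, G y i a * u a := by
    intro u k
    have : (∑ i, (G y)⁻¹ k i * ∑ a, G y i a * u a)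
      = Matrix.mulVec (G y)⁻¹ (Matrix.mulVec (G y) u) k := rfl
    rw [this, Matrix.mulVec_mulVec, hG.inv_mul_cancel hy, Matrix.one_mulVec]
  rw [trace_eq_sum, laplaceCoord]
  refine Finset.sum_congr rfl fun k _ => ?_
  rw [hinv (S (stdVec k)) k]
  exact Finset.sum_congr rfl fun i _ => by rw [hS k i]

/-! ### Conformal formulas in coordinates -/

section Conformal

variable {U : Set (Model n)} {G G' : Model n → Matrix (Fin n) (Fin n) ℝ} {φ : Model n → ℝ}

/-- The squared norm of the gradient. -/
def gradSq (G : Model n → Matrix (Fin n) (Fin n) ℝ) (F K : Model n → ℝ) (y : Model n) : ℝ :=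
  ∑ i, ∑ j, (G y)⁻¹ i j * pd i F y * pd j K y

theorem fderiv_gradVec (F K : Model n → ℝ) (y : Model n) :
    fderiv ℝ F y (gradVec G K y) = gradSq G F K y := by
  rw [fderiv_eq_sum_pd]
  simp only [gradVec_apply, gradSq, Finset.sum_mul]
  exact Finset.sum_congr rfl fun i _ => Finset.sum_congr rfl fun j _ => by ring

theorem bil_smul (c : ℝ) (A : Matrix (Fin n) (Fin n) ℝ) : bil (c • A) = c • bil A := by
  simp only [bil, Matrix.smul_apply, smul_eq_mul, Finset.smul_sum, smul_smul]

/-- The Ricci tensor of the conformal metric `e^{2φ} G`. -/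
theorem ricciCoord_conformal (hU : IsOpen U) (hG : MetricOn U G) (hG' : MetricOn U G')
    (hφ : ContDiffOn ℝ ∞ φ U) (hB : ∀ y ∈ U, G' y = Real.exp (2 * φ y) • G y) {y : Model n}
    (hy : y ∈ U) (i j : Fin n) :
    ricciCoord G' i j y = ricciCoord G i j y
      - (n - 2 : ℝ) * (hessianCoord G φ i j y - pd i φ y * pd j φ y)
      - (laplaceCoord G φ y + (n - 2 : ℝ) * gradSq G φ φ y) * G y i j := by
  have := (hG.isLeviCivita hU).conformal_trace (hG'.isLeviCivita hU) hφ
    (gradVec_smooth hU hG hφ) (fun y hy => by rw [hB y hy, bil_smul])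
    (fun y hy => bil_gradVec hG hy) hy (stdVec i) (stdVec j)
  rw [hG.ricciCoord_eq_trace hU hy, hG'.ricciCoord_eq_trace hU hy, this, bil_stdVec,
    fderiv_gradVec, hessianCoord_eq hU hφ hy, trace_gradVec hU hG hφ hy]
  simp [pd_eq_fderiv]

/-- The Hessian with respect to the conformal metric `e^{2φ} G`. -/
theorem hessianCoord_conformal (hU : IsOpen U) (hG : MetricOn U G) (hG' : MetricOn U G')
    (hφ : ContDiffOn ℝ ∞ φ U) (hB : ∀ y ∈ U, G' y = Real.exp (2 * φ y) • G y)
    {F : Model n → ℝ} (hF : ContDiffOn ℝ ∞ F U) {y : Model n} (hy : y ∈ U) (i j : Fin n) :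
    hessianCoord G' F i j y = hessianCoord G F i j y - pd i φ y * pd j F y - pd j φ y * pd i F y
      + gradSq G F φ y * G y i j := by
  have := (hG.isLeviCivita hU).conformal_conn (hG'.isLeviCivita hU) hφ
    (fun y hy => by rw [hB y hy, bil_smul])
    (fun y hy => bil_gradVec hG hy) hy (stdVec i) (stdVec j)
  rw [hessianCoord_eq hU hF hy, hessianCoord_eq hU hF hy, this]
  simp only [map_add, map_sub, map_smul, fderiv_gradVec, bil_stdVec, pd_eq_fderiv, smul_eq_mul]
  ring

end Conformal

end Bridge

/-! ### The quasi-Einstein equation from the Euler-Lagrange equation, in coordinates -/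

section QuasiEinstein

variable {n : ℕ} {U : Set (Model n)} {G G' : Model n → Matrix (Fin n) (Fin n) ℝ}

/-- `Real.log` is even, so log R stands for log|R| also where R is negative, and no absolute value
has to be differentiated. -/
theorem pd_log (i : Fin n) (c : ℝ) {R : Model n → ℝ} {y : Model n} (hR : DifferentiableAt ℝ R y)
    (h0 : R y ≠ 0) : pd i (fun z => c * Real.log (R z)) y = c * (pd i R y / R y) := by
  rw [pd_comp (q := fun x => c * Real.log x) ((Real.hasDerivAt_log h0).const_mul c) hR]
  field_simp

theorem hessianCoord_log (hU : IsOpen U) {R : Model n → ℝ} (hR : ContDiffOn ℝ ∞ R U)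
    (h0 : ∀ y ∈ U, R y ≠ 0) (c : ℝ) {y : Model n} (hy : y ∈ U) (i j : Fin n) :
    hessianCoord G (fun z => c * Real.log (R z)) i j y =
      c * (hessianCoord G R i j y / R y - pd i R y * pd j R y / R y ^ 2) := by
  have hd := fun {z} (hz : z ∈ U) => differentiableAt_of_contDiffOn hU hR hz
  have hd' := differentiableAt_of_contDiffOn hU (contDiffOn_pd hU hR j) hy
  have h1 : pd j (fun z => c * Real.log (R z)) =ᶠ[nhds y] fun z => c * ((R z)⁻¹ * pd j R z) :=
    Filter.eventually_of_mem (hU.mem_nhds hy) fun z hz => by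
      rw [pd_log j c (hd hz) (h0 z hz)]; ring
  have h0y := h0 y hy
  have hi : DifferentiableAt ℝ (fun z => (R z)⁻¹) y := (hd hy).inv h0y
  have h2 : pd i (fun z => (R z)⁻¹) y = -(R y ^ 2)⁻¹ * pd i R y :=
    pd_comp (q := fun x => x⁻¹) (hasDerivAt_inv h0y) (hd hy)
  rw [hessianCoord, pd_congr h1, pd_const_mul (F := fun z => (R z)⁻¹ * pd j R z) _ (hi.mul hd'), pd_mul hi hd', h2, hessianCoord]
  simp only [pd_log _ c (hd hy) h0y]
  rw [sub_div, mul_sub, mul_sub, Finset.sum_div, Finset.mul_sum]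
  have : ∀ k, christoffel G k i j y * (c * (pd k R y / R y))
    = c * (christoffel G k i j y * pd k R y / R y) := fun k => by ring
  simp only [this]
  field_simp
  ring

theorem laplaceCoord_log (hU : IsOpen U) {R : Model n → ℝ} (hR : ContDiffOn ℝ ∞ R U)
    (h0 : ∀ y ∈ U, R y ≠ 0) (c : ℝ) {y : Model n} (hy : y ∈ U) :
    laplaceCoord G (fun z => c * Real.log (R z)) y =
      c * (laplaceCoord G R y / R y - gradSq G R R y / R y ^ 2) := by
  simp only [laplaceCoord, gradSq, hessianCoord_log hU hR h0 c hy, Finset.sum_div,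
    ← Finset.sum_sub_distrib, Finset.mul_sum]
  exact Finset.sum_congr rfl fun i _ => Finset.sum_congr rfl fun j _ => by ring

theorem gradSq_log {R : Model n → ℝ} {y : Model n} (hR : DifferentiableAt ℝ R y)
    (h0 : R y ≠ 0) (c d : ℝ) :
    gradSq G (fun z => c * Real.log (R z)) (fun z => d * Real.log (R z)) y =
      c * d * (gradSq G R R y / R y ^ 2) := by
  simp only [gradSq, pd_log _ _ hR h0, Finset.sum_div, Finset.mul_sum]
  exact Finset.sum_congr rfl fun i _ => Finset.sum_congr rfl fun j _ => by ring

theorem MetricOn.sum_inv_mul_self (hG : MetricOn U G) {y : Model n} (hy : y ∈ U) :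
    ∑ i, ∑ j, (G y)⁻¹ i j * G y i j = n := by
  have h1 := congrArg Matrix.trace (hG.inv_mul_cancel hy)
  rw [Matrix.trace_one, Fintype.card_fin] at h1
  rw [← h1, Matrix.trace]
  simp only [Matrix.diag_apply, Matrix.mul_apply]
  exact Finset.sum_congr rfl fun i _ => Finset.sum_congr rfl fun j _ => by
    rw [hG.apply_comm hy i j]

/-- The trace of the Euler-Lagrange equation of `∫ R²`. -/
theorem laplaceCoord_scalarCoord (hG : MetricOn U G) {y : Model n} (hy : y ∈ U)
    (hEL : ∀ i j, scalarCoord G y * ricciCoord G i j y = hessianCoord G (scalarCoord G) i j y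
      + (scalarCoord G y ^ 2 / 4 - laplaceCoord G (scalarCoord G) y) * G y i j) :
    4 * (n - 1 : ℝ) * laplaceCoord G (scalarCoord G) y = (n - 4 : ℝ) * scalarCoord G y ^ 2 := by
  have h1 : ∑ i, ∑ j, (G y)⁻¹ i j * (scalarCoord G y * ricciCoord G i j y) =
      scalarCoord G y * scalarCoord G y := by
    conv_rhs => rw [scalarCoord, Finset.mul_sum]
    refine Finset.sum_congr rfl fun i _ => ?_
    rw [Finset.mul_sum]
    refine Finset.sum_congr rfl fun j _ => ?_
    rw [← scalarCoord]; ring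
  have h2 := hG.sum_inv_mul_self hy
  have h3 : ∑ i, ∑ j, (G y)⁻¹ i j * (hessianCoord G (scalarCoord G) i j y
      + (scalarCoord G y ^ 2 / 4 - laplaceCoord G (scalarCoord G) y) * G y i j) =
      laplaceCoord G (scalarCoord G) y
      + (scalarCoord G y ^ 2 / 4 - laplaceCoord G (scalarCoord G) y) * n := by
    conv_rhs => rw [← h2]
    rw [laplaceCoord, Finset.mul_sum, ← Finset.sum_add_distrib]
    refine Finset.sum_congr rfl fun i _ => ?_
    rw [Finset.mul_sum, ← Finset.sum_add_distrib]
    exact Finset.sum_congr rfl fun j _ => by ring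
  simp only [hEL, h3] at h1
  linarith

theorem quasiEinstein_coord (hn : (n : ℝ) ≠ 1) (hU : IsOpen U) (hG : MetricOn U G)
    (hG' : MetricOn U G') (hR : ∀ y ∈ U, scalarCoord G y < 0) {k : ℝ}
    (hk : ((n : ℝ) - 2) * k - 1 ≠ 0)
    (hB : ∀ y ∈ U, G' y = (|scalarCoord G y| ^ (2 * k) : ℝ) • G y) {F : Model n → ℝ}
    (hF : ∀ y ∈ U, F y = (((n : ℝ) - 2) * k - 1) * Real.log |scalarCoord G y|)
    {y : Model n} (hy : y ∈ U)
    (hEL : ∀ i j, scalarCoord G y * ricciCoord G i j y = hessianCoord G (scalarCoord G) i j y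
      + (scalarCoord G y ^ 2 / 4 - laplaceCoord G (scalarCoord G) y) * G y i j) (i j : Fin n) :
    ricciCoord G' i j y + hessianCoord G' F i j y
        - (1 + 2 * k - ((n : ℝ) - 2) * k ^ 2) / (((n : ℝ) - 2) * k - 1) ^ 2
          * (pd i F y * pd j F y)
      = (((n : ℝ) - 4) * k - 3) / (4 * ((n : ℝ) - 1))
          * Real.exp ((1 - 2 * k) / (((n : ℝ) - 2) * k - 1) * F y) * G' y i j := by
  set R := scalarCoord G with hRdef
  set c := ((n : ℝ) - 2) * k - 1 with hc
  have hRs : ContDiffOn ℝ ∞ R U := hG.scalarCoord_smooth hU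
  have h0 : ∀ y ∈ U, R y ≠ 0 := fun y hy => (hR y hy).ne
  have hRd := differentiableAt_of_contDiffOn hU hRs hy
  have hlogs : ∀ c : ℝ, ContDiffOn ℝ ∞ (fun z => c * Real.log (R z)) U := fun c =>
    contDiffOn_const.mul (hRs.log h0)
  have hexp : ∀ y ∈ U, (|R y| ^ (2 * k) : ℝ) = Real.exp (2 * (k * Real.log (R y))) := by
    intro y hy
    rw [Real.rpow_def_of_pos (abs_pos.2 (h0 y hy)), Real.log_abs]
    congr 1; ring
  have hB' : ∀ y ∈ U, G' y = Real.exp (2 * (k * Real.log (R y))) • G y := fun y hy => by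
    rw [hB y hy, hexp y hy]
  have hFe : F =ᶠ[nhds y] fun z => c * Real.log (R z) :=
    Filter.eventually_of_mem (hU.mem_nhds hy) fun z hz => by rw [hF z hz, Real.log_abs]
  -- Two derivatives are taken, so the first derivatives must agree near y and not only at y.
  have hH : hessianCoord G' F i j y = hessianCoord G' (fun z => c * Real.log (R z)) i j y := by
    have h1 : pd j F =ᶠ[nhds y] pd j fun z => c * Real.log (R z) :=
      hFe.eventuallyEq_nhds.mono fun z hz => pd_congr hz
    simp only [hessianCoord, pd_congr h1, pd_congr hFe]
  have hRy := hR y hy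
  have h0y := h0 y hy
  -- Since F / c = log|R|, the product is |R|^{1−2k} |R|^{2k} = |R|, and R is negative.
  have hE : Real.exp ((1 - 2 * k) / c * F y) * (|R y| ^ (2 * k) : ℝ) = -R y := by
    rw [hF y hy, hexp y hy, ← Real.exp_add, Real.log_abs,
      show (1 - 2 * k) / c * (c * Real.log (R y)) + 2 * (k * Real.log (R y)) = Real.log (R y) by
        field_simp; ring, ← Real.log_abs, abs_of_neg hRy, Real.exp_log (neg_pos.2 hRy)]
  have htr := laplaceCoord_scalarCoord hG hy hEL
  have hRic : ricciCoord G i j y = (hessianCoord G R i j y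
      + (R y ^ 2 / 4 - laplaceCoord G R y) * G y i j) / R y := by
    rw [← hEL i j]; field_simp
  have hn' : (n : ℝ) - 1 ≠ 0 := sub_ne_zero.2 hn
  have hL : laplaceCoord G R y = (n - 4 : ℝ) * R y ^ 2 / (4 * (n - 1)) := by
    rw [eq_div_iff (by positivity)]; linarith
  rw [hH, pd_congr hFe, pd_congr hFe, hB y hy, Matrix.smul_apply, smul_eq_mul,
    show ∀ a b d e : ℝ, a * b * (d * e) = a * (b * d) * e from fun _ _ _ _ => by ring, hE,
    ricciCoord_conformal hU hG hG' (hlogs k) hB' hy,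
    hessianCoord_conformal hU hG hG' (hlogs k) hB' (hlogs c) hy, hRic,
    hessianCoord_log hU hRs h0 _ hy, hessianCoord_log hU hRs h0 _ hy,
    laplaceCoord_log hU hRs h0 _ hy, gradSq_log hRd h0y, gradSq_log hRd h0y,
    pd_log _ _ hRd h0y, pd_log _ _ hRd h0y, pd_log _ _ hRd h0y, pd_log _ _ hRd h0y, hL]
  -- What is left is a rational identity in independent quantities. Substituting c = (n−2)k − 1
  -- makes the coefficients of H and of Q vanish.
  generalize hessianCoord G R i j y = H
  generalize gradSq G R R y = Q
  generalize G y i j = g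
  generalize pd i R y = a
  generalize pd j R y = b
  generalize R y = r at *
  field_simp
  rw [hc]
  ring

end QuasiEinstein

/-! ### Derivatives of the volume density and of the inverse metric -/

section Density

variable {n : ℕ}

/-- Jacobi's formula. -/
theorem hasDerivAt_det {ι : Type*} [Fintype ι] [DecidableEq ι] {M : ℝ → Matrix ι ι ℝ}
    {M' : Matrix ι ι ℝ} {t : ℝ} (hM : ∀ i j, HasDerivAt (fun s => M s i j) (M' i j) t) :
    HasDerivAt (fun s => (M s).det) (∑ i, ∑ j, (M t).adjugate i j * M' j i) t := by
  have h1 : HasDerivAt (fun s => (M s).det) (∑ σ : Equiv.Perm ι, ((Equiv.Perm.sign σ : ℤ) : ℝ) *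
      ∑ i, (∏ j ∈ Finset.univ.erase i, M t (σ j) j) • M' (σ i) i) t := by
    simp only [Matrix.det_apply']
    refine HasDerivAt.fun_sum fun σ _ => ?_
    have := HasDerivAt.fun_finsetProd (u := Finset.univ) (f := fun i s => M s (σ i) i)
      fun i _ => hM (σ i) i
    exact this.const_mul ((Equiv.Perm.sign σ : ℤ) : ℝ)
  convert h1 using 1
  simp only [Finset.mul_sum]
  conv_rhs => rw [Finset.sum_comm]
  refine Finset.sum_congr rfl fun i _ => ?_
  -- Cramer's rule: a row of the adjugate applied to a column is the determinant with that column
  -- substituted. Its Leibniz expansion is the part of the product rule in which column i is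
  -- differentiated.
  have h2 : ∑ j, (M t).adjugate i j * M' j i = ((M t).updateCol i fun j => M' j i).det := by
    rw [← Matrix.cramer_apply, Matrix.cramer_eq_adjugate_mulVec]; rfl
  rw [h2, Matrix.det_apply']
  refine Finset.sum_congr rfl fun σ _ => ?_
  rw [← Finset.mul_prod_erase _ _ (Finset.mem_univ i)]
  simp only [Matrix.updateCol_self, smul_eq_mul]
  congr 1
  rw [mul_comm]
  congr 1
  exact Finset.prod_congr rfl fun j hj => by
    rw [Matrix.updateCol_ne (Finset.ne_of_mem_erase hj)]

theorem hasDerivAt_line {F : Model n → ℝ} {y : Model n} (hF : DifferentiableAt ℝ F y)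
    (k : Fin n) : HasDerivAt (fun t : ℝ => F (y + t • stdVec k)) (pd k F y) 0 := by
  have h1 : HasDerivAt (fun t : ℝ => y + t • stdVec k) (stdVec k) 0 := by
    simpa using ((hasDerivAt_id (0 : ℝ)).smul_const (stdVec k)).const_add y
  have h2 : HasFDerivAt F (fderiv ℝ F y) (y + (0 : ℝ) • stdVec k) := by
    simpa using hF.hasFDerivAt
  exact h2.comp_hasDerivAt 0 h1

theorem sum_one_apply (i : Fin n) (v : Fin n → ℝ) :
    ∑ j, (1 : Matrix (Fin n) (Fin n) ℝ) i j * v j = v i := by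
  simp [Matrix.one_apply]

namespace MetricOn

variable {U : Set (Model n)} {G : Model n → Matrix (Fin n) (Fin n) ℝ}

/-- The volume density `√(det G)`. -/
def _root_.QuadCurv.density (G : Model n → Matrix (Fin n) (Fin n) ℝ) (y : Model n) : ℝ :=
  Real.sqrt (G y).det

theorem sum_inv_mul (h : MetricOn U G) {y : Model n} (hy : y ∈ U) (i k : Fin n) :
    ∑ j, (G y)⁻¹ i j * G y j k = (1 : Matrix (Fin n) (Fin n) ℝ) i k := by
  rw [← h.inv_mul_cancel hy, Matrix.mul_apply]

theorem sum_mul_inv (h : MetricOn U G) {y : Model n} (hy : y ∈ U) (i k : Fin n) :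
    ∑ j, G y i j * (G y)⁻¹ j k = (1 : Matrix (Fin n) (Fin n) ℝ) i k := by
  rw [← h.mul_inv_cancel hy, Matrix.mul_apply]

theorem pd_comm_index (h : MetricOn U G) (hU : IsOpen U) {y : Model n} (hy : y ∈ U)
    (l i j : Fin n) : pd l (fun z => G z i j) y = pd l (fun z => G z j i) y :=
  pd_congr (Filter.eventually_of_mem (hU.mem_nhds hy) fun _ hz => h.apply_comm hz i j)

/-- Of the three derivatives in the Christoffel symbol, two cancel on exchanging the summation
indices, as G⁻¹ is symmetric. -/
theorem christoffel_trace (h : MetricOn U G) (hU : IsOpen U) {y : Model n} (hy : y ∈ U)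
    (k : Fin n) : ∑ a, christoffel G a a k y =
      (1 / 2) * ∑ a, ∑ l, (G y)⁻¹ a l * pd k (fun z => G z l a) y := by
  have h1 : ∑ a, ∑ l, (G y)⁻¹ a l * pd l (fun z => G z a k) y
      = ∑ a, ∑ l, (G y)⁻¹ a l * pd a (fun z => G z k l) y := by
    rw [Finset.sum_comm]
    exact Finset.sum_congr rfl fun a _ => Finset.sum_congr rfl fun l _ => by
      rw [h.inv_comm hy, h.pd_comm_index hU hy a l k]
  simp only [christoffel, ← Finset.mul_sum]
  congr 1
  simp only [mul_sub, mul_add, Finset.sum_sub_distrib, Finset.sum_add_distrib, h1]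
  rw [add_sub_cancel_left]
  exact Finset.sum_congr rfl fun a _ => Finset.sum_congr rfl fun l _ => by
    rw [h.pd_comm_index hU hy k]

/-- Jacobi's formula gives ∂_k log √det G = ½ tr(G⁻¹ ∂_k G), which is the contracted Christoffel
symbol by `christoffel_trace`. -/
theorem pd_density (h : MetricOn U G) (hU : IsOpen U) (hpos : ∀ y ∈ U, 0 < (G y).det)
    {y : Model n} (hy : y ∈ U) (k : Fin n) :
    pd k (density G) y = density G y * ∑ a, christoffel G a a k y := by
  have hG := fun i j => differentiableAt_of_contDiffOn hU (h.smooth i j) hy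
  have hdd : DifferentiableAt ℝ (fun z => (G z).det) y :=
    differentiableAt_of_contDiffOn hU (contDiffOn_det h.smooth) hy
  have h1 := hasDerivAt_det (M := fun t : ℝ => G (y + t • stdVec k))
    (M' := Matrix.of fun i j => pd k (fun z => G z i j) y) fun i j => hasDerivAt_line (hG i j) k
  have h2 := h1.unique (hasDerivAt_line hdd k)
  simp only [zero_smul, add_zero, Matrix.of_apply] at h2
  have hp := hpos y hy
  have hadj : ∀ i j, (G y).adjugate i j = (G y).det * (G y)⁻¹ i j := by
    intro i j
    rw [Matrix.inv_def, Matrix.smul_apply, Ring.inverse_eq_inv', smul_eq_mul,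
      mul_inv_cancel_left₀ hp.ne']
  have h3 : pd k (density G) y = (1 / (2 * Real.sqrt (G y).det)) * pd k (fun z => (G z).det) y :=
    pd_comp (q := Real.sqrt) (Real.hasDerivAt_sqrt hp.ne') hdd
  have h4 : 0 < density G y := Real.sqrt_pos.2 hp
  have h5 : (G y).det = density G y ^ 2 := (Real.sq_sqrt hp.le).symm
  rw [h3, ← h2, h.christoffel_trace hU hy]
  simp only [hadj, mul_assoc, ← Finset.mul_sum]
  rw [show Real.sqrt (G y).det = density G y from rfl, h5]
  field_simp

theorem pd_metric (h : MetricOn U G) (hU : IsOpen U) {y : Model n} (hy : y ∈ U) (k a b : Fin n) :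
    pd k (fun z => G z a b) y =
      ∑ m, G y b m * christoffel G m k a y + ∑ m, G y a m * christoffel G m k b y := by
  have hs := fun i j l => h.pd_comm_index hU hy l i j
  rw [h.sum_mul_christoffel hy, h.sum_mul_christoffel hy, hs b a, hs k a, hs k b]
  ring

/-- The inverse metric is parallel. Differentiate G⁻¹ G = 1, insert `pd_metric`, and cancel the
factor G by multiplying with G⁻¹ on the right. -/
theorem pd_inv (h : MetricOn U G) (hU : IsOpen U) {y : Model n} (hy : y ∈ U) (k i j : Fin n) :
    pd k (fun z => (G z)⁻¹ i j) y =
      - ∑ l, christoffel G i k l y * (G y)⁻¹ l j - ∑ l, christoffel G j k l y * (G y)⁻¹ i l := by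
  have hG := fun i j => differentiableAt_of_contDiffOn hU (h.smooth i j) hy
  have hP := fun i j => differentiableAt_of_contDiffOn hU (h.inv_smooth i j) hy
  have h1 : ∀ c, ∑ b, ((G y)⁻¹ i b * pd k (fun z => G z b c) y
      + pd k (fun z => (G z)⁻¹ i b) y * G y b c) = 0 := by
    intro c
    have e : (fun z => ∑ b, (G z)⁻¹ i b * G z b c) =ᶠ[nhds y]
        fun _ => (1 : Matrix (Fin n) (Fin n) ℝ) i c :=
      Filter.eventually_of_mem (hU.mem_nhds hy) fun z hz => h.sum_inv_mul hz i c
    have := pd_congr (i := k) e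
    rw [pd_const, pd_sum fun b _ => (hP i b).fun_mul (hG b c)] at this
    rw [← this]
    exact Finset.sum_congr rfl fun b _ => (pd_mul (hP i b) (hG b c)).symm
  have h2 : ∀ c, ∑ b, pd k (fun z => (G z)⁻¹ i b) y * G y b c =
      - christoffel G i k c y - ∑ m, (∑ b, (G y)⁻¹ i b * christoffel G m k b y) * G y m c := by
    intro c
    have := h1 c
    rw [Finset.sum_add_distrib] at this
    have e1 : ∑ b, (G y)⁻¹ i b * pd k (fun z => G z b c) y = christoffel G i k c y
        + ∑ m, (∑ b, (G y)⁻¹ i b * christoffel G m k b y) * G y m c := by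
      simp only [h.pd_metric hU hy, mul_add, Finset.sum_add_distrib]
      rw [add_comm]
      congr 1
      · simp only [Finset.mul_sum, ← mul_assoc]
        rw [Finset.sum_comm]
        simp only [← Finset.sum_mul, h.sum_inv_mul hy]
        exact sum_one_apply i fun m => christoffel G m k c y
      · simp only [Finset.mul_sum, Finset.sum_mul]
        rw [Finset.sum_comm]
        exact Finset.sum_congr rfl fun m _ => Finset.sum_congr rfl fun b _ => by
          rw [h.apply_comm hy c m]; ring
    linarith
  have h3 : ∀ v : Fin n → ℝ, ∑ c, (∑ b, v b * G y b c) * (G y)⁻¹ c j = v j := by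
    intro v
    simp only [Finset.sum_mul]
    rw [Finset.sum_comm]
    simp only [mul_assoc, ← Finset.mul_sum, h.sum_mul_inv hy]
    simp [Matrix.one_apply]
  rw [← h3 fun b => pd k (fun z => (G z)⁻¹ i b) y]
  simp only [h2, sub_mul, Finset.sum_sub_distrib, neg_mul, Finset.sum_neg_distrib, h3]
  congr 1
  exact Finset.sum_congr rfl fun l _ => mul_comm _ _

end MetricOn

end Density

/-! ### Divergences in coordinates -/

section Divergence

variable {n : ℕ} {U : Set (Model n)} {G : Model n → Matrix (Fin n) (Fin n) ℝ}

/-- The divergence of a vector field with components `Y k`. -/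
def covdiv (G : Model n → Matrix (Fin n) (Fin n) ℝ) (Y : Fin n → Model n → ℝ) (y : Model n) : ℝ :=
  ∑ k, (pd k (Y k) y + (∑ a, christoffel G a a k y) * Y k y)

theorem MetricOn.density_smooth (h : MetricOn U G) (hpos : ∀ y ∈ U, 0 < (G y).det) :
    ContDiffOn ℝ ∞ (density G) U :=
  (contDiffOn_det h.smooth).sqrt fun y hy => (hpos y hy).ne'

/-- Turns a covariant divergence times the density into a sum of partial derivatives, whose integral
vanishes for compact support. -/
theorem MetricOn.sum_pd_density_mul (h : MetricOn U G) (hU : IsOpen U)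
    (hpos : ∀ y ∈ U, 0 < (G y).det) {Y : Fin n → Model n → ℝ} {y : Model n} (hy : y ∈ U)
    (hY : ∀ k, DifferentiableAt ℝ (Y k) y) :
    ∑ k, pd k (fun z => density G z * Y k z) y = density G y * covdiv G Y y := by
  have hd := differentiableAt_of_contDiffOn hU (h.density_smooth hpos) hy
  rw [covdiv, Finset.mul_sum]
  refine Finset.sum_congr rfl fun k _ => ?_
  rw [pd_mul hd (hY k), h.pd_density hU hpos hy]
  ring

theorem covdiv_mul {F : Model n → ℝ} {Y : Fin n → Model n → ℝ} {y : Model n}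
    (hF : DifferentiableAt ℝ F y) (hY : ∀ k, DifferentiableAt ℝ (Y k) y) :
    covdiv G (fun k z => F z * Y k z) y = F y * covdiv G Y y + ∑ k, pd k F y * Y k y := by
  rw [covdiv, covdiv, Finset.mul_sum, ← Finset.sum_add_distrib]
  refine Finset.sum_congr rfl fun k _ => ?_
  rw [pd_mul hF (hY k)]
  ring

theorem covdiv_sub {Y Z : Fin n → Model n → ℝ} {y : Model n}
    (hY : ∀ k, DifferentiableAt ℝ (Y k) y) (hZ : ∀ k, DifferentiableAt ℝ (Z k) y) :
    covdiv G (fun k z => Y k z - Z k z) y = covdiv G Y y - covdiv G Z y := by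
  rw [covdiv, covdiv, covdiv, ← Finset.sum_sub_distrib]
  refine Finset.sum_congr rfl fun k _ => ?_
  rw [pd_sub (hY k) (hZ k)]
  ring

/-- The components of the gradient of `F`. -/
def gradUp (G : Model n → Matrix (Fin n) (Fin n) ℝ) (F : Model n → ℝ) (k : Fin n)
    (y : Model n) : ℝ := ∑ l, (G y)⁻¹ k l * pd l F y

/-- The vector dual to the constant covector `ℓ`. -/
def covecUp (G : Model n → Matrix (Fin n) (Fin n) ℝ) (ℓ : Fin n → ℝ) (k : Fin n)
    (y : Model n) : ℝ := ∑ l, (G y)⁻¹ k l * ℓ l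

/-- The squared norm of the constant covector `ℓ`. -/
def covecSq (G : Model n → Matrix (Fin n) (Fin n) ℝ) (ℓ : Fin n → ℝ) (y : Model n) : ℝ :=
  ∑ k, ℓ k * covecUp G ℓ k y

/-- Minus the covariant derivative of the constant covector `ℓ`. -/
def covecGam (G : Model n → Matrix (Fin n) (Fin n) ℝ) (ℓ : Fin n → ℝ) (i j : Fin n)
    (y : Model n) : ℝ := ∑ m, ℓ m * christoffel G m i j y

namespace MetricOn

theorem gradUp_smooth (h : MetricOn U G) (hU : IsOpen U) {F : Model n → ℝ}
    (hF : ContDiffOn ℝ ∞ F U) (k : Fin n) : ContDiffOn ℝ ∞ (gradUp G F k) U :=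
  ContDiffOn.sum fun l _ => (h.inv_smooth k l).mul (contDiffOn_pd hU hF l)

theorem covecUp_smooth (h : MetricOn U G) (ℓ : Fin n → ℝ) (k : Fin n) :
    ContDiffOn ℝ ∞ (covecUp G ℓ k) U :=
  ContDiffOn.sum fun l _ => (h.inv_smooth k l).mul contDiffOn_const

theorem covecSq_smooth (h : MetricOn U G) (ℓ : Fin n → ℝ) : ContDiffOn ℝ ∞ (covecSq G ℓ) U :=
  ContDiffOn.sum fun k _ => contDiffOn_const.mul (h.covecUp_smooth ℓ k)

theorem covecGam_smooth (h : MetricOn U G) (hU : IsOpen U) (ℓ : Fin n → ℝ) (i j : Fin n) :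
    ContDiffOn ℝ ∞ (covecGam G ℓ i j) U :=
  ContDiffOn.sum fun m _ => contDiffOn_const.mul (h.christoffel_smooth hU m i j)

theorem covecGam_comm (h : MetricOn U G) (hU : IsOpen U) (ℓ : Fin n → ℝ) (i j : Fin n)
    {y : Model n} (hy : y ∈ U) : covecGam G ℓ i j y = covecGam G ℓ j i y :=
  Finset.sum_congr rfl fun m _ => by rw [h.christoffel_comm hU hy]

/-- Contracting a covector with a raised covector is symmetric. -/
theorem sum_inv_mul_comm (h : MetricOn U G) {y : Model n} (hy : y ∈ U) (a b : Fin n → ℝ) :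
    ∑ k, a k * ∑ l, (G y)⁻¹ k l * b l = ∑ k, (∑ l, (G y)⁻¹ k l * a l) * b k := by
  simp only [Finset.mul_sum, Finset.sum_mul]
  rw [Finset.sum_comm]
  exact Finset.sum_congr rfl fun k _ => Finset.sum_congr rfl fun l _ => by
    rw [h.inv_comm hy]; ring

/-- For constant ℓ one has ∇_k ℓ_l = −`covecGam` k l, and raising the index commutes with ∇; the
first sum converts ∇ back to ∂. -/
theorem pd_covecUp (h : MetricOn U G) (hU : IsOpen U) (ℓ : Fin n → ℝ) {y : Model n} (hy : y ∈ U)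
    (k i : Fin n) : pd k (covecUp G ℓ i) y =
      - ∑ l, christoffel G i k l y * covecUp G ℓ l y - ∑ l, (G y)⁻¹ i l * covecGam G ℓ k l y := by
  have hP := fun i j => differentiableAt_of_contDiffOn hU (h.inv_smooth i j) hy
  rw [show pd k (covecUp G ℓ i) y = pd k (fun z => ∑ j, (G z)⁻¹ i j * ℓ j) y from rfl,
    pd_sum fun j _ => (hP i j).fun_mul (differentiableAt_const _)]
  have : ∀ j, pd k (fun z => (G z)⁻¹ i j * ℓ j) y = (- ∑ l, christoffel G i k l y * (G y)⁻¹ l j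
      - ∑ l, christoffel G j k l y * (G y)⁻¹ i l) * ℓ j := fun j => by
    rw [pd_mul (hP i j) (differentiableAt_const _), pd_const, h.pd_inv hU hy]; ring
  simp only [this, sub_mul, neg_mul, Finset.sum_sub_distrib, Finset.sum_neg_distrib, covecGam,
    Finset.sum_mul, Finset.mul_sum]
  congr 1
  · rw [Finset.sum_comm]
    congr 1
    refine Finset.sum_congr rfl fun l _ => ?_
    rw [covecUp, Finset.mul_sum]
    exact Finset.sum_congr rfl fun j _ => by ring
  · rw [Finset.sum_comm]
    exact Finset.sum_congr rfl fun l _ => Finset.sum_congr rfl fun j _ => by ring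

theorem pd_covecSq (h : MetricOn U G) (hU : IsOpen U) (ℓ : Fin n → ℝ) {y : Model n} (hy : y ∈ U)
    (k : Fin n) : pd k (covecSq G ℓ) y = -2 * ∑ m, covecGam G ℓ k m y * covecUp G ℓ m y := by
  have hX := fun i => differentiableAt_of_contDiffOn hU (h.covecUp_smooth ℓ i) hy
  rw [show pd k (covecSq G ℓ) y = pd k (fun z => ∑ i, ℓ i * covecUp G ℓ i z) y from rfl,
    pd_sum fun i _ => (differentiableAt_const _).fun_mul (hX i)]
  simp only [fun i => pd_const_mul (i := k) (ℓ i) (hX i), h.pd_covecUp hU ℓ hy, mul_sub, mul_neg,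
    Finset.sum_sub_distrib, Finset.sum_neg_distrib]
  have e1 : ∑ i, ℓ i * ∑ l, (G y)⁻¹ i l * covecGam G ℓ k l y =
      ∑ m, covecGam G ℓ k m y * covecUp G ℓ m y := by
    rw [h.sum_inv_mul_comm hy]
    exact Finset.sum_congr rfl fun m _ => mul_comm _ _
  have e2 : ∑ i, ℓ i * ∑ l, christoffel G i k l y * covecUp G ℓ l y =
      ∑ m, covecGam G ℓ k m y * covecUp G ℓ m y := by
    simp only [covecGam, Finset.mul_sum, Finset.sum_mul]
    rw [Finset.sum_comm]
    exact Finset.sum_congr rfl fun m _ => Finset.sum_congr rfl fun l _ => by ring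
  rw [e1, e2]; ring

theorem covdiv_covecUp (h : MetricOn U G) (hU : IsOpen U) (ℓ : Fin n → ℝ) {y : Model n}
    (hy : y ∈ U) :
    covdiv G (covecUp G ℓ) y = - ∑ i, ∑ j, (G y)⁻¹ i j * covecGam G ℓ i j y := by
  simp only [covdiv, h.pd_covecUp hU ℓ hy, Finset.sum_add_distrib, Finset.sum_sub_distrib,
    Finset.sum_neg_distrib, Finset.sum_mul]
  have : ∑ k, ∑ a, christoffel G a a k y * covecUp G ℓ k y =
      ∑ k, ∑ l, christoffel G k k l y * covecUp G ℓ l y := Finset.sum_comm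
  rw [this]; ring

/-- Differentiating G⁻¹ yields two Christoffel sums: one cancels the Christoffel term of the
divergence, the other is that of the Hessian. -/
theorem covdiv_gradUp (h : MetricOn U G) (hU : IsOpen U) {F : Model n → ℝ}
    (hF : ContDiffOn ℝ ∞ F U) {y : Model n} (hy : y ∈ U) :
    covdiv G (gradUp G F) y = laplaceCoord G F y := by
  have hP := fun i j => differentiableAt_of_contDiffOn hU (h.inv_smooth i j) hy
  have hd := fun j => differentiableAt_of_contDiffOn hU (contDiffOn_pd hU hF j) hy
  have h1 : ∀ k, pd k (gradUp G F k) y = ∑ j, (G y)⁻¹ k j * pd k (pd j F) y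
      - ∑ l, christoffel G k k l y * gradUp G F l y
      - ∑ l, (G y)⁻¹ k l * ∑ j, christoffel G j k l y * pd j F y := by
    intro k
    rw [show pd k (gradUp G F k) y = pd k (fun z => ∑ j, (G z)⁻¹ k j * pd j F z) y from rfl,
      pd_sum fun j _ => (hP k j).fun_mul (hd j)]
    have : ∀ j, pd k (fun z => (G z)⁻¹ k j * pd j F z) y = (G y)⁻¹ k j * pd k (pd j F) y
      + (- ∑ l, christoffel G k k l y * (G y)⁻¹ l j
      - ∑ l, christoffel G j k l y * (G y)⁻¹ k l) * pd j F y := fun j => by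
      rw [pd_mul (hP k j) (hd j), h.pd_inv hU hy]
    simp only [this, sub_mul, neg_mul, Finset.sum_add_distrib, Finset.sum_sub_distrib,
      Finset.sum_neg_distrib, Finset.sum_mul, Finset.mul_sum]
    rw [add_sub_assoc', ← sub_eq_add_neg]
    congr 1
    · rw [Finset.sum_comm]
      congr 1
      refine Finset.sum_congr rfl fun l _ => ?_
      rw [gradUp, Finset.mul_sum]
      exact Finset.sum_congr rfl fun j _ => by ring
    · rw [Finset.sum_comm]
      exact Finset.sum_congr rfl fun l _ => Finset.sum_congr rfl fun j _ => by ring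
  simp only [covdiv, h1, laplaceCoord, hessianCoord, mul_sub, Finset.sum_add_distrib,
    Finset.sum_sub_distrib, Finset.sum_mul]
  have : ∑ k, ∑ a, christoffel G a a k y * gradUp G F k y =
      ∑ k, ∑ l, christoffel G k k l y * gradUp G F l y := Finset.sum_comm
  rw [this]; ring

end MetricOn

/-- Renames the four summation indices by a bijection, as needed to match the quadratic terms in
`covdiv_palatiniField`. -/
theorem sum_four_reindex {f g : Fin n → Fin n → Fin n → Fin n → ℝ}
    (e : Fin n × Fin n × Fin n × Fin n ≃ Fin n × Fin n × Fin n × Fin n)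
    (h : ∀ p : Fin n × Fin n × Fin n × Fin n, f p.1 p.2.1 p.2.2.1 p.2.2.2 =
      g (e p).1 (e p).2.1 (e p).2.2.1 (e p).2.2.2) :
    ∑ a, ∑ b, ∑ c, ∑ d, f a b c d = ∑ a, ∑ b, ∑ c, ∑ d, g a b c d := by
  have key : ∀ f : Fin n → Fin n → Fin n → Fin n → ℝ, ∑ a, ∑ b, ∑ c, ∑ d, f a b c d =
      ∑ p : Fin n × Fin n × Fin n × Fin n, f p.1 p.2.1 p.2.2.1 p.2.2.2 := by
    intro f
    simp only [Fintype.sum_prod_type]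
  rw [key, key]
  exact Fintype.sum_equiv e _ _ h

/-- The linearized Ricci tensor, in terms of the variation `A` of the Christoffel symbols. -/
def ricciVar (G : Model n → Matrix (Fin n) (Fin n) ℝ) (A : Fin n → Fin n → Fin n → Model n → ℝ)
    (i j : Fin n) (y : Model n) : ℝ :=
  ∑ k, (pd k (A k i j) y - pd i (A k k j) y) +
    ∑ k, ∑ l, ((A k k l y * christoffel G l i j y + christoffel G k k l y * A l i j y) -
      (A k i l y * christoffel G l k j y + christoffel G k i l y * A l k j y))

/-- The vector field whose divergence is the trace of the linearized Ricci tensor. -/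
def palatiniField (G : Model n → Matrix (Fin n) (Fin n) ℝ)
    (A : Fin n → Fin n → Fin n → Model n → ℝ) (k : Fin n) (y : Model n) : ℝ :=
  ∑ i, ∑ j, ((G y)⁻¹ i j * A k i j y - (G y)⁻¹ k j * A i i j y)

/-- The Palatini identity: the linearized Ricci tensor is ∇_k A^k_ij − ∇_i A^k_kj, and G⁻¹ is
parallel, so its contraction is a divergence. -/
theorem MetricOn.covdiv_palatiniField (h : MetricOn U G) (hU : IsOpen U)
    {A : Fin n → Fin n → Fin n → Model n → ℝ} (hA : ∀ k i j, ContDiffOn ℝ ∞ (A k i j) U) {y : Model n} (hy : y ∈ U) :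
    covdiv G (palatiniField G A) y = ∑ i, ∑ j, (G y)⁻¹ i j * ricciVar G A i j y := by
  have hP := fun i j => differentiableAt_of_contDiffOn hU (h.inv_smooth i j) hy
  have hd := fun k i j => differentiableAt_of_contDiffOn hU (hA k i j) hy
  have hΓ := h.christoffel_comm hU hy
  have hPs := h.inv_comm hy
  have h1 : ∀ k, pd k (palatiniField G A k) y = ∑ i, ∑ j, ((G y)⁻¹ i j * pd k (A k i j) y
      - (∑ l, christoffel G i k l y * (G y)⁻¹ l j) * A k i j y
      - (∑ l, christoffel G j k l y * (G y)⁻¹ i l) * A k i j y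
      - (G y)⁻¹ k j * pd k (A i i j) y
      + (∑ l, christoffel G k k l y * (G y)⁻¹ l j) * A i i j y
      + (∑ l, christoffel G j k l y * (G y)⁻¹ k l) * A i i j y) := by
    intro k
    have ha := fun i j => (hP i j).fun_mul (hd k i j)
    have hb := fun i j => (hP k j).fun_mul (hd i i j)
    unfold palatiniField
    rw [pd_sum fun i _ => DifferentiableAt.fun_sum fun j _ => (ha i j).fun_sub (hb i j)]
    refine Finset.sum_congr rfl fun i _ => ?_
    rw [pd_sum fun j _ => (ha i j).fun_sub (hb i j)]
    refine Finset.sum_congr rfl fun j _ => ?_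
    rw [pd_sub (ha i j) (hb i j), pd_mul (hP i j) (hd k i j), pd_mul (hP k j) (hd i i j),
      h.pd_inv hU hy, h.pd_inv hU hy]
    ring
  simp only [covdiv, h1, palatiniField, ricciVar, mul_add, mul_sub, Finset.sum_add_distrib,
    Finset.sum_sub_distrib, Finset.mul_sum, Finset.sum_mul]
  have t1 : ∑ k, ∑ i, ∑ j, (G y)⁻¹ i j * pd k (A k i j) y =
      ∑ i, ∑ j, ∑ k, (G y)⁻¹ i j * pd k (A k i j) y := by
    rw [Finset.sum_comm]
    exact Finset.sum_congr rfl fun i _ => Finset.sum_comm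
  have t2 : ∑ k, ∑ i, ∑ j, (G y)⁻¹ k j * pd k (A i i j) y =
      ∑ i, ∑ j, ∑ k, (G y)⁻¹ i j * pd i (A k k j) y :=
    Finset.sum_congr rfl fun i _ => Finset.sum_comm
  have t3 : ∑ k, ∑ i, ∑ j, ∑ l, christoffel G i k l y * (G y)⁻¹ l j * A k i j y =
      ∑ i, ∑ j, ∑ k, ∑ l, (G y)⁻¹ i j * (christoffel G k i l y * A l k j y) :=
    sum_four_reindex ⟨fun p => (p.2.2.2, p.2.2.1, p.2.1, p.1), fun p => (p.2.2.2, p.2.2.1, p.2.1, p.1),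
      fun _ => rfl, fun _ => rfl⟩ fun p => by
        simp only [Equiv.coe_fn_mk]; rw [hΓ p.2.1 p.1]; ring
  have t4 : ∑ k, ∑ i, ∑ j, ∑ l, christoffel G j k l y * (G y)⁻¹ i l * A k i j y =
      ∑ i, ∑ j, ∑ k, ∑ l, (G y)⁻¹ i j * (A k i l y * christoffel G l k j y) :=
    sum_four_reindex ⟨fun p => (p.2.1, p.2.2.2, p.1, p.2.2.1), fun p => (p.2.2.1, p.1, p.2.2.2, p.2.1),
      fun _ => rfl, fun _ => rfl⟩ fun p => by
        simp only [Equiv.coe_fn_mk]; ring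
  have t5 : ∑ k, ∑ i, ∑ j, ∑ l, christoffel G j k l y * (G y)⁻¹ k l * A i i j y =
      ∑ i, ∑ j, ∑ k, ∑ l, (G y)⁻¹ i j * (A k k l y * christoffel G l i j y) :=
    sum_four_reindex ⟨fun p => (p.1, p.2.2.2, p.2.1, p.2.2.1), fun p => (p.1, p.2.2.1, p.2.2.2, p.2.1),
      fun _ => rfl, fun _ => rfl⟩ fun p => by
        simp only [Equiv.coe_fn_mk]; ring
  have t6 : ∑ k, ∑ i, ∑ j, ∑ a, christoffel G a a k y * ((G y)⁻¹ i j * A k i j y) =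
      ∑ i, ∑ j, ∑ k, ∑ l, (G y)⁻¹ i j * (christoffel G k k l y * A l i j y) :=
    sum_four_reindex ⟨fun p => (p.2.1, p.2.2.1, p.2.2.2, p.1), fun p => (p.2.2.2, p.1, p.2.1, p.2.2.1),
      fun _ => rfl, fun _ => rfl⟩ fun p => by
        simp only [Equiv.coe_fn_mk]; ring
  -- These two sums have opposite signs and cancel: one comes from differentiating G⁻¹, the other
  -- from the Christoffel term of the divergence.
  have t7 : ∑ k, ∑ i, ∑ j, ∑ l, christoffel G k k l y * (G y)⁻¹ l j * A i i j y =
      ∑ k, ∑ i, ∑ j, ∑ a, christoffel G a a k y * ((G y)⁻¹ k j * A i i j y) :=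
    sum_four_reindex ⟨fun p => (p.2.2.2, p.2.1, p.2.2.1, p.1), fun p => (p.2.2.2, p.2.1, p.2.2.1, p.1),
      fun _ => rfl, fun _ => rfl⟩ fun p => by
        simp only [Equiv.coe_fn_mk]; ring
  rw [t1, t2, t3, t4, t5, t6, t7]
  ring

end Divergence

/-! ### The first variation of the curvature in the direction `u ℓ ⊗ ℓ` -/

section Variation

variable {n : ℕ} {U : Set (Model n)} {G : Model n → Matrix (Fin n) (Fin n) ℝ}

/-- Differentiability is already known from smoothness of the family, so differentiating G⁻¹ G = 1
determines the derivative. -/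
theorem SmoothFamily.hasDerivAt_inv {W : Set (ℝ × Model n)}
    {G : ℝ → Model n → Matrix (Fin n) (Fin n) ℝ} {M' : Matrix (Fin n) (Fin n) ℝ} (hW : IsOpen W)
    (hG : ∀ i j, SmoothFamily W fun t y => G t y i j)
    (hd : ∀ q ∈ W, (G q.1 q.2).det ≠ 0) {t : ℝ} {y : Model n} (h : (t, y) ∈ W)
    (hM : ∀ i j, HasDerivAt (fun s => G s y i j) (M' i j) t) (i j : Fin n) :
    HasDerivAt (fun s => (G s y)⁻¹ i j)
      (-∑ a, ∑ b, (G t y)⁻¹ i a * M' a b * (G t y)⁻¹ b j) t := by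
  have hP := fun i j => (SmoothFamily.inv hG hd i j).hasDerivAt_time hW h
  convert hP i j using 1
  set P' : Fin n → Fin n → ℝ := fun i j =>
    fderiv ℝ (fun q : ℝ × Model n => (G q.1 q.2)⁻¹ i j) (t, y) (1, 0) with hP'
  have hu := isUnit_iff_ne_zero.2 (hd _ h)
  have h1 : ∀ c, ∑ b, (P' i b * G t y b c + (G t y)⁻¹ i b * M' b c) = 0 := by
    intro c
    have e1 : HasDerivAt (fun s => ∑ b, (G s y)⁻¹ i b * G s y b c)
        (∑ b, (P' i b * G t y b c + (G t y)⁻¹ i b * M' b c)) t :=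
      HasDerivAt.fun_sum fun b _ => (hP i b).mul (hM b c)
    have hc : Filter.Tendsto (fun s : ℝ => (s, y)) (nhds t) (nhds (t, y)) :=
      (continuous_id.prodMk continuous_const).tendsto' _ _ rfl
    have e2 : (fun s => ∑ b, (G s y)⁻¹ i b * G s y b c) =ᶠ[nhds t]
        fun _ => (1 : Matrix (Fin n) (Fin n) ℝ) i c := by
      filter_upwards [hc (hW.mem_nhds h)] with s hs
      rw [← Matrix.nonsing_inv_mul _ (isUnit_iff_ne_zero.2 (hd _ hs)), Matrix.mul_apply]
    exact (e1.congr_of_eventuallyEq e2.symm).unique (hasDerivAt_const t _)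
  have h2 : ∀ c, ∑ b, P' i b * G t y b c = - ∑ b, (G t y)⁻¹ i b * M' b c := by
    intro c
    have := h1 c
    rw [Finset.sum_add_distrib] at this
    linarith
  have h3 : ∑ c, (∑ b, P' i b * G t y b c) * (G t y)⁻¹ c j = P' i j := by
    have e : ∀ b, ∑ c, G t y b c * (G t y)⁻¹ c j = (1 : Matrix (Fin n) (Fin n) ℝ) b j := by
      intro b; rw [← Matrix.mul_nonsing_inv _ hu, Matrix.mul_apply]
    simp only [Finset.sum_mul]
    rw [Finset.sum_comm]
    simp only [mul_assoc, ← Finset.mul_sum, e]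
    simp [Matrix.one_apply]
  change _ = P' i j
  rw [← h3]
  simp only [h2, neg_mul, Finset.sum_neg_distrib, Finset.sum_mul]
  rw [Finset.sum_comm]

/-- The metric `G + t u ℓ ⊗ ℓ`. -/
def varMetric (G : Model n → Matrix (Fin n) (Fin n) ℝ) (u : Model n → ℝ) (ℓ : Fin n → ℝ)
    (t : ℝ) (y : Model n) : Matrix (Fin n) (Fin n) ℝ :=
  Matrix.of fun i j => G y i j + t * (u y * (ℓ i * ℓ j))

theorem varMetric_zero (G : Model n → Matrix (Fin n) (Fin n) ℝ) (u : Model n → ℝ)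
    (ℓ : Fin n → ℝ) : varMetric G u ℓ 0 = G := by
  ext y i j; simp [varMetric]

/-- The set of pairs `(t, y)` where `G + t u ℓ ⊗ ℓ` has positive determinant. -/
def varDomain (U : Set (Model n)) (G : Model n → Matrix (Fin n) (Fin n) ℝ) (u : Model n → ℝ)
    (ℓ : Fin n → ℝ) : Set (ℝ × Model n) :=
  {q | q.2 ∈ U ∧ 0 < (varMetric G u ℓ q.1 q.2).det}

/-- The variation of the Christoffel symbols in the direction `u ℓ ⊗ ℓ`. -/
def christoffelVar (G : Model n → Matrix (Fin n) (Fin n) ℝ) (u : Model n → ℝ) (ℓ : Fin n → ℝ)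
    (k i j : Fin n) (y : Model n) : ℝ :=
  -(u y * covecUp G ℓ k y * covecGam G ℓ i j y)
    + (1 / 2) * (covecUp G ℓ k y * (pd i u y * ℓ j + pd j u y * ℓ i))
    - (1 / 2) * (gradUp G u k y * (ℓ i * ℓ j))

/-- The variation of the scalar curvature in the direction `u ℓ ⊗ ℓ`. -/
def scalarVar (G : Model n → Matrix (Fin n) (Fin n) ℝ) (u : Model n → ℝ) (ℓ : Fin n → ℝ)
    (y : Model n) : ℝ :=
  -(u y * ∑ i, ∑ j, ricciCoord G i j y * covecUp G ℓ i y * covecUp G ℓ j y)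
    + ∑ i, ∑ j, (G y)⁻¹ i j * ricciVar G (christoffelVar G u ℓ) i j y

namespace MetricOn

variable {u : Model n → ℝ} {ℓ : Fin n → ℝ}

theorem varMetric_smooth (h : MetricOn U G) (hu : ContDiffOn ℝ ∞ u U) (i j : Fin n) :
    SmoothFamily (Set.univ ×ˢ U) fun t y => varMetric G u ℓ t y i j := by
  have h1 : SmoothFamily (Set.univ ×ˢ U) fun _ => u :=
    SmoothFamily.of_contDiffOn hu fun _ hq => hq.2
  have h2 : SmoothFamily (Set.univ ×ˢ U) fun t (_ : Model n) => t := contDiff_fst.contDiffOn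
  exact (h.family i j).add (h2.mul (h1.mul (SmoothFamily.const (ℓ i * ℓ j))))

theorem isOpen_varDomain (h : MetricOn U G) (hU : IsOpen U) (hu : ContDiffOn ℝ ∞ u U) :
    IsOpen (varDomain U G u ℓ) := by
  have h1 : ContinuousOn (fun q : ℝ × Model n => (varMetric G u ℓ q.1 q.2).det)
      (Set.univ ×ˢ U) := (contDiffOn_det fun i j => h.varMetric_smooth hu i j).continuousOn
  have h2 := h1.isOpen_inter_preimage (isOpen_univ.prod hU) (isOpen_Ioi (a := (0 : ℝ)))
  convert h2 using 1
  ext q; simp [varDomain]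

theorem varMetric_smooth' (h : MetricOn U G) (hu : ContDiffOn ℝ ∞ u U) (i j : Fin n) :
    SmoothFamily (varDomain U G u ℓ) fun t y => varMetric G u ℓ t y i j :=
  (h.varMetric_smooth hu i j).mono fun _ hq => ⟨trivial, hq.1⟩

theorem zero_mem_varDomain (hpos : ∀ y ∈ U, 0 < (G y).det) {y : Model n} (hy : y ∈ U) :
    ((0 : ℝ), y) ∈ varDomain U G u ℓ := ⟨hy, by simpa [varMetric_zero] using hpos y hy⟩

theorem hasDerivAt_varMetric (t : ℝ) (y : Model n) (i j : Fin n) :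
    HasDerivAt (fun s => varMetric G u ℓ s y i j) (u y * (ℓ i * ℓ j)) t := by
  simpa [varMetric] using ((hasDerivAt_id t).mul_const (u y * (ℓ i * ℓ j))).const_add (G y i j)

variable (h : MetricOn U G) (hU : IsOpen U) (hu : ContDiffOn ℝ ∞ u U)
  (hpos : ∀ y ∈ U, 0 < (G y).det)
include h hU hu hpos

theorem hasDerivAt_varMetric_inv {y : Model n} (hy : y ∈ U) (i j : Fin n) :
    HasDerivAt (fun s => (varMetric G u ℓ s y)⁻¹ i j)
      (-(u y * covecUp G ℓ i y * covecUp G ℓ j y)) 0 := by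
  have := SmoothFamily.hasDerivAt_inv (M' := Matrix.of fun i j => u y * (ℓ i * ℓ j))
    (h.isOpen_varDomain (ℓ := ℓ) hU hu) (h.varMetric_smooth' hu)
    (fun _ hq => hq.2.ne') (zero_mem_varDomain hpos hy) (hasDerivAt_varMetric 0 y) i j
  convert this using 1
  rw [varMetric_zero, mul_assoc, covecUp, covecUp, Finset.sum_mul_sum, Finset.mul_sum]
  congr 1
  refine Finset.sum_congr rfl fun a _ => ?_
  rw [Finset.mul_sum]
  refine Finset.sum_congr rfl fun b _ => ?_
  rw [h.inv_comm hy j b, Matrix.of_apply]; ring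

omit h hU hu in
theorem hasDerivAt_varMetric_density {y : Model n} (hy : y ∈ U) :
    HasDerivAt (fun s => density (varMetric G u ℓ s) y)
      ((1 / 2) * density G y * u y * covecSq G ℓ y) 0 := by
  have h1 := hasDerivAt_det (M := fun s => varMetric G u ℓ s y)
    (M' := Matrix.of fun i j => u y * (ℓ i * ℓ j)) (hasDerivAt_varMetric 0 y)
  have hp := hpos y hy
  have h2 : HasDerivAt (fun s => density (varMetric G u ℓ s) y) _ 0 :=
    h1.sqrt (by simpa [varMetric_zero] using hp.ne')
  have hadj : ∀ i j, (G y).adjugate i j = (G y).det * (G y)⁻¹ i j := by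
    intro i j
    rw [Matrix.inv_def, Matrix.smul_apply, Ring.inverse_eq_inv', smul_eq_mul,
      mul_inv_cancel_left₀ hp.ne']
  convert h2 using 1
  have h4 : 0 < density G y := Real.sqrt_pos.2 hp
  have h5 : (G y).det = density G y ^ 2 := (Real.sq_sqrt hp.le).symm
  have h6 : ∑ i, ∑ j, (varMetric G u ℓ 0 y).adjugate i j *
      (Matrix.of fun i j => u y * (ℓ i * ℓ j)) j i = density G y ^ 2 * u y * covecSq G ℓ y := by
    simp only [varMetric_zero, hadj, h5, covecSq, covecUp, Finset.mul_sum, Matrix.of_apply]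
    exact Finset.sum_congr rfl fun _ _ => Finset.sum_congr rfl fun _ _ => by ring
  rw [h6, varMetric_zero, show Real.sqrt (G y).det = density G y from rfl]
  field_simp

theorem hasDerivAt_varMetric_christoffel {y : Model n} (hy : y ∈ U) (k i j : Fin n) :
    HasDerivAt (fun s => christoffel (varMetric G u ℓ s) k i j y)
      (christoffelVar G u ℓ k i j y) 0 := by
  have hW := h.isOpen_varDomain (ℓ := ℓ) hU hu
  have h0 := zero_mem_varDomain (u := u) (ℓ := ℓ) hpos hy
  have hpd : ∀ c a b, HasDerivAt (fun s => pd c (fun z => varMetric G u ℓ s z a b) y)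
      (pd c u y * (ℓ a * ℓ b)) 0 := by
    intro c a b
    have := (h.varMetric_smooth' (ℓ := ℓ) hu a b).hasDerivAt_pd hW h0 c
    convert this using 1
    have e : (fun z => deriv (fun s => varMetric G u ℓ s z a b) 0)
        = fun z => (ℓ a * ℓ b) * u z := by
      ext z; rw [(hasDerivAt_varMetric 0 z a b).deriv]; ring
    rw [e, pd_const_mul _ (differentiableAt_of_contDiffOn hU hu hy)]; ring
  have h1 : HasDerivAt (fun s => christoffel (varMetric G u ℓ s) k i j y) _ 0 :=
    (HasDerivAt.fun_sum (u := Finset.univ) fun l _ =>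
      (h.hasDerivAt_varMetric_inv (ℓ := ℓ) hU hu hpos hy k l).fun_mul
        (((hpd i j l).fun_add (hpd j i l)).fun_sub (hpd l i j))).const_mul (1 / 2 : ℝ)
  convert h1 using 1
  -- Varying G⁻¹ leaves the Christoffel symbols of the first kind contracted with X = G⁻¹ ℓ, which
  -- are ℓ_m Γ^m_ij.
  have e1 : ∑ l, covecUp G ℓ l y * ((1 / 2) * (pd i (fun z => G z j l) y
      + pd j (fun z => G z i l) y - pd l (fun z => G z i j) y)) = covecGam G ℓ i j y := by
    simp only [← h.sum_mul_christoffel hy, covecGam, Finset.mul_sum, ← mul_assoc]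
    rw [Finset.sum_comm]
    simp only [← Finset.sum_mul]
    refine Finset.sum_congr rfl fun m _ => ?_
    congr 1
    simp only [covecUp, Finset.sum_mul]
    rw [Finset.sum_comm]
    have : ∀ a, ∑ l, (G y)⁻¹ l a * ℓ a * G y l m = ℓ a * (1 : Matrix (Fin n) (Fin n) ℝ) a m := by
      intro a
      rw [← h.sum_inv_mul hy, Finset.mul_sum]
      exact Finset.sum_congr rfl fun l _ => by rw [h.inv_comm hy l a]; ring
    simp [this, Matrix.one_apply]
  simp only [varMetric_zero, Finset.sum_add_distrib, christoffelVar, gradUp, ← e1]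
  refine Eq.trans ?_ (mul_add _ _ _).symm
  rw [add_sub_assoc]
  congr 1
  · simp only [Finset.mul_sum, ← Finset.sum_neg_distrib]
    exact Finset.sum_congr rfl fun l _ => by ring
  · simp only [covecUp, Finset.mul_sum, Finset.sum_mul, ← Finset.sum_sub_distrib]
    exact Finset.sum_congr rfl fun l _ => by ring

omit hpos in
theorem christoffelVar_smooth (k i j : Fin n) :
    ContDiffOn ℝ ∞ (christoffelVar G u ℓ k i j) U := by
  have h1 := h.covecUp_smooth ℓ k
  have h2 := contDiffOn_pd hU hu
  exact (((hu.mul h1).mul (h.covecGam_smooth hU ℓ i j)).neg.add (contDiffOn_const.mul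
    (h1.mul (((h2 i).mul contDiffOn_const).add ((h2 j).mul contDiffOn_const))))).sub
    (contDiffOn_const.mul ((h.gradUp_smooth hU hu k).mul contDiffOn_const))

theorem hasDerivAt_varMetric_ricciCoord {y : Model n} (hy : y ∈ U) (i j : Fin n) :
    HasDerivAt (fun s => ricciCoord (varMetric G u ℓ s) i j y)
      (ricciVar G (christoffelVar G u ℓ) i j y) 0 := by
  have hW := h.isOpen_varDomain (ℓ := ℓ) hU hu
  have h0 := zero_mem_varDomain (u := u) (ℓ := ℓ) hpos hy
  have hΓ := fun k i j => h.hasDerivAt_varMetric_christoffel (ℓ := ℓ) hU hu hpos hy k i j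
  have hpd : ∀ c k i j, HasDerivAt (fun s => pd c (christoffel (varMetric G u ℓ s) k i j) y)
      (pd c (christoffelVar G u ℓ k i j) y) 0 := by
    intro c k i j
    have := (SmoothFamily.christoffel hW (h.varMetric_smooth' (ℓ := ℓ) hu)
      (fun _ hq => hq.2.ne') k i j).hasDerivAt_pd hW h0 c
    convert this using 1
    -- The variation of the Christoffel symbols is known on all of U, so it may be differentiated in
    -- space.
    exact pd_congr (Filter.eventually_of_mem (hU.mem_nhds hy) fun z hz =>
      (h.hasDerivAt_varMetric_christoffel hU hu hpos hz k i j).deriv.symm)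
  have h1 : HasDerivAt (fun s => ricciCoord (varMetric G u ℓ s) i j y) _ 0 :=
    (HasDerivAt.fun_sum (u := Finset.univ) fun k _ => (hpd k k i j).fun_sub (hpd i k k j)).fun_add
    (HasDerivAt.fun_sum (u := Finset.univ) fun k _ => HasDerivAt.fun_sum (u := Finset.univ)
      fun l _ => ((hΓ k k l).fun_mul (hΓ l i j)).fun_sub ((hΓ k i l).fun_mul (hΓ l k j)))
  convert h1 using 1
  rw [varMetric_zero, ricciVar]

theorem hasDerivAt_varMetric_scalarCoord {y : Model n} (hy : y ∈ U) :
    HasDerivAt (fun s => scalarCoord (varMetric G u ℓ s) y) (scalarVar G u ℓ y) 0 := by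
  have h1 : HasDerivAt (fun s => scalarCoord (varMetric G u ℓ s) y) _ 0 :=
    HasDerivAt.fun_sum (u := Finset.univ) fun i _ => HasDerivAt.fun_sum (u := Finset.univ)
      fun j _ => (h.hasDerivAt_varMetric_inv (ℓ := ℓ) hU hu hpos hy i j).fun_mul
        (h.hasDerivAt_varMetric_ricciCoord hU hu hpos hy i j)
  convert h1 using 1
  simp only [varMetric_zero, scalarVar, Finset.sum_add_distrib]
  congr 1
  simp only [Finset.mul_sum, ← Finset.sum_neg_distrib]
  exact Finset.sum_congr rfl fun _ _ => Finset.sum_congr rfl fun _ _ => by ring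

omit hU hu hpos in
/-- The explicit form of the vector field in the first variation. -/
theorem palatiniField_christoffelVar {y : Model n} (hy : y ∈ U) (k : Fin n) :
    palatiniField G (christoffelVar G u ℓ) k y =
      -(u y * (∑ i, ∑ j, (G y)⁻¹ i j * covecGam G ℓ i j y)) * covecUp G ℓ k y
      + (∑ i, covecUp G ℓ i y * pd i u y) * covecUp G ℓ k y - covecSq G ℓ y * gradUp G u k y
      + u y * ∑ j, (G y)⁻¹ k j * ∑ i, covecGam G ℓ i j y * covecUp G ℓ i y := by
  have hX : ∀ i, ∑ j, (G y)⁻¹ i j * ℓ j = covecUp G ℓ i y := fun i => rfl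
  have hX' : ∀ j, ∑ i, (G y)⁻¹ i j * ℓ i = covecUp G ℓ j y := fun j =>
    Finset.sum_congr rfl fun i _ => by rw [h.inv_comm hy]
  have hup : ∀ i, ∑ j, (G y)⁻¹ i j * pd j u y = gradUp G u i y := fun i => rfl
  have hX2 : ∑ j, covecUp G ℓ j y * ℓ j = covecSq G ℓ y :=
    Finset.sum_congr rfl fun i _ => mul_comm _ _
  have hgl : ∑ j, gradUp G u j y * ℓ j = ∑ i, covecUp G ℓ i y * pd i u y := by
    have := h.sum_inv_mul_comm hy ℓ fun j => pd j u y
    simp only [hX, hup] at this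
    rw [← this]
    exact Finset.sum_congr rfl fun i _ => mul_comm _ _
  have t1 : ∑ i, ∑ j, (G y)⁻¹ i j * christoffelVar G u ℓ k i j y =
      -(u y * (∑ i, ∑ j, (G y)⁻¹ i j * covecGam G ℓ i j y)) * covecUp G ℓ k y
      + (∑ i, covecUp G ℓ i y * pd i u y) * covecUp G ℓ k y
      - (1 / 2) * (covecSq G ℓ y * gradUp G u k y) := by
    have e1 : ∑ i, ∑ j, (G y)⁻¹ i j * (pd i u y * ℓ j) = ∑ i, covecUp G ℓ i y * pd i u y := by
      simp only [mul_left_comm _ (pd _ u y), ← Finset.mul_sum, hX]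
      exact Finset.sum_congr rfl fun i _ => mul_comm _ _
    have e2 : ∑ i, ∑ j, (G y)⁻¹ i j * (pd j u y * ℓ i) = ∑ i, covecUp G ℓ i y * pd i u y := by
      rw [Finset.sum_comm]
      simp only [mul_left_comm _ (pd _ u y), ← Finset.mul_sum, hX']
      exact Finset.sum_congr rfl fun i _ => mul_comm _ _
    have e3 : ∑ i, ∑ j, (G y)⁻¹ i j * (ℓ i * ℓ j) = covecSq G ℓ y := by
      simp only [mul_left_comm _ (ℓ _), ← Finset.mul_sum, hX]
      rfl
    have e4 : ∀ i j, (G y)⁻¹ i j * christoffelVar G u ℓ k i j y =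
        -(u y * covecUp G ℓ k y) * ((G y)⁻¹ i j * covecGam G ℓ i j y)
        + (1 / 2 * covecUp G ℓ k y) * ((G y)⁻¹ i j * (pd i u y * ℓ j)
        + (G y)⁻¹ i j * (pd j u y * ℓ i))
        - (1 / 2 * gradUp G u k y) * ((G y)⁻¹ i j * (ℓ i * ℓ j)) := fun i j => by
      rw [christoffelVar]; ring
    simp only [e4, Finset.sum_sub_distrib, Finset.sum_add_distrib, ← Finset.mul_sum, e1, e2, e3]
    ring
  have t2 : ∀ j, ∑ i, christoffelVar G u ℓ i i j y =
      -(u y * ∑ i, covecGam G ℓ i j y * covecUp G ℓ i y)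
      + (1 / 2) * (covecSq G ℓ y * pd j u y) := by
    intro j
    have e4 : ∀ i, christoffelVar G u ℓ i i j y = -u y * (covecGam G ℓ i j y * covecUp G ℓ i y)
        + (1 / 2 * ℓ j) * (covecUp G ℓ i y * pd i u y)
        + (1 / 2 * pd j u y) * (covecUp G ℓ i y * ℓ i)
        - (1 / 2 * ℓ j) * (gradUp G u i y * ℓ i) := fun i => by
      rw [christoffelVar]; ring
    simp only [e4, Finset.sum_sub_distrib, Finset.sum_add_distrib, ← Finset.mul_sum, hX2, hgl]
    ring
  have t3 : ∑ i, ∑ j, (G y)⁻¹ k j * christoffelVar G u ℓ i i j y =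
      -(u y * ∑ j, (G y)⁻¹ k j * ∑ i, covecGam G ℓ i j y * covecUp G ℓ i y)
      + (1 / 2) * (covecSq G ℓ y * gradUp G u k y) := by
    rw [Finset.sum_comm]
    simp only [← Finset.mul_sum, t2, mul_add, Finset.sum_add_distrib, gradUp]
    simp only [Finset.mul_sum, ← Finset.sum_neg_distrib]
    congr 1
    · exact Finset.sum_congr rfl fun j _ => by
        exact Finset.sum_congr rfl fun i _ => by ring
    · exact Finset.sum_congr rfl fun j _ => by ring
  simp only [palatiniField, Finset.sum_sub_distrib, t1, t3]
  ring

end MetricOn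

end Variation

/-! ### The first variation of `R² √(det G)` is an Euler-Lagrange term plus a divergence -/

section EulerLagrange

variable {n : ℕ} {U : Set (Model n)} {G : Model n → Matrix (Fin n) (Fin n) ℝ}

/-- The Euler-Lagrange tensor of `∫ R²`, evaluated at the vector dual to `ℓ`. -/
def eulerLagrange (G : Model n → Matrix (Fin n) (Fin n) ℝ) (ℓ : Fin n → ℝ) (y : Model n) : ℝ :=
  2 * (∑ i, ∑ j, hessianCoord G (scalarCoord G) i j y * covecUp G ℓ i y * covecUp G ℓ j y)
    - 2 * laplaceCoord G (scalarCoord G) y * covecSq G ℓ y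
    - 2 * scalarCoord G y * (∑ i, ∑ j, ricciCoord G i j y * covecUp G ℓ i y * covecUp G ℓ j y)
    + (1 / 2) * scalarCoord G y ^ 2 * covecSq G ℓ y

/-- The vector field whose divergence appears in the first variation of `∫ R²`. -/
def variationField (G : Model n → Matrix (Fin n) (Fin n) ℝ) (u : Model n → ℝ) (ℓ : Fin n → ℝ)
    (k : Fin n) (y : Model n) : ℝ :=
  2 * scalarCoord G y * palatiniField G (christoffelVar G u ℓ) k y
    - (2 * u y * (∑ i, covecUp G ℓ i y * pd i (scalarCoord G) y) * covecUp G ℓ k y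
      - 2 * u y * covecSq G ℓ y * gradUp G (scalarCoord G) k y)

namespace MetricOn

variable {u : Model n → ℝ} {ℓ : Fin n → ℝ}

theorem palatiniField_smooth (h : MetricOn U G) {A : Fin n → Fin n → Fin n → Model n → ℝ}
    (hA : ∀ k i j, ContDiffOn ℝ ∞ (A k i j) U) (k : Fin n) :
    ContDiffOn ℝ ∞ (palatiniField G A k) U :=
  ContDiffOn.sum fun i _ => ContDiffOn.sum fun j _ =>
    ((h.inv_smooth i j).mul (hA k i j)).sub ((h.inv_smooth k j).mul (hA i i j))

theorem sum_covecUp_mul_pd_smooth (h : MetricOn U G) (hU : IsOpen U) {F : Model n → ℝ}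
    (hF : ContDiffOn ℝ ∞ F U) :
    ContDiffOn ℝ ∞ (fun y => ∑ i, covecUp G ℓ i y * pd i F y) U :=
  ContDiffOn.sum fun i _ => (h.covecUp_smooth ℓ i).mul (contDiffOn_pd hU hF i)

theorem variationField_smooth (h : MetricOn U G) (hU : IsOpen U) (hu : ContDiffOn ℝ ∞ u U)
    (k : Fin n) : ContDiffOn ℝ ∞ (variationField G u ℓ k) U := by
  have hR := h.scalarCoord_smooth hU
  exact ((contDiffOn_const.mul hR).mul
    (h.palatiniField_smooth (fun k i j => h.christoffelVar_smooth hU hu k i j) k)).sub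
    ((((contDiffOn_const.mul hu).mul (h.sum_covecUp_mul_pd_smooth hU hR)).mul
      (h.covecUp_smooth ℓ k)).sub
    (((contDiffOn_const.mul hu).mul (h.covecSq_smooth ℓ)).mul (h.gradUp_smooth hU hR k)))

/-- The derivative of `∂_X F` along `X`, where `X` is dual to `ℓ`. -/
theorem sum_covecUp_mul_pd (h : MetricOn U G) (hU : IsOpen U) {F : Model n → ℝ}
    (hF : ContDiffOn ℝ ∞ F U) {y : Model n} (hy : y ∈ U) :
    ∑ k, pd k (fun z => ∑ i, covecUp G ℓ i z * pd i F z) y * covecUp G ℓ k y =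
      (∑ i, ∑ j, hessianCoord G F i j y * covecUp G ℓ i y * covecUp G ℓ j y)
      - ∑ j, gradUp G F j y * ∑ i, covecGam G ℓ i j y * covecUp G ℓ i y := by
  have hX := fun i => differentiableAt_of_contDiffOn hU (h.covecUp_smooth ℓ i) hy
  have hd := fun j => differentiableAt_of_contDiffOn hU (contDiffOn_pd hU hF j) hy
  have h1 : ∀ k, pd k (fun z => ∑ i, covecUp G ℓ i z * pd i F z) y =
      ∑ i, covecUp G ℓ i y * pd k (pd i F) y
      - ∑ l, (∑ i, christoffel G i k l y * pd i F y) * covecUp G ℓ l y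
      - ∑ l, gradUp G F l y * covecGam G ℓ k l y := by
    intro k
    rw [pd_sum fun i _ => (hX i).fun_mul (hd i)]
    simp only [fun i => pd_mul (i := k) (hX i) (hd i), h.pd_covecUp hU ℓ hy, sub_mul, neg_mul,
      Finset.sum_add_distrib, Finset.sum_sub_distrib, Finset.sum_neg_distrib]
    have e1 : ∑ i, (∑ l, christoffel G i k l y * covecUp G ℓ l y) * pd i F y =
        ∑ l, (∑ i, christoffel G i k l y * pd i F y) * covecUp G ℓ l y := by
      simp only [Finset.sum_mul]
      rw [Finset.sum_comm]
      exact Finset.sum_congr rfl fun _ _ => Finset.sum_congr rfl fun _ _ => by ring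
    have e2 : ∑ i, (∑ l, (G y)⁻¹ i l * covecGam G ℓ k l y) * pd i F y =
        ∑ l, gradUp G F l y * covecGam G ℓ k l y := by
      rw [← h.sum_inv_mul_comm hy]
      exact Finset.sum_congr rfl fun _ _ => mul_comm _ _
    rw [e1, e2]; ring
  have e3 : ∑ k, (∑ l, gradUp G F l y * covecGam G ℓ k l y) * covecUp G ℓ k y =
      ∑ j, gradUp G F j y * ∑ i, covecGam G ℓ i j y * covecUp G ℓ i y := by
    simp only [Finset.sum_mul, Finset.mul_sum]
    rw [Finset.sum_comm]
    exact Finset.sum_congr rfl fun _ _ => Finset.sum_congr rfl fun _ _ => by ring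
  simp only [h1, sub_mul, Finset.sum_sub_distrib, e3]
  congr 1
  simp only [Finset.sum_mul, ← Finset.sum_sub_distrib]
  refine Finset.sum_congr rfl fun k _ => Finset.sum_congr rfl fun i _ => ?_
  rw [hessianCoord, ← Finset.sum_mul, ← Finset.sum_mul]
  ring

/-- Two integrations by parts in one identity. The term 2⟨∇R, V⟩ still contains derivatives of u;
the corrections 2u X(R) X and 2u |X|² ∇R are chosen so that their divergences absorb them. The terms
with the covariant derivative of ℓ cancel too, and outside the linearized Ricci tensor only u times
a tensor in X remains. -/
theorem covdiv_variationField (h : MetricOn U G) (hU : IsOpen U) (hu : ContDiffOn ℝ ∞ u U)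
    {y : Model n} (hy : y ∈ U) : covdiv G (variationField G u ℓ) y =
      2 * scalarCoord G y * (∑ i, ∑ j, (G y)⁻¹ i j * ricciVar G (christoffelVar G u ℓ) i j y)
      - 2 * u y * ((∑ i, ∑ j,
          hessianCoord G (scalarCoord G) i j y * covecUp G ℓ i y * covecUp G ℓ j y)
        - laplaceCoord G (scalarCoord G) y * covecSq G ℓ y) := by
  have hRs := h.scalarCoord_smooth hU
  have hA := fun k i j => h.christoffelVar_smooth (ℓ := ℓ) hU hu k i j
  have D := fun {F : Model n → ℝ} (hF : ContDiffOn ℝ ∞ F U) =>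
    differentiableAt_of_contDiffOn hU hF hy
  have hR := D hRs
  have hV := fun k => D (h.palatiniField_smooth hA k)
  have hX := fun k => D (h.covecUp_smooth ℓ k)
  have hρ := fun k => D (h.gradUp_smooth hU hRs k)
  have has := h.sum_covecUp_mul_pd_smooth (ℓ := ℓ) hU hRs
  have hF1 := (contDiffOn_const (c := (2 : ℝ))).mul hRs
  have hF2 := ((contDiffOn_const (c := (2 : ℝ))).mul hu).mul has
  have hF3 := ((contDiffOn_const (c := (2 : ℝ))).mul hu).mul (h.covecSq_smooth ℓ)
  have hu' := D ((contDiffOn_const (c := (2 : ℝ))).mul hu)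
  have hXu : ∑ k, pd k u y * covecUp G ℓ k y = ∑ i, covecUp G ℓ i y * pd i u y :=
    Finset.sum_congr rfl fun _ _ => mul_comm _ _
  have hXR : ∑ k, pd k (scalarCoord G) y * covecUp G ℓ k y =
      ∑ i, covecUp G ℓ i y * pd i (scalarCoord G) y :=
    Finset.sum_congr rfl fun _ _ => mul_comm _ _
  have s1 : covdiv G (variationField G u ℓ) y =
      (2 * scalarCoord G y * covdiv G (palatiniField G (christoffelVar G u ℓ)) y
        + 2 * ∑ k, pd k (scalarCoord G) y * palatiniField G (christoffelVar G u ℓ) k y)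
      - ((2 * u y * (∑ i, covecUp G ℓ i y * pd i (scalarCoord G) y) * covdiv G (covecUp G ℓ) y
        + (2 * u y * (∑ k, pd k (fun z => ∑ i, covecUp G ℓ i z * pd i (scalarCoord G) z) y
            * covecUp G ℓ k y) + 2 * (∑ i, covecUp G ℓ i y * pd i (scalarCoord G) y)
              * ∑ i, covecUp G ℓ i y * pd i u y))
      - (2 * u y * covecSq G ℓ y * covdiv G (gradUp G (scalarCoord G)) y
        + (2 * u y * (∑ k, pd k (covecSq G ℓ) y * gradUp G (scalarCoord G) k y)
          + 2 * covecSq G ℓ y * ∑ k, pd k u y * gradUp G (scalarCoord G) k y))) := by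
    have e1 := covdiv_mul (G := G) (D hF1) hV
    have e2 := covdiv_mul (G := G) (D hF2) hX
    have e3 := covdiv_mul (G := G) (D hF3) hρ
    have e4 := covdiv_sub (G := G) (fun k => (D hF2).fun_mul (hX k))
      (fun k => (D hF3).fun_mul (hρ k))
    have e5 := covdiv_sub (G := G) (fun k => (D hF1).fun_mul (hV k))
      (fun k => ((D hF2).fun_mul (hX k)).fun_sub ((D hF3).fun_mul (hρ k)))
    have p1 : ∀ k, pd k (fun z => 2 * scalarCoord G z) y = 2 * pd k (scalarCoord G) y :=
      fun k => pd_const_mul _ hR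
    have p2 : ∀ k, pd k (fun z => 2 * u z * ∑ i, covecUp G ℓ i z * pd i (scalarCoord G) z) y =
        2 * u y * pd k (fun z => ∑ i, covecUp G ℓ i z * pd i (scalarCoord G) z) y
        + 2 * pd k u y * ∑ i, covecUp G ℓ i y * pd i (scalarCoord G) y := fun k => by
      rw [pd_mul hu' (D has), pd_const_mul _ (D hu)]
    have p3 : ∀ k, pd k (fun z => 2 * u z * covecSq G ℓ z) y =
        2 * u y * pd k (covecSq G ℓ) y + 2 * pd k u y * covecSq G ℓ y := fun k => by
      rw [pd_mul hu' (D (h.covecSq_smooth ℓ)), pd_const_mul _ (D hu)]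
    refine e5.trans ?_
    rw [e4, e1, e2, e3]
    simp only [p1, p2, p3]
    congr 2
    · rw [Finset.mul_sum]
      exact Finset.sum_congr rfl fun _ _ => by ring
    · rw [← hXu]
      have : ∀ (p q X : Fin n → ℝ) (α β : ℝ), ∑ k, (α * p k + 2 * q k * β) * X k =
          α * ∑ k, p k * X k + 2 * β * ∑ k, q k * X k := by
        intro p q X α β
        simp only [Finset.mul_sum, ← Finset.sum_add_distrib]
        exact Finset.sum_congr rfl fun _ _ => by ring
      congr 1
      exact this _ _ _ _ _
    · simp only [Finset.mul_sum, ← Finset.sum_add_distrib]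
      congr 1
      exact Finset.sum_congr rfl fun _ _ => by ring
  have hm : ∑ k, pd k (scalarCoord G) y *
      ∑ j, (G y)⁻¹ k j * ∑ i, covecGam G ℓ i j y * covecUp G ℓ i y =
      ∑ j, gradUp G (scalarCoord G) j y * ∑ i, covecGam G ℓ i j y * covecUp G ℓ i y := by
    rw [h.sum_inv_mul_comm hy]; rfl
  have hc : ∑ k, pd k (scalarCoord G) y * gradUp G u k y =
      ∑ k, pd k u y * gradUp G (scalarCoord G) k y := by
    simp only [gradUp]
    rw [h.sum_inv_mul_comm hy]
    exact Finset.sum_congr rfl fun _ _ => mul_comm _ _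
  have s2 : ∑ k, pd k (scalarCoord G) y * palatiniField G (christoffelVar G u ℓ) k y =
      (-(u y * (∑ i, ∑ j, (G y)⁻¹ i j * covecGam G ℓ i j y))
        + (∑ i, covecUp G ℓ i y * pd i u y)) * (∑ i, covecUp G ℓ i y * pd i (scalarCoord G) y)
      - covecSq G ℓ y * (∑ k, pd k u y * gradUp G (scalarCoord G) k y)
      + u y * ∑ j, gradUp G (scalarCoord G) j y *
          ∑ i, covecGam G ℓ i j y * covecUp G ℓ i y := by
    have : ∀ (r X g m : Fin n → ℝ) (α b s u : ℝ),
        ∑ k, r k * (-α * X k + b * X k - s * g k + u * m k) =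
        (-α + b) * (∑ k, r k * X k) - s * (∑ k, r k * g k) + u * ∑ k, r k * m k := by
      intro r X g m α b s u
      simp only [Finset.mul_sum, ← Finset.sum_sub_distrib, ← Finset.sum_add_distrib]
      exact Finset.sum_congr rfl fun _ _ => by ring
    rw [← hm, ← hc, ← hXR]
    simp only [h.palatiniField_christoffelVar hy]
    exact this _ _ _ _ _ _ _ _
  have s3 : ∑ k, pd k (covecSq G ℓ) y * gradUp G (scalarCoord G) k y =
      -2 * ∑ j, gradUp G (scalarCoord G) j y *
          ∑ i, covecGam G ℓ i j y * covecUp G ℓ i y := by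
    rw [Finset.mul_sum]
    refine Finset.sum_congr rfl fun k _ => ?_
    rw [h.pd_covecSq hU ℓ hy]
    simp only [fun m => h.covecGam_comm hU ℓ k m hy]
    ring
  rw [s1, h.covdiv_palatiniField hU hA hy, s2, h.covdiv_covecUp hU ℓ hy,
    h.sum_covecUp_mul_pd hU hRs hy, h.covdiv_gradUp hU hRs hy, s3]
  ring

/-- The first variation of `R² √(det G)` in the direction `u ℓ ⊗ ℓ`. -/
theorem hasDerivAt_scalarCoord_sq_mul_density (h : MetricOn U G) (hU : IsOpen U)
    (hu : ContDiffOn ℝ ∞ u U) (hpos : ∀ y ∈ U, 0 < (G y).det) {y : Model n} (hy : y ∈ U) :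
    HasDerivAt (fun s => scalarCoord (varMetric G u ℓ s) y ^ 2 * density (varMetric G u ℓ s) y)
      (u y * (density G y * eulerLagrange G ℓ y)
        + ∑ k, pd k (fun z => density G z * variationField G u ℓ k z) y) 0 := by
  have h1 := ((h.hasDerivAt_varMetric_scalarCoord (ℓ := ℓ) hU hu hpos hy).fun_pow 2).fun_mul
    (hasDerivAt_varMetric_density (ℓ := ℓ) (u := u) hpos hy)
  refine h1.congr_deriv ?_
  rw [h.sum_pd_density_mul hU hpos hy (Y := variationField G u ℓ) fun k =>
    differentiableAt_of_contDiffOn hU (h.variationField_smooth hU hu k) hy,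
    h.covdiv_variationField hU hu hy, varMetric_zero, scalarVar, eulerLagrange]
  norm_num
  ring

end MetricOn

end EulerLagrange

/-! ### The Euler-Lagrange equation of `∫ R²` in coordinates -/

section Integration

open MeasureTheory

variable {n : ℕ} {U : Set (Model n)} {G : Model n → Matrix (Fin n) (Fin n) ℝ}

theorem SmoothFamily.hasDerivAt_integral {W : Set (ℝ × Model n)} {F : ℝ → Model n → ℝ}
    (hW : IsOpen W) (hF : SmoothFamily W F) {K : Set (Model n)} (hK : IsCompact K)
    (hKW : ∀ y ∈ K, ((0 : ℝ), y) ∈ W) {F' : Model n → ℝ}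
    (hF' : ∀ y ∈ K, HasDerivAt (fun s => F s y) (F' y) 0) :
    HasDerivAt (fun t => ∫ y in K, F t y) (∫ y in K, F' y) 0 := by
  -- By compactness W contains a closed time interval around 0 times K, on which the time derivative
  -- is bounded; the bound is the dominating function.
  obtain ⟨I, V, hI, -, h0I, hKV, hIV⟩ := generalized_tube_lemma (isCompact_singleton (x := (0 : ℝ)))
    hK hW (by rintro ⟨t, y⟩ ⟨rfl, hy⟩; exact hKW y hy)
  obtain ⟨ε, hε, hεI⟩ := Metric.isOpen_iff.1 hI 0 (h0I rfl)
  set s : Set ℝ := Metric.closedBall 0 (ε / 2) with hs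
  have hsW : ∀ t ∈ s, ∀ y ∈ K, (t, y) ∈ W := fun t ht y hy =>
    hIV ⟨hεI (Metric.closedBall_subset_ball (by linarith) ht), hKV hy⟩
  have hs0 : s ∈ nhds (0 : ℝ) := Metric.closedBall_mem_nhds _ (by linarith)
  have h0 : (0 : ℝ) ∈ s := mem_of_mem_nhds hs0
  have hcF : ∀ t ∈ s, ContinuousOn (F t) K := fun t ht =>
    hF.continuousOn.comp (f := fun y => (t, y)) (by fun_prop) fun y hy => hsW t ht y hy
  have hcD := (hF.time hW).continuousOn
  have hcD0 : ContinuousOn (fun y => deriv (fun s => F s y) 0) K :=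
    hcD.comp (f := fun y => ((0 : ℝ), y)) (by fun_prop) fun y hy => hsW 0 h0 y hy
  obtain ⟨C, hC⟩ := ((isCompact_closedBall (0 : ℝ) (ε / 2)).prod hK).exists_bound_of_continuousOn
    (hcD.mono fun q hq => hsW q.1 hq.1 q.2 hq.2)
  have hm := hK.measurableSet
  have hfin : IsFiniteMeasure (volume.restrict K) := ⟨by simpa using hK.measure_lt_top⟩
  have key := (hasDerivAt_integral_of_dominated_loc_of_deriv_le (μ := volume.restrict K)
    (F := F) (F' := fun t y => deriv (fun s => F s y) t) (bound := fun _ => C) hs0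
    (Filter.eventually_of_mem hs0 fun t ht => (hcF t ht).aestronglyMeasurable hm)
    ((hcF 0 h0).integrableOn_compact hK)
    (hcD0.aestronglyMeasurable hm)
    ((ae_restrict_iff' hm).2 (Filter.Eventually.of_forall fun y hy t ht => hC (t, y) ⟨ht, hy⟩))
    (integrable_const C)
    ((ae_restrict_iff' hm).2 (Filter.Eventually.of_forall fun y hy t ht =>
      (hF.hasDerivAt_time hW (hsW t ht y hy)).differentiableAt.hasDerivAt))).2
  refine key.congr_deriv (setIntegral_congr_fun hm fun y hy => (hF' y hy).deriv)

/-- The integral of a partial derivative of a function with compact support vanishes. -/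
theorem integral_pd_eq_zero {Z : Model n → ℝ} (hZ : ContDiff ℝ ∞ Z) (hc : HasCompactSupport Z)
    (i : Fin n) : ∫ y, pd i Z y = 0 := by
  have hc' : HasCompactSupport fun y => fderiv ℝ Z y (EuclideanSpace.single i 1) :=
    (hc.fderiv (𝕜 := ℝ)).comp_left (g := fun L : Model n →L[ℝ] ℝ => L (EuclideanSpace.single i 1))
      (by simp)
  have hi : Integrable (fun y => fderiv ℝ Z y (EuclideanSpace.single i 1)) :=
    Continuous.integrable_of_hasCompactSupport
      ((hZ.continuous_fderiv (by simp)).clm_apply continuous_const) hc'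
  -- Integration by parts against the constant function 1.
  have := integral_mul_fderiv_eq_neg_fderiv_mul_of_integrable (μ := volume) (f := fun _ => (1 : ℝ))
    (g := Z) (v := EuclideanSpace.single i (1 : ℝ)) (by simp) (by simpa using hi)
    (by simpa using hZ.continuous.integrable_of_hasCompactSupport hc)
    (fun _ _ => differentiableAt_const _) (fun _ _ => hZ.differentiable (by simp) _)
  simpa [pd] using this

/-- A function that is smooth on an open set and vanishes off a closed subset is smooth. -/
theorem contDiff_of_eq_zero_off {V E : Type*} [NormedAddCommGroup V] [NormedSpace ℝ V]
    [NormedAddCommGroup E] [NormedSpace ℝ E] {U K : Set V}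
    (hU : IsOpen U) (hK : IsClosed K) (hKU : K ⊆ U) {Z : V → E} (hZ : ContDiffOn ℝ ∞ Z U)
    (h0 : ∀ y, y ∉ K → Z y = 0) : ContDiff ℝ ∞ Z := by
  rw [contDiff_iff_contDiffAt]
  intro y
  by_cases hy : y ∈ K
  · exact hZ.contDiffAt (hU.mem_nhds (hKU hy))
  · exact contDiffAt_const.congr_of_eventuallyEq
      (Filter.eventually_of_mem (hK.isOpen_compl.mem_nhds hy) fun z hz => h0 z hz)

theorem pd_eq_zero_of_notMem_tsupport {u : Model n → ℝ} {y : Model n} (hy : y ∉ tsupport u)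
    (i : Fin n) : pd i u y = 0 := by
  rw [pd_congr (notMem_tsupport_iff_eventuallyEq.1 hy)]
  exact pd_const i 0 y

namespace MetricOn

variable {u : Model n → ℝ} {ℓ : Fin n → ℝ}

theorem variationField_eq_zero {y : Model n} (hy : y ∉ tsupport u) (k : Fin n) :
    variationField G u ℓ k y = 0 := by
  have hu : u y = 0 := image_eq_zero_of_notMem_tsupport hy
  simp [variationField, palatiniField, christoffelVar, hu, pd_eq_zero_of_notMem_tsupport hy, gradUp]

theorem hessianCoord_smooth (h : MetricOn U G) (hU : IsOpen U) {F : Model n → ℝ}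
    (hF : ContDiffOn ℝ ∞ F U) (i j : Fin n) : ContDiffOn ℝ ∞ (hessianCoord G F i j) U :=
  (contDiffOn_pd hU (contDiffOn_pd hU hF j) i).sub (ContDiffOn.sum fun k _ =>
    (h.christoffel_smooth hU k i j).mul (contDiffOn_pd hU hF k))

theorem eulerLagrange_smooth (h : MetricOn U G) (hU : IsOpen U) (ℓ : Fin n → ℝ) :
    ContDiffOn ℝ ∞ (eulerLagrange G ℓ) U := by
  have hR := h.scalarCoord_smooth hU
  have hX := h.covecUp_smooth ℓ
  have hS := h.covecSq_smooth ℓ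
  have hH := h.hessianCoord_smooth hU hR
  have hL : ContDiffOn ℝ ∞ (laplaceCoord G (scalarCoord G)) U :=
    ContDiffOn.sum fun i _ => ContDiffOn.sum fun j _ => (h.inv_smooth i j).mul (hH i j)
  have hD {B : Fin n → Fin n → Model n → ℝ} (hB : ∀ i j, ContDiffOn ℝ ∞ (B i j) U) :
      ContDiffOn ℝ ∞ (fun y => ∑ i, ∑ j, B i j y * covecUp G ℓ i y * covecUp G ℓ j y) U :=
    ContDiffOn.sum fun i _ => ContDiffOn.sum fun j _ => ((hB i j).mul (hX i)).mul (hX j)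
  exact (((contDiffOn_const.mul (hD hH)).sub ((contDiffOn_const.mul hL).mul hS)).sub
    ((contDiffOn_const.mul hR).mul (hD (h.ricciCoord_smooth hU)))).add
    ((contDiffOn_const.mul (hR.pow 2)).mul hS)

/-- Differentiate under the integral and compare with the critical value 0. The divergence part has
compact support in U, extends smoothly by zero, and integrates to zero. -/
theorem integral_mul_eulerLagrange (h : MetricOn U G) (hU : IsOpen U)
    (hpos : ∀ y ∈ U, 0 < (G y).det) (hu : ContDiff ℝ ∞ u) (hc : HasCompactSupport u)
    (hs : tsupport u ⊆ U)
    (hcrit : HasDerivAt (fun t => ∫ y in tsupport u,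
      scalarCoord (varMetric G u ℓ t) y ^ 2 * density (varMetric G u ℓ t) y) 0 0) :
    ∫ y, u y * (density G y * eulerLagrange G ℓ y) = 0 := by
  have huU := hu.contDiffOn (s := U)
  have hW := h.isOpen_varDomain (ℓ := ℓ) hU huU
  have hG := h.varMetric_smooth' (ℓ := ℓ) huU
  have hR : SmoothFamily (varDomain U G u ℓ) fun t => scalarCoord (varMetric G u ℓ t) :=
    SmoothFamily.scalarCoord hW hG fun q hq => hq.2.ne'
  have hd : SmoothFamily (varDomain U G u ℓ) fun t => density (varMetric G u ℓ t) :=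
    ContDiffOn.sqrt (contDiffOn_det hG) fun q hq => hq.2.ne'
  have hF : SmoothFamily (varDomain U G u ℓ) fun t y =>
      scalarCoord (varMetric G u ℓ t) y ^ 2 * density (varMetric G u ℓ t) y := by
    simp only [pow_two]; exact (hR.mul hR).mul hd
  have h1 := hF.hasDerivAt_integral hW hc (fun y hy => zero_mem_varDomain hpos (hs hy))
    fun y hy => h.hasDerivAt_scalarCoord_sq_mul_density hU huU hpos (hs hy)
  have h2 := h1.unique hcrit
  have hZ0 : ∀ k, ∀ y ∉ tsupport u, density G y * variationField G u ℓ k y = 0 := fun k y hy => by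
    rw [variationField_eq_zero hy, mul_zero]
  have hZ : ∀ k, ContDiff ℝ ∞ fun z => density G z * variationField G u ℓ k z := fun k =>
    contDiff_of_eq_zero_off hU (isClosed_tsupport u) hs
      ((h.density_smooth hpos).mul (h.variationField_smooth hU huU k)) (hZ0 k)
  have hZc : ∀ k, HasCompactSupport fun z => density G z * variationField G u ℓ k z := fun k =>
    HasCompactSupport.intro hc (hZ0 k)
  have hZi : ∀ k, Integrable (pd k fun z => density G z * variationField G u ℓ k z) := fun k =>
    Continuous.integrable_of_hasCompactSupport
      (((hZ k).continuous_fderiv (by simp)).clm_apply continuous_const)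
      (HasCompactSupport.intro (hZc k) fun y hy => pd_eq_zero_of_notMem_tsupport hy k)
  have hEi : Integrable fun y => u y * (density G y * eulerLagrange G ℓ y) := by
    have h0 : ∀ y ∉ tsupport u, u y * (density G y * eulerLagrange G ℓ y) = 0 := fun y hy => by
      rw [image_eq_zero_of_notMem_tsupport hy, zero_mul]
    exact (contDiff_of_eq_zero_off hU (isClosed_tsupport u) hs
      (huU.mul ((h.density_smooth hpos).mul (h.eulerLagrange_smooth hU ℓ))) h0).continuous.integrable_of_hasCompactSupport
        (HasCompactSupport.intro hc h0)
  rw [setIntegral_eq_integral_of_forall_compl_eq_zero,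
    integral_add hEi (integrable_finsetSum _ fun k _ => hZi k),
    integral_finsetSum _ fun k _ => hZi k,
    Finset.sum_eq_zero fun k _ => integral_pd_eq_zero (hZ k) (hZc k) k, add_zero] at h2
  · exact h2
  · intro y hy
    rw [image_eq_zero_of_notMem_tsupport hy, zero_mul, zero_add]
    exact Finset.sum_eq_zero fun k _ => pd_eq_zero_of_notMem_tsupport
      (fun hy' => hy (closure_minimal (fun z hz => by_contra fun hz' => (hz : _ ≠ _) (hZ0 k z hz'))
        (isClosed_tsupport u) hy')) k

/-- The fundamental lemma of the calculus of variations gives vanishing almost everywhere,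
continuity gives it everywhere, and the density is positive. -/
theorem eulerLagrange_eq_zero (h : MetricOn U G) (hU : IsOpen U)
    (hpos : ∀ y ∈ U, 0 < (G y).det) (ℓ : Fin n → ℝ)
    (hcrit : ∀ u : Model n → ℝ, ContDiff ℝ ∞ u → HasCompactSupport u → tsupport u ⊆ U →
      HasDerivAt (fun t => ∫ y in tsupport u,
        scalarCoord (varMetric G u ℓ t) y ^ 2 * density (varMetric G u ℓ t) y) 0 0)
    {y : Model n} (hy : y ∈ U) : eulerLagrange G ℓ y = 0 := by
  have hc : ContinuousOn (fun y => density G y * eulerLagrange G ℓ y) U :=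
    (h.density_smooth hpos).continuousOn.mul (h.eulerLagrange_smooth hU ℓ).continuousOn
  have h1 := hU.ae_eq_zero_of_integral_contDiff_smul_eq_zero (μ := volume)
    (hc.locallyIntegrableOn hU.measurableSet) fun u hu huc hus =>
      h.integral_mul_eulerLagrange hU hpos hu huc hus (hcrit u hu huc hus)
  have h2 := Measure.eqOn_open_of_ae_eq (g := fun _ => (0 : ℝ))
    ((ae_restrict_iff' hU.measurableSet).2 h1) hU hc continuousOn_const hy
  exact (mul_eq_zero.1 h2).resolve_left (Real.sqrt_pos.2 (hpos y hy)).ne'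

/-- The one term not visibly symmetric is ∂_i Γ^k_kj, and Γ^k_kj = ∂_j log √det G makes it a second
derivative. -/
theorem ricciCoord_comm (h : MetricOn U G) (hU : IsOpen U) (hpos : ∀ y ∈ U, 0 < (G y).det)
    {y : Model n} (hy : y ∈ U) (i j : Fin n) : ricciCoord G i j y = ricciCoord G j i y := by
  have hlog : ContDiffOn ℝ ∞ (fun z => Real.log (density G z)) U :=
    (h.density_smooth hpos).log fun z hz => (Real.sqrt_pos.2 (hpos z hz)).ne'
  have htr : ∀ a, ∀ z ∈ U, ∑ k, christoffel G k k a z = pd a (fun z => Real.log (density G z)) z := by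
    intro a z hz
    have hz0 : density G z ≠ 0 := (Real.sqrt_pos.2 (hpos z hz)).ne'
    rw [pd_comp (Real.hasDerivAt_log hz0)
      (differentiableAt_of_contDiffOn hU (h.density_smooth hpos) hz), h.pd_density hU hpos hz, ← mul_assoc, inv_mul_cancel₀ hz0, one_mul]
  have h1 : ∀ a b, ∑ k, pd a (christoffel G k k b) y =
      pd a (pd b fun z => Real.log (density G z)) y := fun a b => by
    rw [← pd_sum fun k _ => differentiableAt_of_contDiffOn hU (h.christoffel_smooth hU k k b) hy]
    exact pd_congr (Filter.eventually_of_mem (hU.mem_nhds hy) (htr b))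
  have h2 : ∀ k, pd k (christoffel G k i j) y = pd k (christoffel G k j i) y := fun k =>
    pd_congr (Filter.eventually_of_mem (hU.mem_nhds hy) fun z hz => h.christoffel_comm hU hz k i j)
  have h3 : ∀ k l, christoffel G k i l y * christoffel G l k j y =
      christoffel G l j k y * christoffel G k l i y := fun k l => by
    rw [h.christoffel_comm hU hy k i l, h.christoffel_comm hU hy l k j, mul_comm]
  simp only [ricciCoord, Finset.sum_sub_distrib, h1, h2, h3, h.christoffel_comm hU hy _ i j]
  rw [pd_comm hU hlog i j hy,
    Finset.sum_comm (f := fun k l => christoffel G l j k y * christoffel G k l i y)]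

theorem eq_zero_of_quadratic_eq_zero {Q : Fin n → Fin n → ℝ} (hs : ∀ i j, Q i j = Q j i)
    (h : ∀ x : Fin n → ℝ, ∑ i, ∑ j, Q i j * x i * x j = 0) (i j : Fin n) : Q i j = 0 := by
  have h1 : ∀ i, Q i i = 0 := fun i => by simpa [Pi.single_apply] using h (Pi.single i 1)
  have h2 := h (Pi.single i 1 + Pi.single j 1)
  simp [Pi.single_apply, mul_add, Finset.sum_add_distrib, h1] at h2
  linarith [hs i j]

/-- The Euler-Lagrange equation of `∫ R²`. -/
theorem scalarCoord_mul_ricciCoord (h : MetricOn U G) (hU : IsOpen U)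
    (hpos : ∀ y ∈ U, 0 < (G y).det) {y : Model n} (hy : y ∈ U)
    (hE : ∀ ℓ, eulerLagrange G ℓ y = 0) (i j : Fin n) :
    scalarCoord G y * ricciCoord G i j y = hessianCoord G (scalarCoord G) i j y
      + (scalarCoord G y ^ 2 / 4 - laplaceCoord G (scalarCoord G) y) * G y i j := by
  have hR := h.scalarCoord_smooth hU
  -- With ℓ = G x the dual vector is x itself, so x is arbitrary and the quadratic form polarizes.
  have hx : ∀ (x : Fin n → ℝ) (k : Fin n), covecUp G (fun i => ∑ j, G y i j * x j) k y = x k := by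
    intro x k
    have := congrFun (congrArg (Matrix.mulVec · x) (h.inv_mul_cancel hy)) k
    rw [← Matrix.mulVec_mulVec, Matrix.one_mulVec] at this
    exact this
  have hq : ∀ (x : Fin n → ℝ), covecSq G (fun i => ∑ j, G y i j * x j) y =
      ∑ i, ∑ j, G y i j * x i * x j := by
    intro x
    simp only [covecSq, hx, Finset.sum_mul]
    exact Finset.sum_congr rfl fun i _ => Finset.sum_congr rfl fun j _ => by ring
  have := eq_zero_of_quadratic_eq_zero (Q := fun i j => 2 * hessianCoord G (scalarCoord G) i j y
      - 2 * laplaceCoord G (scalarCoord G) y * G y i j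
      - 2 * scalarCoord G y * ricciCoord G i j y + (1 / 2) * scalarCoord G y ^ 2 * G y i j)
    (fun i j => by
      have : hessianCoord G (scalarCoord G) i j y = hessianCoord G (scalarCoord G) j i y := by
        simp only [hessianCoord, pd_comm hU hR i j hy, h.christoffel_comm hU hy _ i j]
      simp only [h.ricciCoord_comm hU hpos hy i j, h.apply_comm hy i j, this])
    (fun x => by
      rw [← hE fun i => ∑ j, G y i j * x j, eulerLagrange, hq]
      simp only [hx, Finset.mul_sum, ← Finset.sum_add_distrib, ← Finset.sum_sub_distrib]
      refine Finset.sum_congr rfl fun i _ => Finset.sum_congr rfl fun j _ => ?_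
      ring) i j
  linarith

end MetricOn

end Integration

/-! ### Bilinear fields on a manifold, in the charts -/

section Charts

variable {n : ℕ} {M : Type*} [TopologicalSpace M] [ChartedSpace (Model n) M]

local notation "φ" => extChartAt 𝓘(ℝ, Model n)

/-- The derivative of the inverse of the chart at `p`. -/
def dSymm (p : M) (y : Model n) : Model n →L[ℝ] Tan n ((φ p).symm y) :=
  mfderiv 𝓘(ℝ, Model n) 𝓘(ℝ, Model n) (φ p).symm y

/-- The derivative of the chart at `p`. -/
def dChart (p q : M) : Tan n q →L[ℝ] Model n :=
  mfderiv 𝓘(ℝ, Model n) 𝓘(ℝ, Model n) (φ p) q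

theorem bil_gram (B : BilinField n M) (p : M) (y v w : Model n) :
    bil (gram B p y) v w = B ((φ p).symm y) (dSymm p y v) (dSymm p y w) := by
  induction v using model_induction with
  | h0 => simp only [map_zero, zero_apply]
  | hadd v₁ v₂ h₁ h₂ => simp only [map_add, add_apply, h₁, h₂]
  | hsmul c v h₁ => simp only [map_smul, smul_apply, h₁]
  | hb i =>
    induction w using model_induction with
    | h0 => simp only [map_zero]
    | hadd v₁ v₂ h₁ h₂ => simp only [map_add, h₁, h₂]
    | hsmul c v h₁ => simp only [map_smul, h₁]
    | hb j => rw [bil_stdVec]; rfl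

/-- Every tangent space is definitionally ℝⁿ, so the base point can be replaced by an equal one
without casting the vectors. -/
theorem bilinField_congr (B : BilinField n M) {q q' : M} (h : q = q') (v w : Model n) :
    B q (v : Tan n q) (w : Tan n q) = B q' (v : Tan n q') (w : Tan n q') := by
  subst h; rfl

variable [IsManifold 𝓘(ℝ, Model n) ∞ M]

theorem mdifferentiableAt_symm {p : M} {y : Model n} (hy : y ∈ (φ p).target) :
    MDifferentiableAt 𝓘(ℝ, Model n) 𝓘(ℝ, Model n) (φ p).symm y :=
  ((contMDiffOn_extChartAt_symm (n := ∞) p).contMDiffAt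
    ((isOpen_extChartAt_target p).mem_nhds hy)).mdifferentiableAt (by simp)

theorem mdifferentiableAt_chart {p q : M} (hq : q ∈ (φ p).source) :
    MDifferentiableAt 𝓘(ℝ, Model n) 𝓘(ℝ, Model n) (φ p) q :=
  ((contMDiffOn_extChartAt (n := ∞) (x := p)).contMDiffAt
    ((chartAt (Model n) p).open_source.mem_nhds
      (by rwa [extChartAt_source] at hq))).mdifferentiableAt (by simp)

omit [IsManifold 𝓘(ℝ, Model n) ∞ M] in
theorem isOpen_source (p : M) : IsOpen (φ p).source := isOpen_extChartAt_source p

/-- The transition map from the chart at `p` to the chart at `p'`. -/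
def transition (p p' : M) (y : Model n) : Model n := φ p' ((φ p).symm y)

/-- The domain of the transition map from the chart at `p` to the chart at `p'`. -/
def overlap (p p' : M) : Set (Model n) := (φ p).target ∩ (φ p).symm ⁻¹' (φ p').source

omit [IsManifold 𝓘(ℝ, Model n) ∞ M] in
theorem isOpen_overlap (p p' : M) : IsOpen (overlap (n := n) p p') :=
  (continuousOn_extChartAt_symm p).isOpen_inter_preimage (isOpen_extChartAt_target p)
    (isOpen_source p')

theorem transition_smooth (p p' : M) :
    ContDiffOn ℝ ∞ (transition (n := n) p p') (overlap p p') := by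
  rw [← contMDiffOn_iff_contDiffOn]
  exact (contMDiffOn_extChartAt (n := ∞) (x := p')).comp
    ((contMDiffOn_extChartAt_symm (n := ∞) p).mono Set.inter_subset_left)
    fun y hy => by simpa using hy.2

theorem dChart_dSymm {p p' : M} {y : Model n} (hy : y ∈ overlap p p') (v : Model n) :
    dChart p' ((φ p).symm y) (dSymm p y v) = fderiv ℝ (transition p p') y v := by
  have := mfderiv_comp y (mdifferentiableAt_chart hy.2) (mdifferentiableAt_symm hy.1)
  rw [← mfderiv_eq_fderiv]
  exact (congrArg (fun L => L v) this).symm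

theorem dSymm_transition {p p' : M} {y : Model n} (hy : y ∈ overlap p p') (v : Model n) :
    (dSymm p' (transition p p' y) (fderiv ℝ (transition p p') y v) : Model n) = dSymm p y v := by
  have hy' : transition p p' y ∈ (φ p').target := (φ p').map_source hy.2
  have h1 := mfderiv_comp y (mdifferentiableAt_symm hy')
    ((transition_smooth p p').contDiffAt ((isOpen_overlap p p').mem_nhds hy)
      |>.contMDiffAt.mdifferentiableAt (by simp))
  have h2 : (φ p').symm ∘ transition p p' =ᶠ[nhds y] (φ p).symm :=
    Filter.eventually_of_mem ((isOpen_overlap p p').mem_nhds hy) fun z hz =>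
      (φ p').left_inv hz.2
  rw [h2.mfderiv_eq] at h1
  rw [← mfderiv_eq_fderiv]
  exact (congrArg (fun L => L v) h1).symm

/-- The transformation rule of the components of a bilinear field. -/
theorem bil_gram_transition (B : BilinField n M) {p p' : M} {y : Model n}
    (hy : y ∈ overlap p p') (v w : Model n) :
    bil (gram B p y) v w = bil (gram B p' (transition p p' y))
      (fderiv ℝ (transition p p') y v) (fderiv ℝ (transition p p') y w) := by
  rw [bil_gram, bil_gram]
  refine (bilinField_congr B ((φ p').left_inv hy.2).symm _ _).trans ?_
  rw [← dSymm_transition hy v, ← dSymm_transition hy w]; rfl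

/-- The trivialization of the bundle of bilinear forms at p reads B off as its Gram matrix in the
chart at p; hence smoothness of sections is smoothness of components. -/
theorem trivialization_apply (B : BilinField n M) {p q : M} (hq : q ∈ (φ p).source) :
    (trivializationAt (Model n →L[ℝ] Model n →L[ℝ] ℝ)
      (fun p : M => Tan n p →L[ℝ] Tan n p →L[ℝ] ℝ) p ⟨q, B q⟩).2 = bil (gram B p (φ p q)) := by
  have hq' : q ∈ (chartAt (Model n) p).source := by rwa [extChartAt_source] at hq
  ext v w
  rw [bil_gram, hom_trivializationAt_apply]
  have hS : ∀ v, ((trivializationAt (Model n) (TangentSpace 𝓘(ℝ, Model n)) p).symmL ℝ q v : Model n) = 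
      (dSymm p (φ p q) v : Model n) := by
    intro v
    rw [TangentBundle.symmL_trivializationAt hq']
    simp only [modelWithCornersSelf_coe, Set.range_id, mfderivWithin_univ]
    rfl
  rw [ContinuousLinearMap.inCoordinates, ContinuousLinearMap.comp_apply,
    Bundle.Trivialization.continuousLinearMapAt_apply, Bundle.Trivialization.linearMapAt_apply,
    if_pos (by simpa using hq'), hom_trivializationAt_apply, ContinuousLinearMap.inCoordinates]
  simp only [ContinuousLinearMap.comp_apply]
  have h1 := bilinField_congr B ((φ p).left_inv hq).symm
    ((trivializationAt (Model n) (TangentSpace 𝓘(ℝ, Model n)) p).symmL ℝ q v : Model n)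
    ((trivializationAt (Model n) (TangentSpace 𝓘(ℝ, Model n)) p).symmL ℝ q w : Model n)
  rw [hS v, hS w] at h1
  refine Eq.trans ?_ h1
  rw [← hS v, ← hS w]
  exact congrArg (fun L : ℝ →L[ℝ] ℝ => L _) (Bundle.Trivial.continuousLinearMapAt_trivialization ℝ M ℝ q)

theorem smoothOn_iff (B : BilinField n M) (p : M) :
    ContMDiffOn 𝓘(ℝ, Model n)
      (𝓘(ℝ, Model n).prod 𝓘(ℝ, Model n →L[ℝ] Model n →L[ℝ] ℝ)) ∞
      (fun p : M => Bundle.TotalSpace.mk' (Model n →L[ℝ] Model n →L[ℝ] ℝ)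
      (E := fun p : M => Tan n p →L[ℝ] Tan n p →L[ℝ] ℝ) p (B p)) (φ p).source ↔
    ∀ i j, ContDiffOn ℝ ∞ (fun y => gram B p y i j) (φ p).target := by
  rw [Bundle.Trivialization.contMDiffOn_section_iff (trivializationAt (Model n →L[ℝ] Model n →L[ℝ] ℝ)
      (fun p : M => Tan n p →L[ℝ] Tan n p →L[ℝ] ℝ) p) (isOpen_source p) (by simp)]
  constructor
  · intro h i j
    have h1 := (h.congr fun q hq => (trivialization_apply B hq).symm).comp
      (contMDiffOn_extChartAt_symm (n := ∞) p) fun y hy => (φ p).map_target hy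
    have h2 := (contMDiffOn_iff_contDiffOn.1 h1).congr
      (f₁ := fun y => bil (gram B p y)) fun y hy => by
        simp only [Function.comp, (φ p).right_inv hy]
    refine ((h2.clm_apply contDiffOn_const).clm_apply contDiffOn_const).congr
      (f₁ := fun y => gram B p y i j) fun y _ => (bil_stdVec _ i j).symm
  · intro h
    have h1 : ContDiffOn ℝ ∞ (fun y => bil (gram B p y)) (φ p).target :=
      ContDiffOn.sum fun i _ => ContDiffOn.sum fun j _ => (h i j).smul contDiffOn_const
    have h2 := (contMDiffOn_iff_contDiffOn.2 h1).comp
      (contMDiffOn_extChartAt (n := ∞) (x := p)) fun q hq =>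
        (φ p).map_source (by rwa [extChartAt_source])
    rw [← extChartAt_source 𝓘(ℝ, Model n) p] at h2
    exact h2.congr fun q hq => trivialization_apply B hq

end Charts

/-! ### Scalar curvature and volume in an arbitrary chart -/

section MetricField

open MeasureTheory

variable {n : ℕ} {M : Type*} [TopologicalSpace M] [ChartedSpace (Model n) M]

local notation "φ" => extChartAt 𝓘(ℝ, Model n)

theorem mem_overlap_self {p q : M} (hq : q ∈ (φ p).source) : φ p q ∈ overlap p q :=
  ⟨(φ p).map_source hq, by
    rw [Set.mem_preimage, (φ p).left_inv hq]; exact mem_extChartAt_source q⟩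

theorem transition_mem_overlap {p p' : M} {y : Model n} (hy : y ∈ overlap p p') :
    transition p p' y ∈ overlap p' p :=
  ⟨(φ p').map_source hy.2, by
    rw [Set.mem_preimage, transition, (φ p').left_inv hy.2]; exact (φ p).map_target hy.1⟩

theorem transition_transition {p p' : M} {y : Model n} (hy : y ∈ overlap p p') :
    transition p' p (transition p p' y) = y := by
  rw [transition, transition, (φ p').left_inv hy.2, (φ p).right_inv hy.1]

variable [IsManifold 𝓘(ℝ, Model n) ∞ M]

theorem hasFDerivAt_transition {p p' : M} {y : Model n} (hy : y ∈ overlap p p') :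
    HasFDerivAt (transition p p') (fderiv ℝ (transition p p') y) y :=
  (differentiableAt_of_contDiffOn (isOpen_overlap p p') (transition_smooth p p') hy).hasFDerivAt

theorem det_fderiv_transition_ne_zero {p p' : M} {y : Model n} (hy : y ∈ overlap p p') :
    (fderiv ℝ (transition p p') y).det ≠ 0 := by
  have h1 := (hasFDerivAt_transition (transition_mem_overlap hy)).comp y (hasFDerivAt_transition hy)
  have h2 : transition p' p ∘ transition p p' =ᶠ[nhds y] id :=
    Filter.eventually_of_mem ((isOpen_overlap p p').mem_nhds hy) fun z hz =>
      transition_transition hz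
  have h3 := h1.unique ((hasFDerivAt_id y).congr_of_eventuallyEq h2)
  have h4 := congrArg ContinuousLinearMap.det h3
  have h5 : (1 : ℝ) = (fderiv ℝ (transition p' p) (transition p p' y)).det *
      (fderiv ℝ (transition p p') y).det := by
    rw [ContinuousLinearMap.det, ContinuousLinearMap.det, ← LinearMap.det_comp]
    rw [ContinuousLinearMap.det] at h4
    exact (h4.trans LinearMap.det_id).symm
  intro h0
  rw [h0, mul_zero] at h5
  exact one_ne_zero h5

theorem det_gram_transition (B : BilinField n M) {p p' : M} {y : Model n}
    (hy : y ∈ overlap p p') : (gram B p y).det =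
      (fderiv ℝ (transition p p') y).det ^ 2 * (gram B p' (transition p p' y)).det :=
  det_eq_of_bil_eq fun v w => bil_gram_transition B hy v w

/-- Smooth symmetric bilinear fields whose components have positive determinant. -/
structure MetricField (B : BilinField n M) : Prop where
  smooth : SmoothField B
  symm : ∀ p v w, B p v w = B p w v
  det_pos : ∀ p, 0 < (gram B p (φ p p)).det

namespace MetricField

variable {B : BilinField n M} (hB : MetricField B)
include hB

/-- Positivity is assumed only at the centre of each chart; elsewhere the determinant changes by the
square of a nonzero Jacobian. -/
theorem det_gram_pos (p : M) {y : Model n} (hy : y ∈ (φ p).target) :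
    0 < (gram B p y).det := by
  have h1 := mem_overlap_self ((φ p).map_target hy)
  rw [(φ p).right_inv hy] at h1
  rw [det_gram_transition B h1]
  exact mul_pos (by have := det_fderiv_transition_ne_zero h1; positivity) (hB.det_pos _)

theorem metricOn (p : M) : MetricOn (φ p).target (gram B p) where
  smooth := (smoothOn_iff B p).1 hB.smooth.contMDiffOn
  symm y _ := by ext i j; exact hB.symm _ _ _
  det_ne y hy := (hB.det_gram_pos p hy).ne'

/-- The scalar curvature can be computed in any chart. -/
theorem scalarCurv_eq {p q : M} (hq : q ∈ (φ p).source) :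
    scalarCurv B q = scalarCoord (gram B p) (φ p q) := by
  have hq' : φ q q ∈ overlap q p :=
    ⟨mem_extChartAt_target q, by
      rw [Set.mem_preimage, extChartAt_to_inv]; exact hq⟩
  have := scalarCoord_comp (isOpen_extChartAt_target p) (isOpen_overlap q p) (hB.metricOn p)
    ((hB.metricOn q).mono Set.inter_subset_left) (transition_smooth q p)
    (fun y hy => (φ p).map_source hy.2) (fun y hy => bil_gram_transition B hy) hq'
  rw [scalarCurv, this, transition, extChartAt_to_inv]

theorem continuousOn_scalarCurv (p : M) : ContinuousOn (scalarCurv B) (φ p).source :=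
  (((hB.metricOn p).scalarCoord_smooth (isOpen_extChartAt_target p)).continuousOn.comp
    (continuousOn_extChartAt p) fun _ hq => (φ p).map_source hq).congr
    fun _ hq => hB.scalarCurv_eq hq

variable [MeasurableSpace M] [BorelSpace M]

omit [IsManifold 𝓘(ℝ, Model n) ∞ M] hB in
theorem measurableSet_target_inter (p : M) {A : Set M} (hA : MeasurableSet A) :
    MeasurableSet ((φ p).target ∩ (φ p).symm ⁻¹' A) := by
  have h1 := (continuousOn_extChartAt_symm (I := 𝓘(ℝ, Model n)) p).domRestrict.measurable hA
  have h2 := (isOpen_extChartAt_target (I := 𝓘(ℝ, Model n)) p).measurableSet.subtype_image h1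
  convert h2 using 1
  ext y
  simp [and_comm]

omit [IsManifold 𝓘(ℝ, Model n) ∞ M] hB in
theorem chartVolume_apply (B : BilinField n M) (p : M) {A : Set M} (hA : MeasurableSet A) :
    chartVolume B p A = ∫⁻ y in (φ p).target ∩ (φ p).symm ⁻¹' A,
      ENNReal.ofReal (density (gram B p) y) := by
  have ht := (isOpen_extChartAt_target (I := 𝓘(ℝ, Model n)) p).measurableSet
  have hm : AEMeasurable (φ p).symm ((volume.restrict (φ p).target).withDensity
      fun y => ENNReal.ofReal (Real.sqrt (gram B p y).det)) :=
    ((continuousOn_extChartAt_symm p).aemeasurable ht).mono_ac (withDensity_absolutelyContinuous _ _)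
  rw [chartVolume, Measure.map_apply_of_aemeasurable hm hA, withDensity_apply', Measure.restrict_restrict' ht,
    Set.inter_comm]
  rfl

omit hB in
/-- The volume measures of two charts agree on the intersection of their domains. -/
theorem chartVolume_apply_eq (B : BilinField n M) (p p' : M) {A : Set M} (hA : MeasurableSet A)
    (hp : A ⊆ (φ p).source) (hp' : A ⊆ (φ p').source) :
    chartVolume B p A = chartVolume B p' A := by
  rw [chartVolume_apply B p hA, chartVolume_apply B p' hA]
  have hs : (φ p).target ∩ (φ p).symm ⁻¹' A ⊆ overlap p p' := fun y hy => ⟨hy.1, hp' hy.2⟩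
  have himg : (φ p').target ∩ (φ p').symm ⁻¹' A =
      transition p p' '' ((φ p).target ∩ (φ p).symm ⁻¹' A) := by
    ext z
    constructor
    · intro hz
      have hz' : z ∈ overlap p' p := ⟨hz.1, hp hz.2⟩
      refine ⟨transition p' p z, ⟨(transition_mem_overlap hz').1, ?_⟩, transition_transition hz'⟩
      rw [Set.mem_preimage, transition, (φ p).left_inv hz'.2]; exact hz.2
    · rintro ⟨y, hy, rfl⟩
      refine ⟨(transition_mem_overlap (hs hy)).1, ?_⟩
      rw [Set.mem_preimage, transition, (φ p').left_inv (hs hy).2]; exact hy.2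
  -- Change of variables along the transition map: its Jacobian is the factor relating the two
  -- densities √det.
  rw [himg, lintegral_image_eq_lintegral_abs_det_fderiv_mul volume (measurableSet_target_inter p hA)
    (fun y hy => (hasFDerivAt_transition (hs hy)).hasFDerivWithinAt)
    (fun y hy z hz h => by
      rw [← transition_transition (hs hy), h, transition_transition (hs hz)])]
  refine setLIntegral_congr_fun (measurableSet_target_inter p hA) fun y hy => ?_
  rw [← ENNReal.ofReal_mul (abs_nonneg _), density, density, det_gram_transition B (hs hy),
    Real.sqrt_mul (sq_nonneg _), Real.sqrt_sq_eq_abs]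

omit [IsManifold 𝓘(ℝ, Model n) ∞ M] hB in
theorem chartVolume_inter_source (B : BilinField n M) (p : M) {A : Set M} (hA : MeasurableSet A) :
    chartVolume B p (A ∩ (φ p).source) = chartVolume B p A := by
  rw [chartVolume_apply B p hA, chartVolume_apply B p (hA.inter (isOpen_source p).measurableSet)]
  congr 2
  ext y
  simp only [Set.mem_inter_iff, Set.mem_preimage]
  exact ⟨fun h => ⟨h.1, h.2.1⟩, fun h => ⟨h.1, h.2, (φ p).map_target h.1⟩⟩

omit hB in
theorem riemVolume_apply (B : BilinField n M) (p : M) {A : Set M} (hA : MeasurableSet A) (hp : A ⊆ (φ p).source) :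
    riemVolume B A = chartVolume B p A := by
  refine le_antisymm ?_ (le_iSup (chartVolume B) p A)
  have hS := (isOpen_source (n := n) p).measurableSet
  -- It suffices to bound each chart measure. Inside the domain at p it is at most the measure of
  -- that chart, by agreement on overlaps; outside it is at most the supremum. For A inside the
  -- domain the second summand vanishes.
  have h1 : riemVolume B ≤ chartVolume B p + (riemVolume B).restrict (φ p).sourceᶜ := by
    refine iSup_le fun p' => Measure.le_iff.2 fun s hs => ?_
    have hS' := (isOpen_source (n := n) p').measurableSet
    rw [← measure_inter_add_sdiff s hS, Measure.add_apply, Measure.restrict_apply hs]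
    refine add_le_add ?_ (le_iSup (chartVolume B) p' _)
    rw [← chartVolume_inter_source B p' (hs.inter hS), ← chartVolume_apply_eq B p p'
      ((hs.inter hS).inter hS') (fun q hq => hq.1.2) fun q hq => hq.2]
    exact measure_mono fun q hq => hq.1.1
  refine (h1 A).trans ?_
  rw [Measure.add_apply, Measure.restrict_apply hA, show A ∩ (φ p).sourceᶜ = ∅ from
    Set.disjoint_iff_inter_eq_empty.1 (Set.disjoint_compl_right_iff_subset.2 hp)]
  simp

omit hB in
theorem restrict_riemVolume (B : BilinField n M) (p : M) {K : Set M} (hK : MeasurableSet K) (hp : K ⊆ (φ p).source) :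
    (riemVolume B).restrict K = (chartVolume B p).restrict K := by
  ext A hA
  rw [Measure.restrict_apply hA, Measure.restrict_apply hA,
    riemVolume_apply B p (hA.inter hK) (Set.inter_subset_right.trans hp)]

/-- The energy over a subset of a chart domain, in coordinates. -/
theorem energyOn_eq (p : M) {K : Set (Model n)} (hK : MeasurableSet ((φ p).symm '' K))
    (hKm : MeasurableSet K) (hKt : K ⊆ (φ p).target) :
    energyOn ((φ p).symm '' K) B =
      ∫ y in K, scalarCoord (gram B p) y ^ 2 * density (gram B p) y := by
  have ht := (isOpen_extChartAt_target (I := 𝓘(ℝ, Model n)) p).measurableSet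
  have hKs : (φ p).symm '' K ⊆ (φ p).source := by
    rintro _ ⟨y, hy, rfl⟩; exact (φ p).map_target (hKt hy)
  have hpre : (φ p).symm ⁻¹' ((φ p).symm '' K) ∩ (φ p).target = K := by
    ext y
    constructor
    · rintro ⟨⟨z, hz, hzy⟩, hy⟩
      rwa [← (φ p).symm.injOn (hKt hz) hy hzy]
    · exact fun hy => ⟨⟨y, hy, rfl⟩, hKt hy⟩
  have hm : AEMeasurable (φ p).symm ((volume.restrict (φ p).target).withDensity
      fun y => ENNReal.ofReal (Real.sqrt (gram B p y).det)) :=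
    ((continuousOn_extChartAt_symm p).aemeasurable ht).mono_ac (withDensity_absolutelyContinuous _ _)
  have hs : AEStronglyMeasurable (fun q => scalarCurv B q ^ 2)
      ((chartVolume B p).restrict ((φ p).symm '' K)) :=
    (((hB.continuousOn_scalarCurv p).pow 2).mono hKs).aestronglyMeasurable hK
  have hd : ContinuousOn (density (gram B p)) K :=
    (((hB.metricOn p).density_smooth fun y hy => hB.det_gram_pos p hy).continuousOn).mono hKt
  rw [energyOn, restrict_riemVolume B p hK hKs]
  rw [chartVolume, Measure.restrict_map_of_aemeasurable hm hK] at hs ⊢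
  rw [integral_map (hm.mono_measure Measure.restrict_le_self) hs, restrict_withDensity',
    Measure.restrict_restrict' ht, hpre, integral_withDensity_eq_integral_toReal_smul₀]
  · refine setIntegral_congr_fun hKm fun y hy => ?_
    simp only [smul_eq_mul]
    rw [ENNReal.toReal_ofReal (Real.sqrt_nonneg _), hB.scalarCurv_eq ((φ p).map_target (hKt hy)),
      (φ p).right_inv (hKt hy), mul_comm]
    rfl
  · exact (hd.aemeasurable hKm).ennreal_ofReal
  · exact Filter.Eventually.of_forall fun _ => ENNReal.ofReal_lt_top

end MetricField

end MetricField

/-! ### The Euler-Lagrange equation of a critical metric -/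

section Critical

open MeasureTheory

variable {n : ℕ} {M : Type*} [TopologicalSpace M] [ChartedSpace (Model n) M]

local notation "φ" => extChartAt 𝓘(ℝ, Model n)

/-- Invariance under coordinate changes, applied to the identity map. -/
theorem MetricOn.scalarCoord_congr {U : Set (Model n)} {G G' : Model n → Matrix (Fin n) (Fin n) ℝ}
    (h : MetricOn U G) (hU : IsOpen U) (hG : ∀ y ∈ U, G y = G' y) {y : Model n} (hy : y ∈ U) :
    scalarCoord G y = scalarCoord G' y :=
  have h' : MetricOn U G' :=
    { smooth := fun i j => (h.smooth i j).congr fun z hz => by rw [hG z hz]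
      symm := fun z hz => hG z hz ▸ h.symm z hz
      det_ne := fun z hz => hG z hz ▸ h.det_ne z hz }
  scalarCoord_comp (τ := id) hU hU h' h contDiffOn_id (Set.mapsTo_id _)
    (fun z hz v w => by rw [hG z hz, fderiv_id]; rfl) hy

/-- The tube lemma gives one time interval for the compact support of u; off the support the metric
does not change. -/
theorem eventually_det_varMetric_pos {U : Set (Model n)} {G : Model n → Matrix (Fin n) (Fin n) ℝ}
    (h : MetricOn U G) (hU : IsOpen U) (hpos : ∀ y ∈ U, 0 < (G y).det) {u : Model n → ℝ}
    (hu : ContDiffOn ℝ ∞ u U) (hc : HasCompactSupport u) (hs : tsupport u ⊆ U) (ℓ : Fin n → ℝ) :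
    ∀ᶠ t in nhds (0 : ℝ), ∀ y ∈ U, 0 < (varMetric G u ℓ t y).det := by
  obtain ⟨I, V, hI, -, h0I, hKV, hIV⟩ := generalized_tube_lemma (isCompact_singleton (x := (0 : ℝ)))
    hc (h.isOpen_varDomain (ℓ := ℓ) hU hu)
    (by rintro ⟨t, y⟩ ⟨rfl, hy⟩; exact MetricOn.zero_mem_varDomain hpos (hs hy))
  filter_upwards [hI.mem_nhds (h0I rfl)] with t ht y hy
  by_cases hyu : y ∈ tsupport u
  · exact (hIV (show (t, y) ∈ I ×ˢ V from ⟨ht, hKV hyu⟩)).2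
  · have : varMetric G u ℓ t y = G y := by
      ext i j; simp [varMetric, image_eq_zero_of_notMem_tsupport hyu]
    rw [this]; exact hpos y hy

open Classical in
/-- The bilinear field with components `u ℓ ⊗ ℓ` in the chart at `p`. -/
def testField (p : M) (u : Model n → ℝ) (ℓ : Fin n → ℝ) : BilinField n M := fun q =>
  if q ∈ (φ p).source then
    u (φ p q) • ((∑ i, ℓ i • (EuclideanSpace.proj (𝕜 := ℝ) i : Model n →L[ℝ] ℝ)) ∘L
      dChart p q).smulRight ((∑ i, ℓ i • (EuclideanSpace.proj (𝕜 := ℝ) i : Model n →L[ℝ] ℝ)) ∘L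
      dChart p q)
  else 0

theorem gram_add_smul (B H : BilinField n M) (t : ℝ) (p : M) (y : Model n) (i j : Fin n) :
    gram (fun q => B q + t • H q) p y i j = gram B p y i j + t * gram H p y i j := rfl

theorem testField_apply {p q : M} (hq : q ∈ (φ p).source) (u : Model n → ℝ) (ℓ : Fin n → ℝ)
    (v w : Tan n q) : testField p u ℓ q v w =
      u (φ p q) * ((∑ i, ℓ i * dChart p q v i) * ∑ i, ℓ i * dChart p q w i) := by
  rw [testField, if_pos hq]
  simp

theorem testField_comm (p : M) (u : Model n → ℝ) (ℓ : Fin n → ℝ) (q : M) (v w : Tan n q) :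
    testField p u ℓ q v w = testField p u ℓ q w v := by
  by_cases hq : q ∈ (φ p).source
  · rw [testField_apply hq, testField_apply hq]; ring
  · rw [testField, if_neg hq]; rfl

theorem testField_eq_zero {p q : M} {u : Model n → ℝ} (ℓ : Fin n → ℝ)
    (hq : q ∉ (φ p).symm '' tsupport u) : testField p u ℓ q = 0 := by
  by_cases hq' : q ∈ (φ p).source
  · have : u (φ p q) = 0 := image_eq_zero_of_notMem_tsupport fun hu =>
      hq ⟨_, hu, (φ p).left_inv hq'⟩
    rw [testField, if_pos hq', this, zero_smul]
  · rw [testField, if_neg hq']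

variable [IsManifold 𝓘(ℝ, Model n) ∞ M]

theorem dChart_dSymm_self {p : M} {y : Model n} (hy : y ∈ (φ p).target) (v : Model n) :
    dChart p ((φ p).symm y) (dSymm p y v) = v := by
  have hy' : y ∈ overlap p p := ⟨hy, (φ p).map_target hy⟩
  have h2 : transition p p =ᶠ[nhds y] id :=
    Filter.eventually_of_mem ((isOpen_overlap p p).mem_nhds hy') fun z hz => (φ p).right_inv hz.1
  rw [dChart_dSymm hy', h2.fderiv_eq, fderiv_id]; rfl

theorem gram_testField {p : M} {y : Model n} (hy : y ∈ (φ p).target) (u : Model n → ℝ)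
    (ℓ : Fin n → ℝ) (i j : Fin n) : gram (testField p u ℓ) p y i j = u y * (ℓ i * ℓ j) := by
  change testField p u ℓ _ (dSymm p y (stdVec i)) (dSymm p y (stdVec j)) = _
  rw [testField_apply ((φ p).map_target hy), dChart_dSymm_self hy, dChart_dSymm_self hy,
    (φ p).right_inv hy]
  simp

theorem smoothField_iff {B : BilinField n M} : SmoothField B ↔
    ∀ p i j, ContDiffOn ℝ ∞ (fun y => gram B p y i j) (φ p).target := by
  refine ⟨fun h p => (smoothOn_iff B p).1 h.contMDiffOn, fun h p => ?_⟩
  exact ((smoothOn_iff B p).2 (h p)).contMDiffAt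
    ((isOpen_source p).mem_nhds (mem_extChartAt_source p))

/-- In a Hausdorff space the compact image of the support is closed, so the extension by zero is
smooth outside the chart domain as well. -/
theorem smoothField_testField [T2Space M] (p : M) {u : Model n → ℝ} (hu : ContDiff ℝ ∞ u)
    (hc : HasCompactSupport u) (hs : tsupport u ⊆ (φ p).target) (ℓ : Fin n → ℝ) :
    SmoothField (testField p u ℓ) := by
  intro q
  by_cases hq : q ∈ (φ p).source
  · exact ((smoothOn_iff (testField p u ℓ) p).2 fun i j =>
      (hu.contDiffOn.mul contDiffOn_const).congr fun y hy => gram_testField hy u ℓ i j).contMDiffAt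
      ((isOpen_source p).mem_nhds hq)
  · have hK : IsCompact ((φ p).symm '' tsupport u) :=
      IsCompact.image_of_continuousOn hc ((continuousOn_extChartAt_symm p).mono hs)
    have hqK : q ∉ (φ p).symm '' tsupport u := by
      rintro ⟨y, hy, rfl⟩; exact hq ((φ p).map_target (hs hy))
    refine ((Bundle.contMDiff_zeroSection ℝ
      (fun p : M => Tan n p →L[ℝ] Tan n p →L[ℝ] ℝ)).contMDiffAt (x := q)).congr_of_eventuallyEq ?_
    filter_upwards [hK.isClosed.isOpen_compl.mem_nhds hqK] with x hx
    rw [testField_eq_zero ℓ hx]; rfl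

theorem metricField_inner (g : SmoothMetric n M) : MetricField g.inner where
  smooth := g.contMDiff
  symm := g.symm
  det_pos p := by
    refine Matrix.PosDef.det_pos (Matrix.PosDef.of_dotProduct_mulVec_pos ?_ ?_)
    · ext i j
      exact g.symm _ _ _
    · intro x hx
      have h1 := bil_gram g.inner p (φ p p) (WithLp.toLp 2 x) (WithLp.toLp 2 x)
      have h2 : dSymm p (φ p p) (WithLp.toLp 2 x) ≠ 0 := by
        intro h0
        have := dChart_dSymm_self (mem_extChartAt_target p) (WithLp.toLp 2 x)
        rw [h0, map_zero] at this
        exact hx (by ext i; simpa using congrArg (fun v : Model n => v i) this.symm)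
      have h3 := g.pos _ _ h2
      rw [← h1, bil_apply] at h3
      refine h3.trans_eq ?_
      simp only [dotProduct, Matrix.mulVec, Finset.mul_sum, Pi.star_apply, star_trivial]
      exact Finset.sum_congr rfl fun i _ => Finset.sum_congr rfl fun j _ => by ring

/-- Curvature and density need only a positive determinant, so definiteness need not be followed
along the variation. -/
theorem metricField_add_smul (g : SmoothMetric n M) {H : BilinField n M} (hH : SmoothField H)
    (hHs : ∀ p v w, H p v w = H p w v) {t : ℝ}
    (hpos : ∀ q, 0 < (gram (fun q => g.inner q + t • H q) q (φ q q)).det) :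
    MetricField (fun q => g.inner q + t • H q) where
  smooth := smoothField_iff.2 fun p i j =>
    ((smoothField_iff.1 g.contMDiff p i j).add
      (contDiffOn_const.mul (smoothField_iff.1 hH p i j))).congr
      fun y _ => gram_add_smul g.inner H t p y i j
  symm p v w := by
    change g.inner p v w + t * H p v w = g.inner p w v + t * H p w v
    rw [g.symm, hHs]
  det_pos := hpos

variable [T2Space M] [MeasurableSpace M] [BorelSpace M]

/-- Criticality is applied to `testField` with K the image of the support of u; for small t the
energy over K is the coordinate integral. -/
theorem IsCritical.hasDerivAt_integral {g : SmoothMetric n M} (hg : IsCritical g) (p : M)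
    {u : Model n → ℝ} (hu : ContDiff ℝ ∞ u) (hc : HasCompactSupport u)
    (hs : tsupport u ⊆ (φ p).target) (ℓ : Fin n → ℝ) :
    HasDerivAt (fun t => ∫ y in tsupport u, scalarCoord (varMetric (gram g.inner p) u ℓ t) y ^ 2
      * density (varMetric (gram g.inner p) u ℓ t) y) 0 0 := by
  have hK : IsCompact ((φ p).symm '' tsupport u) :=
    IsCompact.image_of_continuousOn hc ((continuousOn_extChartAt_symm p).mono hs)
  have hU := isOpen_extChartAt_target (I := 𝓘(ℝ, Model n)) p
  have hgm := metricField_inner g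
  have hH := smoothField_testField p hu hc hs ℓ
  have h1 := hg (testField p u ℓ) hH (testField_comm p u ℓ) _ hK
    fun q hq => testField_eq_zero ℓ hq
  refine h1.congr_of_eventuallyEq ?_
  filter_upwards [eventually_det_varMetric_pos (hgm.metricOn p) hU
    (fun y hy => hgm.det_gram_pos p hy) hu.contDiffOn hc hs ℓ] with t ht
  set B : BilinField n M := fun q => g.inner q + t • testField p u ℓ q with hBdef
  have hv : ∀ y ∈ (φ p).target, gram B p y = varMetric (gram g.inner p) u ℓ t y := fun y hy => by
    ext i j
    rw [hBdef, gram_add_smul, gram_testField hy]; rfl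
  have hB : MetricField B := by
    refine metricField_add_smul g hH (testField_comm p u ℓ) fun q => ?_
    -- Positivity is required in the chart at q, while it is known in the chart at p. On the domain
    -- of the latter it is carried over by the transition map; elsewhere the test field is zero.
    by_cases hq : q ∈ (φ p).source
    · have hqo : φ q q ∈ overlap q p :=
        ⟨mem_extChartAt_target q, by rw [Set.mem_preimage, extChartAt_to_inv]; exact hq⟩
      have hqt : transition q p (φ q q) ∈ (φ p).target := (φ p).map_source hqo.2
      rw [det_gram_transition _ hqo, hv _ hqt]
      exact mul_pos (by have := det_fderiv_transition_ne_zero hqo; positivity) (ht _ hqt)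
    · have h0 : gram (fun q => g.inner q + t • testField p u ℓ q) q (φ q q)
          = gram g.inner q (φ q q) := by
        have h0' : testField p u ℓ ((φ q).symm (φ q q)) = 0 := by
          rw [extChartAt_to_inv, testField, if_neg hq]
        ext i j
        have h1' : gram (testField p u ℓ) q (φ q q) i j = 0 := by
          change testField p u ℓ _ (dSymm q _ (stdVec i)) (dSymm q _ (stdVec j)) = 0
          rw [h0']; rfl
        rw [gram_add_smul, h1', mul_zero, add_zero]
      rw [h0]; exact hgm.det_pos q
  rw [hB.energyOn_eq p hK.measurableSet hc.measurableSet hs]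
  refine setIntegral_congr_fun hc.measurableSet fun y hy => ?_
  simp only [← (hB.metricOn p).scalarCoord_congr hU hv (hs hy), density, ← hv y (hs hy)]

/-- The Euler-Lagrange equation of `∫ R²` in the chart at `p`. -/
theorem IsCritical.scalarCoord_mul_ricciCoord {g : SmoothMetric n M} (hg : IsCritical g) (p : M)
    {y : Model n} (hy : y ∈ (φ p).target) (i j : Fin n) :
    scalarCoord (gram g.inner p) y * ricciCoord (gram g.inner p) i j y =
      hessianCoord (gram g.inner p) (scalarCoord (gram g.inner p)) i j y
      + (scalarCoord (gram g.inner p) y ^ 2 / 4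
        - laplaceCoord (gram g.inner p) (scalarCoord (gram g.inner p)) y)
        * gram g.inner p y i j := by
  have hgm := metricField_inner g
  have hU := isOpen_extChartAt_target (I := 𝓘(ℝ, Model n)) p
  have hpos : ∀ y ∈ (φ p).target, 0 < (gram g.inner p y).det := fun y hy => hgm.det_gram_pos p hy
  exact (hgm.metricOn p).scalarCoord_mul_ricciCoord hU hpos hy
    (fun ℓ => (hgm.metricOn p).eulerLagrange_eq_zero hU hpos ℓ
      (fun u hu hc hs => hg.hasDerivAt_integral p hu hc hs ℓ) hy) i j

end Critical

/-! ### The conformal metric `|R|^{2k} g` -/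

section Conformal

variable {n : ℕ} {M : Type*} [TopologicalSpace M] [ChartedSpace (Model n) M]

local notation "φ" => extChartAt 𝓘(ℝ, Model n)

variable [IsManifold 𝓘(ℝ, Model n) ∞ M]

omit [IsManifold 𝓘(ℝ, Model n) ∞ M] in
theorem diff_congr (f : M → ℝ) {q q' : M} (h : q = q') (v : Model n) :
    diff f q (v : Tan n q) = diff f q' (v : Tan n q') := by
  subst h; rfl

theorem contMDiff_of_contDiffOn {F : M → ℝ} (h : ∀ p, ContDiffOn ℝ ∞ (F ∘ (φ p).symm) (φ p).target) :
    ContMDiff 𝓘(ℝ, Model n) 𝓘(ℝ, ℝ) ∞ F := by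
  intro p
  have h1 := (contMDiffOn_iff_contDiffOn.2 (h p)).comp
    (contMDiffOn_extChartAt (n := ∞) (x := p)) fun q hq =>
      (φ p).map_source (by rwa [extChartAt_source])
  rw [← extChartAt_source 𝓘(ℝ, Model n) p] at h1
  exact (h1.congr fun q hq => by simp only [Function.comp, (φ p).left_inv hq]).contMDiffAt
    ((isOpen_source p).mem_nhds (mem_extChartAt_source p))

/-- The identification of the tangent space at p with ℝⁿ is the one given by the chart at p, whose
derivative there is the identity. -/
theorem comp_apply_eq (p : M) (v : Tan n p) (i : Fin n) : comp p v i = (show Model n from v) i := by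
  rw [comp, mfderiv_extChartAt_self]; rfl

theorem dSymm_self (p : M) (v : Model n) : (dSymm p (φ p p) v : Model n) = v := by
  have := mfderivWithin_range_extChartAt_symm (I := 𝓘(ℝ, Model n)) (x := p)
  simp only [modelWithCornersSelf_coe, Set.range_id, mfderivWithin_univ] at this
  exact congrArg (fun L : Model n →L[ℝ] Model n => L v) this

/-- A bilinear form at `p`, through its components in the chart at `p`. -/
theorem sum_gram_comp (B : BilinField n M) (p : M) (v w : Tan n p) :
    ∑ i, ∑ j, gram B p (φ p p) i j * comp p v i * comp p w j = B p v w := by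
  have h2 := bil_gram B p (φ p p) (show Model n from v) (show Model n from w)
  rw [bil_apply] at h2
  simp only [comp_apply_eq]
  refine h2.trans ((bilinField_congr B (extChartAt_to_inv p) _ _).trans ?_)
  rw [dSymm_self, dSymm_self]

theorem diff_eq_sum {f : M → ℝ} (hf : ContMDiff 𝓘(ℝ, Model n) 𝓘(ℝ, ℝ) ∞ f) (p : M) (v : Tan n p) :
    diff f p v = ∑ i, pd i (f ∘ (φ p).symm) (φ p p) * comp p v i := by
  have h1 := mfderiv_comp (φ p p) (hf.mdifferentiableAt (by simp))
    (mdifferentiableAt_symm (mem_extChartAt_target p))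
  have h2 := fderiv_eq_sum_pd (f ∘ (φ p).symm) (φ p p) (show Model n from v)
  rw [← mfderiv_eq_fderiv] at h2
  simp only [comp_apply_eq, mul_comm (pd _ _ _)]
  refine Eq.trans ?_ h2
  refine Eq.trans ?_ (congrArg (fun L : Model n →L[ℝ] ℝ => L (show Model n from v)) h1).symm
  change diff f p v = diff f ((φ p).symm (φ p p)) (dSymm p (φ p p) (show Model n from v))
  rw [show dSymm p (φ p p) (show Model n from v) = (show Model n from v) from dSymm_self p _]
  exact diff_congr f (extChartAt_to_inv p).symm _

/-- The conformal metric `c g`. -/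
def conformalMetric (g : SmoothMetric n M) (c : M → ℝ) (hc : ∀ p, 0 < c p)
    (hs : ContMDiff 𝓘(ℝ, Model n) 𝓘(ℝ, ℝ) ∞ c) : SmoothMetric n M where
  inner p := c p • g.inner p
  symm p v w := by
    change c p * g.inner p v w = c p * g.inner p w v
    rw [g.symm]
  pos p v hv := mul_pos (hc p) (g.pos p v hv)
  isVonNBounded p := by
    -- The unit ball of c g is contained in the unit ball of g scaled by c^{−1/2}.
    refine ((g.isVonNBounded p).image
      ((Real.sqrt (c p))⁻¹ • ContinuousLinearMap.id ℝ (Tan n p))).subset fun v hv => ?_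
    have h0 := Real.sqrt_pos.2 (hc p)
    refine ⟨Real.sqrt (c p) • v, ?_, by simp [smul_smul, h0.ne']⟩
    change g.inner p (Real.sqrt (c p) • v) (Real.sqrt (c p) • v) < 1
    rw [map_smul, map_smul, smul_apply, smul_eq_mul, smul_eq_mul, ← mul_assoc,
      Real.mul_self_sqrt (hc p).le]
    exact hv
  contMDiff := by
    refine smoothField_iff.2 fun p i j => ?_
    exact (contMDiffOn_iff_contDiffOn.1 (hs.comp_contMDiffOn
      (contMDiffOn_extChartAt_symm (n := ∞) p))).mul (smoothField_iff.1 g.contMDiff p i j)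

end Conformal

end QuadCurv

end

/-! ### Assembly of the quasi-Einstein equation on the manifold -/

theorem proposition2p3 (n : ℕ) (hn : 5 ≤ n)
    {M : Type*} [TopologicalSpace M] [T2Space M] [SecondCountableTopology M]
    [ChartedSpace (QuadCurv.Model n) M] [IsManifold 𝓘(ℝ, QuadCurv.Model n) ∞ M]
    [MeasurableSpace M] [BorelSpace M]
    (g : QuadCurv.SmoothMetric n M) (hg : QuadCurv.IsCritical g)
    (hR : ∀ p, QuadCurv.scalarCurv g.inner p < 0)
    (k : ℝ) (hk0 : k ≠ 0) (hk1 : k ≠ 1 / ((n : ℝ) - 2))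
    (f : M → ℝ)
    (hf : ∀ p, f p = (((n : ℝ) - 2) * k - 1) * Real.log |QuadCurv.scalarCurv g.inner p|) :
    ContMDiff 𝓘(ℝ, QuadCurv.Model n) 𝓘(ℝ, ℝ) ∞ f ∧
    ∃ g' : QuadCurv.SmoothMetric n M,
      (∀ p, g'.inner p = (|QuadCurv.scalarCurv g.inner p| ^ (2 * k) : ℝ) • g.inner p) ∧
      ∀ (p : M) (v w : QuadCurv.Tan n p),
        QuadCurv.ricci g'.inner p v w + QuadCurv.hessian g'.inner f p v w
            - (1 + 2 * k - ((n : ℝ) - 2) * k ^ 2) / (((n : ℝ) - 2) * k - 1) ^ 2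
              * (QuadCurv.diff f p v * QuadCurv.diff f p w)
          = (((n : ℝ) - 4) * k - 3) / (4 * ((n : ℝ) - 1))
              * Real.exp ((1 - 2 * k) / (((n : ℝ) - 2) * k - 1) * f p) * g'.inner p v w := by
  have hn' : (5 : ℝ) ≤ n := by exact_mod_cast hn
  have hk : ((n : ℝ) - 2) * k - 1 ≠ 0 := by
    intro h
    exact hk1 (by rw [eq_div_iff (by linarith)]; linarith)
  have hgm := QuadCurv.metricField_inner g
  have hU := fun p => isOpen_extChartAt_target (I := 𝓘(ℝ, QuadCurv.Model n)) (M := M) p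
  have hsc : ∀ p, ∀ y ∈ (extChartAt 𝓘(ℝ, QuadCurv.Model n) p).target,
      QuadCurv.scalarCurv g.inner ((extChartAt 𝓘(ℝ, QuadCurv.Model n) p).symm y) =
        QuadCurv.scalarCoord (QuadCurv.gram g.inner p) y := fun p y hy => by
    rw [hgm.scalarCurv_eq (PartialEquiv.map_target _ hy), PartialEquiv.right_inv _ hy]
  have hneg : ∀ p, ∀ y ∈ (extChartAt 𝓘(ℝ, QuadCurv.Model n) p).target,
      QuadCurv.scalarCoord (QuadCurv.gram g.inner p) y < 0 := fun p y hy => by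
    rw [← hsc p y hy]; exact hR _
  have hRs := fun p => (hgm.metricOn p).scalarCoord_smooth (hU p)
  have habs : ∀ p, ContDiffOn ℝ ∞ (fun y => |QuadCurv.scalarCoord (QuadCurv.gram g.inner p) y|)
      (extChartAt 𝓘(ℝ, QuadCurv.Model n) p).target := fun p =>
    (hRs p).neg.congr fun y hy => abs_of_neg (hneg p y hy)
  have hfs : ContMDiff 𝓘(ℝ, QuadCurv.Model n) 𝓘(ℝ, ℝ) ∞ f :=
    QuadCurv.contMDiff_of_contDiffOn fun p =>
      (contDiffOn_const.mul ((habs p).log fun y hy => (abs_pos.2 (hneg p y hy).ne).ne')).congr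
        fun y hy => by rw [Function.comp, hf, hsc p y hy]
  have hcs : ContMDiff 𝓘(ℝ, QuadCurv.Model n) 𝓘(ℝ, ℝ) ∞
      fun p => |QuadCurv.scalarCurv g.inner p| ^ (2 * k) :=
    QuadCurv.contMDiff_of_contDiffOn fun p =>
      ((habs p).rpow_const_of_ne fun y hy => (abs_pos.2 (hneg p y hy).ne).ne').congr
        fun y hy => by rw [Function.comp, hsc p y hy]
  refine ⟨hfs, QuadCurv.conformalMetric g _ (fun p => Real.rpow_pos_of_pos
    (abs_pos.2 (hR p).ne) _) hcs, fun p => rfl, fun p v w => ?_⟩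
  set g' := QuadCurv.conformalMetric g _ (fun p => Real.rpow_pos_of_pos
    (abs_pos.2 (hR p).ne) (2 * k)) hcs with hg'
  have hgm' := QuadCurv.metricField_inner g'
  have hy := mem_extChartAt_target (I := 𝓘(ℝ, QuadCurv.Model n)) p
  have key := QuadCurv.quasiEinstein_coord (by linarith : (n : ℝ) ≠ 1) (hU p) (hgm.metricOn p)
    (hgm'.metricOn p) (hneg p) hk
    (fun y hy => by
      rw [← hsc p y hy]; rfl)
    (F := f ∘ (extChartAt 𝓘(ℝ, QuadCurv.Model n) p).symm)
    (fun y hy => by rw [Function.comp, hf, hsc p y hy]) hy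
    (hg.scalarCoord_mul_ricciCoord p hy)
  rw [← QuadCurv.sum_gram_comp g'.inner p v w, QuadCurv.diff_eq_sum hfs,
    QuadCurv.diff_eq_sum hfs, QuadCurv.ricci, QuadCurv.hessian, Finset.sum_mul_sum]
  -- Every tensor is now expanded in the components of v and w in the chart at p, so the coordinate
  -- identity at the centre of that chart applies term by term.
  simp only [Finset.mul_sum, ← Finset.sum_add_distrib, ← Finset.sum_sub_distrib]
  refine Finset.sum_congr rfl fun i _ => Finset.sum_congr rfl fun j _ => ?_
  have h1 := key i j
  rw [Function.comp_apply, extChartAt_to_inv] at h1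
  linear_combination (QuadCurv.comp p v i * QuadCurv.comp p w j) * h1
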